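/- Work in $\mathrm{ZFC}$. Formulas are those of the first-order language $\{\in\}$, and the Lévy hierarchy is defined as usual: $\Sigma_0=\Pi_0$ formulas are those with bounded quantifiers only, a $\Sigma_{m+1}$ (resp. $\Pi_{m+1}$) formula is a finite block of existential (resp. universal) quantifiers followed by a $\Pi_m$ (resp. $\Sigma_m$) formula. For $m<\omega$, let $C^{(m)}$ be the class of all ordinals $\alpha$ such that $V_\alpha\prec_{\Sigma_m}V$, i.e. every $\Sigma_m$ formula with parameters in $V_\alpha$ holds in $V_\alpha$ if and only if it holds in $V$. For an elementary embedding $j:V_\alpha\to V_\beta$, its critical point $\mathrm{cp}(j)$ is the least ordinal $\gamma<\alpha$ with $j(\gamma)\neq\gamma$, if there is one. A cardinal $\kappa$ is *extendible* if for every ordinal $\lambda>\kappa$ there are an ordinal $\mu$ and an elementary embedding $j:V_\lambda\to V_\mu$ with $\mathrm{cp}(j)=\kappa$ and $j(\kappa)>\lambda$. It is *$C^{(n)}$-extendible* if for every ordinal $\lambda>\kappa$ there are such $\mu$ and $j$ with, in addition, $j(\kappa)\in C^{(n)}$. For $m\ge 1$, an ordinal $\delta$ is *$\Sigma_m$-supercompact*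 if for every $\lambda>\delta$ in $C^{(m)}$ and every $a\in V_\lambda$ there exist ordinals $\bar\delta<\bar\lambda<\delta$ with $\bar\lambda\in C^{(m)}$, a set $\bar a\in V_{\bar\lambda}$, and an elementary embedding $j:V_{\bar\lambda}\to V_\lambda$ such that $\mathrm{cp}(j)=\bar\delta$, $j(\bar\delta)=\delta$ and $j(\bar a)=a$. **Theorem.** Let $\delta$ be an ordinal. For every $n\geq 1$, $\delta$ is a $C^{(n)}$-extendible cardinal if and only if $\delta$ is $\Sigma_{n+1}$-supercompact. In particular, $\delta$ is an extendible cardinal if and only if $\delta$ is $\Sigma_2$-supercompact. -/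

import Mathlib

open FirstOrder FirstOrder.Language Ordinal
open scoped ZFSet

universe u v

/-- The only non-logical symbol of the language of set theory is a binary relation symbol. -/
inductive MemRel : ℕ → Type
  | mem : MemRel 2

/-- The first-order language of set theory `{∈}` (with equality). -/
def setLang : FirstOrder.Language.{0, 0} where
  Functions := fun _ => Empty
  Relations := MemRel

/-- The membership symbol. -/
def memSymbol : setLang.Relations 2 := MemRel.mem

/-- The universe of sets as a structure for the language of set theory. -/
instance universeStructure : setLang.Structure ZFSet.{u} where
  funMap := fun f => f.elim
  RelMap := fun {_} r =>
    match r with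
    | MemRel.mem => fun v => v 0 ∈ v 1

/-- Every set `M`, with the restriction of membership, is a structure for the language of set
theory; it is used for the levels `V_ α` of the cumulative hierarchy. -/
instance setStructure (M : ZFSet.{u}) : setLang.Structure M where
  funMap := fun f => f.elim
  RelMap := fun {_} r =>
    match r with
    | MemRel.mem => fun v => (v 0 : ZFSet.{u}) ∈ (v 1 : ZFSet.{u})

/-- The atomic formula `s ∈ t`. -/
def memFormula {A : Type v} {k : ℕ} (s t : setLang.Term (A ⊕ Fin k)) :
    setLang.BoundedFormula A k :=
  Relations.boundedFormula₂ memSymbol s t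

/-- The bounded quantification `∀ x ∈ t, φ(x)`, that is, `∀ x (x ∈ t → φ(x))`. The quantified
variable `x` is the one with index `k`, and `t` does not mention it. -/
def ballFormula {A : Type v} {k : ℕ} (t : setLang.Term (A ⊕ Fin k))
    (φ : setLang.BoundedFormula A (k + 1)) : setLang.BoundedFormula A k :=
  BoundedFormula.all
    (BoundedFormula.imp
      (memFormula (Term.var (Sum.inr (Fin.last k))) (t.relabel (Sum.map id Fin.castSucc))) φ)

/-- `Δ₀` formulas: built from atomic formulas with the propositional connectives (`⊥` and `→`
generate them all) and bounded quantifiers (`∃ x ∈ t, φ` is `¬ ∀ x ∈ t, ¬ φ`). -/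
inductive IsDeltaZero {A : Type v} : ∀ {k : ℕ}, setLang.BoundedFormula A k → Prop
  | falsum {k : ℕ} : IsDeltaZero (BoundedFormula.falsum : setLang.BoundedFormula A k)
  | equal {k : ℕ} (s t : setLang.Term (A ⊕ Fin k)) : IsDeltaZero (BoundedFormula.equal s t)
  | mem {k : ℕ} (s t : setLang.Term (A ⊕ Fin k)) : IsDeltaZero (memFormula s t)
  | imp {k : ℕ} {φ ψ : setLang.BoundedFormula A k} :
      IsDeltaZero φ → IsDeltaZero ψ → IsDeltaZero (BoundedFormula.imp φ ψ)
  | ball {k : ℕ} (t : setLang.Term (A ⊕ Fin k)) {φ : setLang.BoundedFormula A (k + 1)} :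
      IsDeltaZero φ → IsDeltaZero (ballFormula t φ)

/-- The two sides `Σ` and `Π` of the Lévy hierarchy. -/
inductive LevySide : Type
  | sigma
  | pi

/-- The Lévy hierarchy: `IsLevy .sigma n φ` says that `φ` is a `Σ_n` formula, `IsLevy .pi n φ` that
it is a `Π_n` formula. `Σ_0 = Π_0 = Δ₀`; a `Σ_{n+1}` formula is a (possibly empty) block of
existential quantifiers followed by a `Π_n` formula, and a `Π_{n+1}` formula is a (possibly empty)
block of universal quantifiers followed by a `Σ_n` formula. -/
inductive IsLevy {A : Type v} :
    LevySide → ℕ → ∀ {k : ℕ}, setLang.BoundedFormula A k → Prop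
  | deltaZero (s : LevySide) {k : ℕ} {φ : setLang.BoundedFormula A k} :
      IsDeltaZero φ → IsLevy s 0 φ
  | sigma_of_pi {n k : ℕ} {φ : setLang.BoundedFormula A k} :
      IsLevy .pi n φ → IsLevy .sigma (n + 1) φ
  | ex {n k : ℕ} {φ : setLang.BoundedFormula A (k + 1)} :
      IsLevy .sigma (n + 1) φ → IsLevy .sigma (n + 1) φ.ex
  | pi_of_sigma {n k : ℕ} {φ : setLang.BoundedFormula A k} :
      IsLevy .sigma n φ → IsLevy .pi (n + 1) φ
  | all {n k : ℕ} {φ : setLang.BoundedFormula A (k + 1)} :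
      IsLevy .pi (n + 1) φ → IsLevy .pi (n + 1) φ.all

/-- The class `C^{(n)}` of the `Σ_n`-correct ordinals: those `α` for which `V_α` is a
`Σ_n`-elementary substructure of the universe. -/
def sigmaCorrect (n : ℕ) : Set Ordinal.{u} :=
  {α | ∀ (k : ℕ) (φ : setLang.Formula (Fin k)), IsLevy .sigma n φ →
    ∀ v : Fin k → (V_ α : ZFSet.{u}), φ.Realize v ↔ φ.Realize (fun i => (v i : ZFSet.{u}))}

/-- `Sends j x y` says that `x` belongs to the domain of `j : V_α → V_β` and `j(x) = y`. -/
def Sends {α β : Ordinal.{u}} (j : (V_ α : ZFSet.{u}) ↪ₑ[setLang] (V_ β : ZFSet.{u}))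
    (x y : ZFSet.{u}) : Prop :=
  ∃ hx : x ∈ V_ α, (j ⟨x, hx⟩ : ZFSet.{u}) = y

/-- `κ` is the critical point of `j : V_α → V_β`: the least ordinal in `V_α` (that is, the least
ordinal below `α`) which `j` moves. -/
def IsCriticalPoint {α β : Ordinal.{u}}
    (j : (V_ α : ZFSet.{u}) ↪ₑ[setLang] (V_ β : ZFSet.{u})) (κ : Ordinal.{u}) : Prop :=
  IsLeast {γ : Ordinal.{u} | γ < α ∧ ¬ Sends j γ.toZFSet γ.toZFSet} κ

/-- `κ` is a `C^{(n)}`-extendible cardinal: `κ` is a cardinal and for every `lam > κ` there is an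
elementary embedding `j : V_lam → V_μ`, for some `μ`, with critical point `κ`, `j(κ) > lam`
and `j(κ) ∈ C^{(n)}`. -/
def IsCExtendible (n : ℕ) (κ : Ordinal.{u}) : Prop :=
  κ.IsInitial ∧ ∀ lam : Ordinal.{u}, κ < lam →
    ∃ (μ : Ordinal.{u}) (j : (V_ lam : ZFSet.{u}) ↪ₑ[setLang] (V_ μ : ZFSet.{u})),
      IsCriticalPoint j κ ∧
      ∃ θ : Ordinal.{u}, Sends j κ.toZFSet θ.toZFSet ∧ lam < θ ∧ θ ∈ sigmaCorrect n

/-- `κ` is an extendible cardinal: `κ` is a cardinal and for every `lam > κ` there is an elementary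
embedding `j : V_lam → V_μ`, for some `μ`, with critical point `κ` and `j(κ) > lam`. -/
def IsExtendible (κ : Ordinal.{u}) : Prop :=
  κ.IsInitial ∧ ∀ lam : Ordinal.{u}, κ < lam →
    ∃ (μ : Ordinal.{u}) (j : (V_ lam : ZFSet.{u}) ↪ₑ[setLang] (V_ μ : ZFSet.{u})),
      IsCriticalPoint j κ ∧ ∃ θ : Ordinal.{u}, Sends j κ.toZFSet θ.toZFSet ∧ lam < θ

/-- `δ` is `lam`-`Σ_n`-supercompact (used for `lam > δ` in `C^{(n)}`): for every `a ∈ V_lam` there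
are ordinals `δ' < lam' < δ` with `lam' ∈ C^{(n)}`, a set `a' ∈ V_lam'` and an elementary embedding
`j : V_lam' → V_lam` with critical point `δ'`, `j(δ') = δ` and `j(a') = a`. -/
def IsLevelSigmaSupercompact (n : ℕ) (lam δ : Ordinal.{u}) : Prop :=
  ∀ a : ZFSet.{u}, a ∈ V_ lam →
    ∃ δ' lam' : Ordinal.{u}, δ' < lam' ∧ lam' < δ ∧ lam' ∈ sigmaCorrect n ∧
      ∃ a' : ZFSet.{u}, a' ∈ V_ lam' ∧
        ∃ j : (V_ lam' : ZFSet.{u}) ↪ₑ[setLang] (V_ lam : ZFSet.{u}),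
          IsCriticalPoint j δ' ∧ Sends j δ'.toZFSet δ.toZFSet ∧ Sends j a' a

/-- `δ` is `Σ_n`-supercompact: it is `lam`-`Σ_n`-supercompact for every `lam > δ` in `C^{(n)}`. -/
def IsSigmaSupercompact (n : ℕ) (δ : Ordinal.{u}) : Prop :=
  ∀ lam : Ordinal.{u}, δ < lam → lam ∈ sigmaCorrect n → IsLevelSigmaSupercompact n lam δ

/-! Extendible implies supercompact. Let δ be C^(n)-extendible, V_μ ≺ V with μ > δ, and j : V_μ →
V_β with critical point δ, j(δ) > μ and j(δ) ∈ C^(n). As j fixes V_δ pointwise, V_δ ≺ V_{j(δ)}. A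
Σ_{n+1} truth of V_{j(δ)} goes up to V, and one of V goes down to V_μ and from there up to V_{j(δ)};
hence δ ∈ C^(n+1) (`IsCExtendible.mem_sigmaCorrect`). Now let λ ∈ C^(n+1), a ∈ V_λ, and take such a
j on V_μ with μ > λ a limit. The restriction of j to V_λ belongs to V_β. It shows that some level
V_λ' with λ' < j(δ), Σ_{n+1}-elementary in V_{j(δ)}, embeds into V_{j(λ)} with its critical point
sent to j(δ) and with j(a) in the range. By elementarity of j the same holds of δ, λ, a, with V_λ' ≺
V_δ for Σ_{n+1} formulas; since δ ∈ C^(n+1), also λ' ∈ C^(n+1)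
(`IsCExtendible.isSigmaSupercompact`).

Supercompact implies extendible. Capturing every γ < δ shows that C^(n+1) is unbounded in δ, so δ ∈
C^(n+1). For η > δ take λ > η in C^(n+1) and j : V_λ' → V_λ with j(δ') = δ and j(η') = η. The
restriction of j to V_η' shows that V_η' has an elementary embedding into some level with critical
point δ', sending δ' to a member of C^(n) above η'. This is a Σ_{n+1} property of η', δ', because
C^(n) is Π_n. It therefore holds in V_λ', and j carries it to η, δ
(`IsSigmaSupercompact.isCExtendible`).

For the last claim, extendible means C^(0)-extendible, so δ ∈ C^(1) by the first argument. Then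
every set in V_δ is a surjective image of an ordinal below δ by a map in V_δ. This passes to j(δ),
and a Löwenheim–Skolem and collapse argument gives j(δ) ∈ C^(1) (`HasSurjections.mem_sigmaCorrect`).

What remains is the complexity count. Elementarity is made Δ₀ by quantifying over satisfaction
relations, and the sets of codes of formulas are passed as parameters, which embeddings with
critical point above ω fix. -/

/-! ### Renaming of variables, absoluteness of Δ₀ formulas, relativization. -/

section Renaming

variable {A B : Type} {k l : ℕ}

/-- Extension of a renaming of variables under a quantifier. -/
def liftVar (σ : A ⊕ Fin k → B ⊕ Fin l) : A ⊕ Fin (k + 1) → B ⊕ Fin (l + 1)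
  | .inl a => Sum.map id Fin.castSucc (σ (.inl a))
  | .inr i => Fin.lastCases (motive := fun _ => B ⊕ Fin (l + 1)) (.inr (Fin.last l))
      (fun i => Sum.map id Fin.castSucc (σ (.inr i))) i

theorem liftVar_map (σ : A ⊕ Fin k → B ⊕ Fin l) :
    liftVar σ ∘ Sum.map id Fin.castSucc = Sum.map id Fin.castSucc ∘ σ := by
  funext x
  rcases x with a | i <;> simp [liftVar]

/-- Renaming of the free and bound variables of a formula. -/
def renameFormula : ∀ {k : ℕ}, setLang.BoundedFormula A k → ∀ {l : ℕ},
    (A ⊕ Fin k → B ⊕ Fin l) → setLang.BoundedFormula B l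
  | _, .falsum, _, _ => .falsum
  | _, .equal s t, _, σ => .equal (s.relabel σ) (t.relabel σ)
  | _, .rel R ts, _, σ => .rel R fun i => (ts i).relabel σ
  | _, .imp φ ψ, _, σ => .imp (renameFormula φ σ) (renameFormula ψ σ)
  | _, .all φ, _, σ => .all (renameFormula φ (liftVar σ))

theorem sumElim_liftVar {M : Type*} (σ : A ⊕ Fin k → B ⊕ Fin l) (v : B → M) (xs : Fin l → M)
    (x : M) (y : A ⊕ Fin (k + 1)) :
    Sum.elim v (Fin.snoc xs x : Fin (l + 1) → M) (liftVar σ y) =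
      Sum.elim (fun a => Sum.elim v xs (σ (.inl a)))
        (Fin.snoc (fun i => Sum.elim v xs (σ (.inr i))) x : Fin (k + 1) → M) y := by
  have key : ∀ z : B ⊕ Fin l, Sum.elim v (Fin.snoc xs x : Fin (l + 1) → M)
      (Sum.map id Fin.castSucc z) = Sum.elim v xs z := by
    rintro (b | i) <;> simp
  rcases y with a | i
  · simp [liftVar, key]
  · refine Fin.lastCases ?_ (fun i => ?_) i
    · simp [liftVar]
    · simp [liftVar, key]

theorem realize_renameFormula {M : Type*} [setLang.Structure M]
    {k : ℕ} (φ : setLang.BoundedFormula A k) {l : ℕ} (σ : A ⊕ Fin k → B ⊕ Fin l)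
    (v : B → M) (xs : Fin l → M) :
    (renameFormula φ σ).Realize v xs ↔
      φ.Realize (fun a => Sum.elim v xs (σ (.inl a))) (fun i => Sum.elim v xs (σ (.inr i))) := by
  have hterm : ∀ {k l : ℕ} (σ : A ⊕ Fin k → B ⊕ Fin l) (v : B → M) (xs : Fin l → M),
      Sum.elim v xs ∘ σ = Sum.elim (fun a => Sum.elim v xs (σ (.inl a)))
        (fun i => Sum.elim v xs (σ (.inr i))) := by
    intro k l σ v xs
    funext y
    rcases y with a | i <;> rfl
  induction φ generalizing l with
  | falsum => exact Iff.rfl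
  | equal s t => simp only [renameFormula, BoundedFormula.Realize, Term.realize_relabel, hterm]
  | rel R ts => simp only [renameFormula, BoundedFormula.Realize, Term.realize_relabel, hterm]
  | imp φ ψ ih₁ ih₂ => simp only [renameFormula, BoundedFormula.Realize, ih₁, ih₂]
  | all φ ih =>
    simp only [renameFormula, BoundedFormula.Realize, ih, sumElim_liftVar, Sum.elim_inl,
      Sum.elim_inr]

theorem realize_renameFormula_formula {M : Type*} [setLang.Structure M] (φ : setLang.Formula A)
    (σ : A ⊕ Fin 0 → B ⊕ Fin l) (v : B → M) (xs : Fin l → M) :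
    (renameFormula φ σ).Realize v xs ↔
      φ.Realize fun a => Sum.elim v xs (σ (.inl a)) := by
  rw [realize_renameFormula, Formula.Realize]
  exact iff_of_eq (congrArg _ (Subsingleton.elim _ _))

theorem renameFormula_memFormula (s t : setLang.Term (A ⊕ Fin k)) (σ : A ⊕ Fin k → B ⊕ Fin l) :
    renameFormula (memFormula s t) σ = memFormula (s.relabel σ) (t.relabel σ) := by
  simp only [memFormula, Relations.boundedFormula₂, Relations.boundedFormula, renameFormula]
  congr 1
  funext i
  fin_cases i <;> rfl

theorem IsDeltaZero.rename {φ : setLang.BoundedFormula A k} (h : IsDeltaZero φ) :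
    ∀ {l : ℕ} (σ : A ⊕ Fin k → B ⊕ Fin l), IsDeltaZero (renameFormula φ σ) := by
  induction h with
  | falsum => exact fun _ => .falsum
  | equal s t => exact fun _ => .equal _ _
  | mem s t =>
    intro l σ
    rw [renameFormula_memFormula]
    exact .mem _ _
  | imp _ _ ih₁ ih₂ => exact fun σ => .imp (ih₁ σ) (ih₂ σ)
  | ball t _ ih =>
    intro l σ
    have := IsDeltaZero.ball (t.relabel σ) (ih (liftVar σ))
    simpa only [ballFormula, renameFormula, renameFormula_memFormula, Term.relabel_relabel,
      liftVar_map, Term.relabel, liftVar, Fin.lastCases_last] using this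

theorem IsLevy.rename {s : LevySide} {n : ℕ} {φ : setLang.BoundedFormula A k}
    (h : IsLevy s n φ) :
    ∀ {l : ℕ} (σ : A ⊕ Fin k → B ⊕ Fin l), IsLevy s n (renameFormula φ σ) := by
  induction h with
  | deltaZero s h => exact fun σ => .deltaZero s (h.rename σ)
  | sigma_of_pi _ ih => exact fun σ => .sigma_of_pi (ih σ)
  | ex _ ih => exact fun σ => .ex (ih (liftVar σ))
  | pi_of_sigma _ ih => exact fun σ => .pi_of_sigma (ih σ)
  | all _ ih => exact fun σ => .all (ih (liftVar σ))

theorem realize_memFormula_set {M : ZFSet.{u}} (s t : setLang.Term (A ⊕ Fin k)) (v : A → M)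
    (xs : Fin k → M) : (memFormula s t).Realize v xs ↔
      ((s.realize (Sum.elim v xs) : M) : ZFSet) ∈ ((t.realize (Sum.elim v xs) : M) : ZFSet) :=
  BoundedFormula.realize_rel₂

theorem realize_memFormula (s t : setLang.Term (A ⊕ Fin k)) (v : A → ZFSet.{u})
    (xs : Fin k → ZFSet.{u}) : (memFormula s t).Realize v xs ↔
      s.realize (Sum.elim v xs) ∈ t.realize (Sum.elim v xs) :=
  BoundedFormula.realize_rel₂

theorem realize_weaken_term {M : Type*} [setLang.Structure M] (t : setLang.Term (A ⊕ Fin k))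
    (v : A → M) (xs : Fin k → M) (x : M) :
    (t.relabel (Sum.map id Fin.castSucc)).realize
      (Sum.elim v (Fin.snoc xs x : Fin (k + 1) → M)) = t.realize (Sum.elim v xs) := by
  rw [Term.realize_relabel]
  congr 1
  funext y
  rcases y with a | i <;> simp

theorem realize_ballFormula_set {M : ZFSet.{u}} (t : setLang.Term (A ⊕ Fin k))
    (φ : setLang.BoundedFormula A (k + 1)) (v : A → M) (xs : Fin k → M) :
    (ballFormula t φ).Realize v xs ↔ ∀ x : M,
      (x : ZFSet) ∈ ((t.realize (Sum.elim v xs) : M) : ZFSet) → φ.Realize v (Fin.snoc xs x) := by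
  simp only [ballFormula, BoundedFormula.realize_all, BoundedFormula.realize_imp,
    realize_memFormula_set, realize_weaken_term]
  simp

theorem realize_ballFormula (t : setLang.Term (A ⊕ Fin k))
    (φ : setLang.BoundedFormula A (k + 1)) (v : A → ZFSet.{u}) (xs : Fin k → ZFSet.{u}) :
    (ballFormula t φ).Realize v xs ↔ ∀ x : ZFSet.{u},
      x ∈ t.realize (Sum.elim v xs) → φ.Realize v (Fin.snoc xs x) := by
  simp only [ballFormula, BoundedFormula.realize_all, BoundedFormula.realize_imp,
    realize_memFormula, realize_weaken_term]
  simp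

theorem coe_realize_term {M : ZFSet.{u}} (t : setLang.Term (A ⊕ Fin k)) (v : A → M)
    (xs : Fin k → M) : ((t.realize (Sum.elim v xs) : M) : ZFSet) =
      t.realize (Sum.elim (fun a => (v a : ZFSet)) fun i => (xs i : ZFSet)) := by
  cases t with
  | var x => rcases x with a | i <;> rfl
  | func f => exact f.elim

theorem coe_snoc {M : ZFSet.{u}} (xs : Fin k → M) (x : M) :
    (fun i => ((Fin.snoc xs x : Fin (k + 1) → M) i : ZFSet)) =
      (Fin.snoc (fun i => (xs i : ZFSet)) (x : ZFSet) : Fin (k + 1) → ZFSet) := by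
  funext i
  refine Fin.lastCases ?_ (fun i => ?_) i <;> simp

/-- `Δ₀` formulas are absolute for transitive sets. -/
theorem IsDeltaZero.realize_coe {M : ZFSet.{u}} (hM : M.IsTransitive)
    {φ : setLang.BoundedFormula A k} (h : IsDeltaZero φ) (v : A → M) (xs : Fin k → M) :
    φ.Realize v xs ↔ φ.Realize (fun a => (v a : ZFSet)) (fun i => (xs i : ZFSet)) := by
  induction h with
  | falsum => exact Iff.rfl
  | equal s t =>
    simp only [BoundedFormula.Realize, ← coe_realize_term, Subtype.coe_inj]
  | mem s t => rw [realize_memFormula, realize_memFormula_set, coe_realize_term, coe_realize_term]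
  | imp _ _ ih₁ ih₂ => simp only [BoundedFormula.realize_imp, ih₁, ih₂]
  | ball t _ ih =>
    simp only [realize_ballFormula, realize_ballFormula_set, coe_realize_term, ih, coe_snoc]
    refine ⟨fun H x hx => ?_, fun H x hx => H x hx⟩
    rw [← coe_realize_term] at hx
    exact H ⟨x, hM.subset_of_mem (Subtype.prop _) hx⟩ (by rwa [coe_realize_term] at hx)

/-- The relativization of a formula to a set, which becomes the additional free variable `none`. -/
def relativize : ∀ {k : ℕ}, setLang.BoundedFormula A k → setLang.BoundedFormula (Option A) k
  | _, .falsum => .falsum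
  | _, .equal s t => .equal (s.relabel (Sum.map some id)) (t.relabel (Sum.map some id))
  | _, .rel R ts => .rel R fun i => (ts i).relabel (Sum.map some id)
  | _, .imp φ ψ => .imp (relativize φ) (relativize ψ)
  | _, .all φ => ballFormula (Term.var (.inl none)) (relativize φ)

theorem isDeltaZero_rel {n : ℕ} (R : setLang.Relations n)
    (ts : Fin n → setLang.Term (A ⊕ Fin k)) : IsDeltaZero (.rel R ts) := by
  cases R
  have : (.rel MemRel.mem ts : setLang.BoundedFormula A k) = memFormula (ts 0) (ts 1) := by
    simp only [memFormula, Relations.boundedFormula₂, Relations.boundedFormula]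
    congr 1
    funext i
    fin_cases i <;> rfl
  rw [this]
  exact .mem _ _

/-- Each quantifier is bounded by the new variable, so satisfaction of an arbitrary formula in `M`
becomes a Δ₀ property of `M`. This lets `realize_appSet` treat all formulas at once. -/
theorem isDeltaZero_relativize {k : ℕ} (φ : setLang.BoundedFormula A k) :
    IsDeltaZero (relativize φ) := by
  induction φ with
  | falsum => exact .falsum
  | equal s t => exact .equal _ _
  | rel R ts => exact isDeltaZero_rel _ _
  | imp φ ψ ih₁ ih₂ => exact .imp ih₁ ih₂
  | all φ ih => exact .ball _ ih

theorem realize_rel_set {M : ZFSet.{u}} {n : ℕ} (R : setLang.Relations n)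
    (ts : Fin n → setLang.Term (A ⊕ Fin k)) (v : A → M) (xs : Fin k → M) :
    (BoundedFormula.rel R ts).Realize v xs ↔ (BoundedFormula.rel R ts).Realize
      (fun a => (v a : ZFSet)) (fun i => (xs i : ZFSet)) := by
  cases R
  change (((ts 0).realize (Sum.elim v xs) : M) : ZFSet) ∈
    (((ts 1).realize (Sum.elim v xs) : M) : ZFSet) ↔ (ts 0).realize _ ∈ (ts 1).realize _
  rw [coe_realize_term, coe_realize_term]

theorem realize_relativize {M : ZFSet.{u}} {k : ℕ} (φ : setLang.BoundedFormula A k) (v : A → M)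
    (xs : Fin k → M) : (relativize φ).Realize
      (fun a : Option A => a.elim M fun a => (v a : ZFSet)) (fun i => (xs i : ZFSet)) ↔
      φ.Realize v xs := by
  have hterm : ∀ {k : ℕ} (v : A → M) (xs : Fin k → M),
      Sum.elim (fun a : Option A => a.elim M fun a => (v a : ZFSet)) (fun i => (xs i : ZFSet)) ∘
        Sum.map some id = Sum.elim (fun a => (v a : ZFSet)) (fun i => (xs i : ZFSet)) := by
    intro k v xs
    funext y
    rcases y with a | i <;> rfl
  induction φ with
  | falsum => exact Iff.rfl
  | equal s t =>
    simp only [relativize, BoundedFormula.Realize, Term.realize_relabel, hterm,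
      ← coe_realize_term, Subtype.coe_inj]
  | rel R ts =>
    rw [realize_rel_set]
    simp only [relativize, BoundedFormula.Realize, Term.realize_relabel, hterm]
  | imp φ ψ ih₁ ih₂ => simp only [relativize, BoundedFormula.realize_imp, ih₁, ih₂]
  | all φ ih =>
    simp only [relativize, realize_ballFormula, BoundedFormula.realize_all]
    refine ⟨fun H x => ?_, fun H x hx => ?_⟩
    · refine (ih _).1 ?_
      rw [coe_snoc]
      exact H x x.2
    · have := (ih (Fin.snoc xs ⟨x, hx⟩)).2 (H ⟨x, hx⟩)
      rwa [coe_snoc] at this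

end Renaming

/-! ### Δ₀ predicates of sets. -/

/-- A predicate on tuples of sets is `Δ₀` if it is expressed by a `Δ₀` formula. -/
class DeltaZero {ι : Type} (P : (ι → ZFSet.{u}) → Prop) : Prop where
  exists_formula : ∃ φ : setLang.Formula ι, IsDeltaZero φ ∧ ∀ v, φ.Realize v ↔ P v

namespace DeltaZero

variable {ι κ : Type} {P Q : (ι → ZFSet.{u}) → Prop}

theorem congr (h : DeltaZero P) (hPQ : ∀ v, Q v ↔ P v) : DeltaZero Q := by
  rwa [show Q = P from funext fun v => propext (hPQ v)]

theorem reindex (h : DeltaZero P) (f : ι → κ) : DeltaZero fun v : κ → ZFSet.{u} => P fun i => v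
    (f i) := by
  obtain ⟨φ, hφ, hP⟩ := h
  refine ⟨renameFormula φ (Sum.map f id), hφ.rename _, fun v => ?_⟩
  rw [← hP, Formula.Realize, realize_renameFormula_formula]
  rfl

instance mem (a b : ι) : DeltaZero fun v : ι → ZFSet.{u} => v a ∈ v b :=
  ⟨memFormula (.var (.inl a)) (.var (.inl b)), .mem _ _, fun _ => realize_memFormula _ _ _ _⟩

instance eq (a b : ι) : DeltaZero fun v : ι → ZFSet.{u} => v a = v b :=
  ⟨.equal (.var (.inl a)) (.var (.inl b)), .equal _ _, fun _ => Iff.rfl⟩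

instance false : DeltaZero fun _ : ι → ZFSet.{u} => False :=
  ⟨.falsum, .falsum, fun _ => Iff.rfl⟩

instance imp [hP : DeltaZero P] [hQ : DeltaZero Q] : DeltaZero fun v => P v → Q v := by
  obtain ⟨φ, hφ, hP⟩ := hP
  obtain ⟨ψ, hψ, hQ⟩ := hQ
  exact ⟨φ.imp ψ, hφ.imp hψ, fun v => by rw [Formula.realize_imp, hP, hQ]⟩

instance not [DeltaZero P] : DeltaZero fun v => ¬ P v :=
  (inferInstance : DeltaZero fun v => P v → False)

instance and [DeltaZero P] [DeltaZero Q] : DeltaZero fun v => P v ∧ Q v :=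
  (inferInstance : (DeltaZero fun v => ¬ (P v → ¬ Q v))).congr fun v => by tauto

instance or [DeltaZero P] [DeltaZero Q] : DeltaZero fun v => P v ∨ Q v :=
  (inferInstance : (DeltaZero fun v => ¬ P v → Q v)).congr fun v => by tauto

instance iff [DeltaZero P] [DeltaZero Q] : DeltaZero fun v => (P v ↔ Q v) :=
  (inferInstance : (DeltaZero fun v => (P v → Q v) ∧ (Q v → P v))).congr fun v => by tauto

instance ball (a : ι) {R : (ι → ZFSet.{u}) → ZFSet.{u} → Prop}
    [h : DeltaZero fun w : Option ι → ZFSet.{u} => R (fun i => w (some i)) (w none)] :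
    DeltaZero fun v => ∀ x ∈ v a, R v x := by
  obtain ⟨φ, hφ, hR⟩ := h
  refine ⟨ballFormula (.var (.inl a)) (renameFormula φ
    (Sum.elim (fun o => o.elim (.inr (Fin.last 0)) .inl) Fin.elim0)), .ball _ (hφ.rename _),
    fun v => ?_⟩
  rw [Formula.Realize, realize_ballFormula]
  refine forall₂_congr fun x _ => ?_
  rw [realize_renameFormula_formula]
  refine Iff.trans (iff_of_eq (congrArg _ ?_)) (hR fun o => o.elim x v)
  funext o
  cases o
  · exact Fin.snoc_last (α := fun _ => ZFSet) x _
  · rfl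

instance bex (a : ι) {R : (ι → ZFSet.{u}) → ZFSet.{u} → Prop}
    [DeltaZero fun w : Option ι → ZFSet.{u} => R (fun i => w (some i)) (w none)] :
    DeltaZero fun v => ∃ x, x ∈ v a ∧ R v x :=
  (inferInstance : (DeltaZero fun v => ¬ ∀ x ∈ v a, ¬ R v x)).congr fun v => by
    push Not
    rfl

instance subset (a b : ι) : DeltaZero fun v : ι → ZFSet.{u} => v a ⊆ v b :=
  (inferInstance : (DeltaZero fun v : ι → ZFSet.{u} => ∀ x ∈ v a, x ∈ v b)).congr fun _ =>
    ZFSet.subset_def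

instance isTransitive (a : ι) : DeltaZero fun v : ι → ZFSet.{u} => (v a).IsTransitive :=
  (inferInstance : (DeltaZero fun v : ι → ZFSet.{u} => ∀ x ∈ v a, x ⊆ v a)).congr fun _ => Iff.rfl

instance isOrdinal (a : ι) : DeltaZero fun v : ι → ZFSet.{u} => (v a).IsOrdinal :=
  (inferInstance : (DeltaZero fun v : ι → ZFSet.{u} =>
    (v a).IsTransitive ∧ ∀ x ∈ v a, x.IsTransitive)).congr fun _ =>
      ZFSet.isOrdinal_iff_forall_mem_isTransitive

end DeltaZero

namespace DeltaZero

variable {ι : Type}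

instance eqEmpty (a : ι) : DeltaZero fun v : ι → ZFSet.{u} => v a = ∅ :=
  (inferInstance : DeltaZero fun v : ι → ZFSet.{u} => ∀ x ∈ v a, False).congr fun v => by
    rw [ZFSet.eq_empty]

instance eqPair (a b c : ι) :
    DeltaZero fun v : ι → ZFSet.{u} => v a = ZFSet.pair (v b) (v c) :=
  (inferInstance : DeltaZero fun v : ι → ZFSet.{u} => ∃ s ∈ v a, ∃ t ∈ v a,
    (v b ∈ s ∧ ∀ z ∈ s, z = v b) ∧ (v b ∈ t ∧ v c ∈ t ∧ ∀ z ∈ t, z = v b ∨ z = v c) ∧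
      ∀ z ∈ v a, z = s ∨ z = t).congr fun v => by
    constructor
    · intro h
      rw [h]
      refine ⟨{v b}, by simp [ZFSet.pair], {v b, v c}, by simp [ZFSet.pair], ?_, ?_, ?_⟩ <;>
        simp [ZFSet.pair]
    · rintro ⟨s, hs, t, ht, ⟨h1, h2⟩, ⟨h3, h4, h5⟩, h6⟩
      have hs' : s = {v b} := by
        ext z
        simp only [ZFSet.mem_singleton]
        exact ⟨h2 z, fun h => h ▸ h1⟩
      have ht' : t = {v b, v c} := by
        ext z
        simp only [ZFSet.mem_pair]
        exact ⟨h5 z, fun h => h.elim (fun h => h ▸ h3) fun h => h ▸ h4⟩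
      subst hs' ht'
      ext z
      simp only [ZFSet.pair, ZFSet.mem_pair]
      exact ⟨h6 z, fun h => h.elim (fun h => h ▸ hs) fun h => h ▸ ht⟩

instance pairMem (a b c : ι) :
    DeltaZero fun v : ι → ZFSet.{u} => ZFSet.pair (v a) (v b) ∈ v c :=
  (inferInstance : DeltaZero fun v : ι → ZFSet.{u} => ∃ p ∈ v c, p = ZFSet.pair (v a) (v b)).congr
    fun v => by simp

theorem snd_mem_sUnion_pair {x y : ZFSet.{u}} :
    ∃ s ∈ ZFSet.pair x y, x ∈ s ∧ y ∈ s := ⟨{x, y}, by simp [ZFSet.pair]⟩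

/-- The second coordinate of a pair is an element of an element of the pair, so the quantifier over
`y` is bounded after passing through `p ∈ f` and `s ∈ p`. The three `Option`s hold `p`, `s` and `y`.
-/
instance exApp (a f : ι) {R : (ι → ZFSet.{u}) → ZFSet.{u} → Prop}
    [h : DeltaZero fun w : Option (Option (Option ι)) → ZFSet.{u} =>
      R (fun i => w (some (some (some i)))) (w none)] :
    DeltaZero fun v => ∃ y, ZFSet.pair (v a) y ∈ v f ∧ R v y :=
  (inferInstance : DeltaZero fun v : ι → ZFSet.{u} => ∃ p ∈ v f, ∃ s ∈ p, ∃ y ∈ s,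
    p = ZFSet.pair (v a) y ∧ R v y).congr fun v => by
    constructor
    · rintro ⟨y, hy, hR⟩
      obtain ⟨s, hs, -, hys⟩ := snd_mem_sUnion_pair (x := v a) (y := y)
      exact ⟨_, hy, s, hs, y, hys, rfl, hR⟩
    · rintro ⟨p, hp, s, -, y, -, rfl, hR⟩
      exact ⟨y, hp, hR⟩

instance allApp (a f : ι) {R : (ι → ZFSet.{u}) → ZFSet.{u} → Prop}
    [h : DeltaZero fun w : Option (Option (Option ι)) → ZFSet.{u} =>
      R (fun i => w (some (some (some i)))) (w none)] :
    DeltaZero fun v => ∀ y, ZFSet.pair (v a) y ∈ v f → R v y :=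
  (inferInstance : DeltaZero fun v : ι → ZFSet.{u} => ¬ ∃ y, ZFSet.pair (v a) y ∈ v f ∧ ¬ R v
    y).congr
    fun v => by push Not; rfl

end DeltaZero

/-! ### Σ_n and Π_n predicates of sets. -/

/-- `Σ_n` predicates on tuples of sets. -/
def SigmaPred : ℕ → ∀ {ι : Type}, ((ι → ZFSet.{u}) → Prop) → Prop
  | 0, _, P => DeltaZero P
  | n + 1, ι, P => ∃ (κ : Type) (_ : Finite κ) (Q : (ι ⊕ κ → ZFSet.{u}) → Prop),
      SigmaPred n Q ∧ ∀ v, P v ↔ ∃ w : κ → ZFSet.{u}, ¬ Q (Sum.elim v w)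

/-- `Π_n` predicates on tuples of sets. -/
def PiPred (n : ℕ) {ι : Type} (P : (ι → ZFSet.{u}) → Prop) : Prop :=
  SigmaPred n fun v => ¬ P v

namespace SigmaPred

variable {ι κ : Type} {n m : ℕ} {P Q : (ι → ZFSet.{u}) → Prop}

theorem congr (h : SigmaPred n P) (hPQ : ∀ v, Q v ↔ P v) : SigmaPred n Q := by
  rwa [show Q = P from funext fun v => propext (hPQ v)]

theorem _root_.PiPred.congr (h : PiPred n P) (hPQ : ∀ v, Q v ↔ P v) : PiPred n Q :=
  SigmaPred.congr h fun v => not_congr (hPQ v)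

theorem piPred_not (h : SigmaPred n P) : PiPred n fun v => ¬ P v :=
  h.congr fun _ => not_not

theorem reindex (h : SigmaPred n P) (f : ι → κ) :
    SigmaPred n fun v : κ → ZFSet.{u} => P fun i => v (f i) := by
  induction n generalizing ι κ with
  | zero => exact DeltaZero.reindex h f
  | succ n ih =>
    obtain ⟨ρ, hρ, Q, hQ, hP⟩ := h
    refine ⟨ρ, hρ, _, ih hQ (Sum.map f id), fun v => (hP _).trans (exists_congr fun w => ?_)⟩
    refine not_congr (iff_of_eq (congrArg Q ?_))
    funext i
    rcases i with i | i <;> rfl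

theorem succ_of_piPred (h : PiPred n P) : SigmaPred (n + 1) P :=
  ⟨Empty, inferInstance, _, h.reindex Sum.inl, fun v => by simp⟩

theorem succ (h : SigmaPred n P) : SigmaPred (n + 1) P := by
  induction n generalizing ι with
  | zero =>
    have : DeltaZero P := h
    exact succ_of_piPred (n := 0) (inferInstance : DeltaZero fun v => ¬ P v)
  | succ n ih =>
    obtain ⟨ρ, hρ, Q, hQ, hP⟩ := h
    exact ⟨ρ, hρ, Q, ih hQ, hP⟩

theorem mono (h : SigmaPred n P) (hnm : n ≤ m) : SigmaPred m P :=
  Nat.le_induction h (fun _ _ ih => ih.succ) m hnm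

theorem of_piPred (h : PiPred n P) (hnm : n < m) : SigmaPred m P :=
  (succ_of_piPred h).mono hnm

theorem of_deltaZero (h : DeltaZero P) : SigmaPred n P :=
  mono (n := 0) h n.zero_le

/-- Each level of `SigmaPred` negates the one below, so conjunctions at `n + 1` need disjunctions at
`n` and conversely; hence the joint induction. -/
theorem and_or (n : ℕ) : ∀ {ι : Type} {P Q : (ι → ZFSet.{u}) → Prop}, SigmaPred n P →
    SigmaPred n Q → SigmaPred n (fun v => P v ∧ Q v) ∧ SigmaPred n fun v => P v ∨ Q v := by
  induction n with
  | zero =>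
    intro ι P Q hP hQ
    have hP : DeltaZero P := hP
    have hQ : DeltaZero Q := hQ
    exact ⟨(inferInstance : DeltaZero fun v => P v ∧ Q v),
      (inferInstance : DeltaZero fun v => P v ∨ Q v)⟩
  | succ n ih =>
    rintro ι P Q ⟨ρ, hρ, P', hP', hP⟩ ⟨τ, hτ, Q', hQ', hQ⟩
    have h1 := hP'.reindex (Sum.map (id : ι → ι) (Sum.inl : ρ → ρ ⊕ τ))
    have h2 := hQ'.reindex (Sum.map (id : ι → ι) (Sum.inr : τ → ρ ⊕ τ))
    have e1 : ∀ (v : ι → ZFSet.{u}) (w : ρ ⊕ τ → ZFSet.{u}),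
        (fun i => Sum.elim v w (Sum.map (id : ι → ι) (Sum.inl : ρ → ρ ⊕ τ) i)) =
          Sum.elim v (w ∘ Sum.inl) := by
      intro v w; funext i; rcases i with i | i <;> rfl
    have e2 : ∀ (v : ι → ZFSet.{u}) (w : ρ ⊕ τ → ZFSet.{u}),
        (fun i => Sum.elim v w (Sum.map (id : ι → ι) (Sum.inr : τ → ρ ⊕ τ) i)) =
          Sum.elim v (w ∘ Sum.inr) := by
      intro v w; funext i; rcases i with i | i <;> rfl
    refine ⟨⟨ρ ⊕ τ, inferInstance, _, (ih h1 h2).2, fun v => ?_⟩,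
      ⟨ρ ⊕ τ, inferInstance, _, (ih h1 h2).1, fun v => ?_⟩⟩
    · change (P v ∧ Q v) ↔ _
      rw [hP, hQ]
      constructor
      · rintro ⟨⟨w, hw⟩, ⟨w', hw'⟩⟩
        refine ⟨Sum.elim w w', ?_⟩
        rw [e1, e2]
        exact not_or.2 ⟨hw, hw'⟩
      · rintro ⟨w, hw⟩
        rw [e1, e2] at hw
        exact ⟨⟨_, (not_or.1 hw).1⟩, ⟨_, (not_or.1 hw).2⟩⟩
    · change (P v ∨ Q v) ↔ _
      rw [hP, hQ]
      constructor
      · rintro (⟨w, hw⟩ | ⟨w', hw'⟩)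
        -- The block of the other disjunct plays no role and is filled with `∅`.
        · refine ⟨Sum.elim w fun _ => ∅, ?_⟩
          rw [e1, e2]
          exact fun h => hw h.1
        · refine ⟨Sum.elim (fun _ => ∅) w', ?_⟩
          rw [e1, e2]
          exact fun h => hw' h.2
      · rintro ⟨w, hw⟩
        rw [e1, e2] at hw
        rcases not_and_or.1 hw with h | h
        exacts [.inl ⟨_, h⟩, .inr ⟨_, h⟩]

theorem and (hP : SigmaPred n P) (hQ : SigmaPred n Q) : SigmaPred n fun v => P v ∧ Q v :=
  (and_or n hP hQ).1

theorem or (hP : SigmaPred n P) (hQ : SigmaPred n Q) : SigmaPred n fun v => P v ∨ Q v :=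
  (and_or n hP hQ).2

theorem ex {R : (ι → ZFSet.{u}) → ZFSet.{u} → Prop}
    (h : SigmaPred (n + 1) fun w : Option ι → ZFSet.{u} => R (fun i => w (some i)) (w none)) :
    SigmaPred (n + 1) fun v => ∃ x, R v x := by
  obtain ⟨ρ, hρ, Q, hQ, hP⟩ := h
  refine ⟨Option ρ, inferInstance, _, hQ.reindex
    (Sum.elim (fun o => o.elim (Sum.inr none) Sum.inl) (Sum.inr ∘ some)), fun v => ?_⟩
  have e : ∀ (x : ZFSet.{u}) (w : ρ → ZFSet.{u}),
      (fun i : Option ι ⊕ ρ => Sum.elim v (fun o : Option ρ => o.elim x w)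
        (Sum.elim (fun o => o.elim (Sum.inr none) Sum.inl) (Sum.inr ∘ some) i)) =
          Sum.elim (fun o : Option ι => o.elim x v) w := by
    intro x w
    funext i
    rcases i with (_ | i) | i <;> rfl
  constructor
  · rintro ⟨x, hx⟩
    obtain ⟨w, hw⟩ := (hP fun o => o.elim x v).1 hx
    exact ⟨fun o => o.elim x w, by rwa [e]⟩
  · rintro ⟨w, hw⟩
    refine ⟨w none, (hP fun o => o.elim (w none) v).2 ⟨fun i => w (some i), ?_⟩⟩
    rw [← e]
    rwa [show (fun o : Option ρ => o.elim (w none) fun i => w (some i)) = w from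
      funext fun o => by cases o <;> rfl]

end SigmaPred

namespace PiPred

variable {ι κ : Type} {n m : ℕ} {P Q : (ι → ZFSet.{u}) → Prop}

theorem of_deltaZero (h : DeltaZero P) : PiPred n P :=
  SigmaPred.of_deltaZero (inferInstance : DeltaZero fun v => ¬ P v)

theorem mono (h : PiPred n P) (hnm : n ≤ m) : PiPred m P := SigmaPred.mono h hnm

theorem not (h : PiPred n P) : SigmaPred n fun v => ¬ P v := h

theorem and (hP : PiPred n P) (hQ : PiPred n Q) : PiPred n fun v => P v ∧ Q v :=
  (SigmaPred.or hP hQ).congr fun _ => not_and_or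

theorem or (hP : PiPred n P) (hQ : PiPred n Q) : PiPred n fun v => P v ∨ Q v :=
  (SigmaPred.and hP hQ).congr fun _ => not_or

theorem imp (hP : SigmaPred n P) (hQ : PiPred n Q) : PiPred n fun v => P v → Q v :=
  (hP.piPred_not.or hQ).congr fun _ => imp_iff_not_or

theorem all {R : (ι → ZFSet.{u}) → ZFSet.{u} → Prop}
    (h : PiPred (n + 1) fun w : Option ι → ZFSet.{u} => R (fun i => w (some i)) (w none)) :
    PiPred (n + 1) fun v => ∀ x, R v x :=
  (SigmaPred.ex (R := fun v x => ¬ R v x) h).congr fun _ => not_forall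

end PiPred

theorem IsLevy.exs {A : Type v} {n k : ℕ} {φ : setLang.BoundedFormula A k}
    (h : IsLevy .sigma (n + 1) φ) : IsLevy .sigma (n + 1) φ.exs := by
  induction k with
  | zero => exact h
  | succ k ih => exact ih h.ex

theorem IsLevy.alls {A : Type v} {n k : ℕ} {φ : setLang.BoundedFormula A k}
    (h : IsLevy .pi (n + 1) φ) : IsLevy .pi (n + 1) φ.alls := by
  induction k with
  | zero => exact h
  | succ k ih => exact ih h.all

/-- The matrix of a Σ_{n+1} predicate is a negated Σ_n predicate, so the induction must carry a Π
formula for the negation along with the Σ formula. -/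
theorem SigmaPred.exists_formula {n : ℕ} : ∀ {ι : Type} {P : (ι → ZFSet.{u}) → Prop},
    SigmaPred n P →
      (∃ φ : setLang.Formula ι, IsLevy .sigma n φ ∧ ∀ v : ι → ZFSet.{u}, φ.Realize v ↔ P v) ∧
      ∃ φ : setLang.Formula ι, IsLevy .pi n φ ∧ ∀ v : ι → ZFSet.{u}, φ.Realize v ↔ ¬ P v := by
  induction n with
  | zero =>
    intro ι P h
    have : DeltaZero P := h
    obtain ⟨φ, hφ, H⟩ := DeltaZero.exists_formula (P := P)
    obtain ⟨ψ, hψ, H'⟩ := DeltaZero.exists_formula (P := fun v => ¬ P v)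
    exact ⟨⟨φ, .deltaZero _ hφ, H⟩, ⟨ψ, .deltaZero _ hψ, H'⟩⟩
  | succ n ih =>
    rintro ι P ⟨κ, hκ, Q, hQ, hP⟩
    obtain ⟨⟨φ, hφ, H⟩, ⟨ψ, hψ, H'⟩⟩ := ih hQ
    obtain ⟨m, ⟨e⟩⟩ := Finite.exists_equiv_fin κ
    let σ : (ι ⊕ κ) ⊕ Fin 0 → ι ⊕ Fin m := Sum.elim (Sum.map id e) Fin.elim0
    have key : ∀ (v : ι → ZFSet.{u}) (xs : Fin m → ZFSet.{u}),
        (fun a : ι ⊕ κ => Sum.elim v xs (σ (.inl a))) = Sum.elim v (xs ∘ e) := by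
      intro v xs
      funext a
      rcases a with a | a <;> rfl
    refine ⟨⟨(renameFormula ψ σ).exs, (IsLevy.sigma_of_pi (hψ.rename σ)).exs, fun v => ?_⟩,
      ⟨(renameFormula φ σ).alls, (IsLevy.pi_of_sigma (hφ.rename σ)).alls, fun v => ?_⟩⟩
    · rw [BoundedFormula.realize_exs, hP]
      simp only [realize_renameFormula_formula, key, H']
      exact ⟨fun ⟨xs, h⟩ => ⟨_, h⟩, fun ⟨w, h⟩ => ⟨w ∘ e.symm, by
        simpa [Function.comp_assoc] using h⟩⟩
    · rw [BoundedFormula.realize_alls, hP]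
      simp only [realize_renameFormula_formula, key, H, not_exists, not_not]
      exact ⟨fun h w => by simpa [Function.comp_assoc] using h (w ∘ e.symm), fun h xs => h _⟩

/-! ### Σ_n-elementary maps. -/

section Agree

/-- Negation exchanges the two sides of the Lévy hierarchy. -/
theorem IsLevy.exists_not {A : Type} {s : LevySide} {n k : ℕ} {φ : setLang.BoundedFormula A k}
    (h : IsLevy s n φ) : ∃ ψ : setLang.BoundedFormula A k,
      IsLevy (match s with | .sigma => .pi | .pi => .sigma) n ψ ∧
      ∀ (M : Type v) [setLang.Structure M] (v : A → M) (xs : Fin k → M),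
        ψ.Realize v xs ↔ ¬ φ.Realize v xs := by
  induction h with
  | deltaZero s h => exact ⟨_, .deltaZero _ (h.imp .falsum), fun M _ v xs => Iff.rfl⟩
  | sigma_of_pi _ ih =>
    obtain ⟨ψ, h, H⟩ := ih
    exact ⟨ψ, .pi_of_sigma h, H⟩
  | ex _ ih =>
    obtain ⟨ψ, h, H⟩ := ih
    exact ⟨ψ.all, .all h, fun M _ v xs => by simp [H]⟩
  | pi_of_sigma _ ih =>
    obtain ⟨ψ, h, H⟩ := ih
    exact ⟨ψ, .sigma_of_pi h, H⟩
  | all _ ih =>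
    obtain ⟨ψ, h, H⟩ := ih
    exact ⟨ψ.ex, .ex h, fun M _ v xs => by simp [H]⟩

/-- The map `i : M → N` preserves and reflects the `Σ_n` formulas. -/
def SigmaElementary (n : ℕ) {M N : Type v} [setLang.Structure M] [setLang.Structure N]
    (i : M → N) : Prop :=
  ∀ (k : ℕ) (φ : setLang.Formula (Fin k)), IsLevy .sigma n φ → ∀ v : Fin k → M,
    φ.Realize v ↔ φ.Realize fun j => i (v j)

variable {M N K : Type v} [setLang.Structure M] [setLang.Structure N] [setLang.Structure K]
  {i : M → N} {n : ℕ}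

/-- All variables are renamed into one finite tuple; the Π side follows by negation. -/
theorem SigmaElementary.realize_bounded (h : SigmaElementary n i) {A : Type} [Finite A] {k : ℕ}
    {s : LevySide}
    {φ : setLang.BoundedFormula A k} (hφ : IsLevy s n φ) (v : A → M) (xs : Fin k → M) :
    φ.Realize v xs ↔ φ.Realize (fun j => i (v j)) fun j => i (xs j) := by
  obtain ⟨m, ⟨e⟩⟩ := Finite.exists_equiv_fin (A ⊕ Fin k)
  have main : ∀ {φ : setLang.BoundedFormula A k}, IsLevy .sigma n φ →
      (φ.Realize v xs ↔ φ.Realize (fun j => i (v j)) fun j => i (xs j)) := by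
    intro φ hφ
    have := h m (renameFormula φ (Sum.inl ∘ e)) (hφ.rename _) (Sum.elim v xs ∘ e.symm)
    rw [Formula.Realize, Formula.Realize, realize_renameFormula, realize_renameFormula] at this
    simpa using this
  cases s with
  | sigma => exact main hφ
  | pi =>
    obtain ⟨ψ, h, H⟩ := hφ.exists_not
    rw [← not_iff_not, ← H, ← H]
    exact main h

/-- `Σ_{n+1}` formulas are preserved by `Σ_n`-elementary maps. -/
theorem SigmaElementary.realize_of_realize (h : SigmaElementary n i) {A : Type} [Finite A] {k : ℕ}
    {φ : setLang.BoundedFormula A k} (hφ : IsLevy .sigma (n + 1) φ) (v : A → M) (xs : Fin k → M) :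
    φ.Realize v xs → φ.Realize (fun j => i (v j)) fun j => i (xs j) := by
  generalize hs : LevySide.sigma = s at hφ
  generalize hm : n + 1 = m at hφ
  induction hφ with
  | deltaZero => cases hm
  | sigma_of_pi hφ =>
    cases hm
    exact (h.realize_bounded hφ v xs).1
  | ex hφ ih =>
    cases hm
    simp only [BoundedFormula.realize_ex]
    rintro ⟨a, ha⟩
    refine ⟨i a, ?_⟩
    convert ih _ rfl rfl ha using 2 with j
    refine Fin.lastCases ?_ (fun j => ?_) j <;> simp
  | pi_of_sigma => cases hs
  | all => cases hs

/-- Upward preservation of Σ_{n+1} formulas is automatic, so only reflection has to be checked. -/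
theorem SigmaElementary.succ (h : SigmaElementary n i)
    (H : ∀ (k : ℕ) (φ : setLang.Formula (Fin k)), IsLevy .sigma (n + 1) φ → ∀ v : Fin k → M,
      (φ.Realize fun j => i (v j)) → φ.Realize v) : SigmaElementary (n + 1) i := by
  intro k φ hφ v
  refine ⟨fun hv => ?_, H k φ hφ v⟩
  have := h.realize_of_realize hφ v default hv
  rwa [Subsingleton.elim (fun j => i _) (default : Fin 0 → N)] at this

end Agree

theorem IsLevy.zero_iff {A : Type v} {s : LevySide} {k : ℕ} {φ : setLang.BoundedFormula A k} :
    IsLevy s 0 φ ↔ IsDeltaZero φ :=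
  ⟨fun h => by cases h; assumption, .deltaZero s⟩

/-! ### The classes C^(n) and reflection. -/

section Correct

theorem sigmaCorrect_iff {n : ℕ} {α : Ordinal.{u}} :
    α ∈ sigmaCorrect n ↔ SigmaElementary n (Subtype.val : (V_ α : ZFSet.{u}) → ZFSet.{u}) :=
  Iff.rfl

theorem sigmaElementary_zero_val {M : ZFSet.{u}} (hM : M.IsTransitive) :
    SigmaElementary 0 (Subtype.val : M → ZFSet.{u}) := by
  intro k φ hφ v
  rw [Formula.Realize, (IsLevy.zero_iff.1 hφ).realize_coe hM]
  exact iff_of_eq (congrArg _ (Subsingleton.elim _ _))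

theorem mem_sigmaCorrect_zero (α : Ordinal.{u}) : α ∈ sigmaCorrect 0 :=
  sigmaElementary_zero_val (ZFSet.isTransitive_vonNeumann α)

theorem IsLevy.succ {A : Type v} {s : LevySide} {n k : ℕ} {φ : setLang.BoundedFormula A k}
    (h : IsLevy s n φ) : IsLevy s (n + 1) φ := by
  induction h with
  | deltaZero s h =>
    cases s
    · exact .sigma_of_pi (.deltaZero _ h)
    · exact .pi_of_sigma (.deltaZero _ h)
  | sigma_of_pi _ ih => exact .sigma_of_pi ih
  | ex _ ih => exact .ex ih
  | pi_of_sigma _ ih => exact .pi_of_sigma ih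
  | all _ ih => exact .all ih

theorem IsLevy.mono {A : Type v} {s : LevySide} {n m k : ℕ} {φ : setLang.BoundedFormula A k}
    (h : IsLevy s n φ) (hnm : n ≤ m) : IsLevy s m φ :=
  Nat.le_induction h (fun _ _ ih => ih.succ) m hnm

theorem sigmaCorrect_anti {n m : ℕ} (h : n ≤ m) :
    (sigmaCorrect m : Set Ordinal.{u}) ⊆ sigmaCorrect n :=
  fun _ hα k φ hφ => hα k φ (hφ.mono h)

/-- **Reflection**: there are arbitrarily large `α` with `V_α` an elementary substructure of the
universe. -/
theorem exists_forall_mem_sigmaCorrect (β : Ordinal.{u}) :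
    ∃ α > β, ∀ n, α ∈ sigmaCorrect n := by
  classical
  -- All formulas with parameters in `V_ ξ` are indexed together by a small type. One closure
  -- function then serves every `n`.
  let I (ξ : Ordinal.{u}) : Type (u + 1) :=
    Σ n : ℕ, setLang.BoundedFormula Empty (n + 1) × (Fin n → (V_ ξ : ZFSet.{u}))
  let e : Empty → ZFSet.{u} := Unique.instInhabited.default
  have hw : ∀ (ξ : Ordinal.{u}) (p : I ξ), ∃ o : Ordinal.{u}, ∀ a : ZFSet.{u},
      p.2.1.Realize e (Fin.snoc (fun i => (p.2.2 i : ZFSet.{u})) a : Fin (p.1 + 1) → _) →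
      ∃ b : ZFSet.{u}, b.rank < o ∧
        p.2.1.Realize e (Fin.snoc (fun i => (p.2.2 i : ZFSet.{u})) b : Fin (p.1 + 1) → _) := by
    intro ξ p
    by_cases h : ∃ a : ZFSet.{u}, p.2.1.Realize e
      (Fin.snoc (fun i => (p.2.2 i : ZFSet.{u})) a : Fin (p.1 + 1) → _)
    · obtain ⟨a, ha⟩ := h
      exact ⟨a.rank + 1, fun _ _ => ⟨a, lt_add_one _, ha⟩⟩
    · exact ⟨0, fun a ha => (h ⟨a, ha⟩).elim⟩
  choose o ho using hw
  -- `V_ (g ξ)` contains a witness for each existential statement over `V_ ξ` that is true in the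
  -- universe. After ω iterations the Tarski–Vaught test applies, as finitely many parameters
  -- already lie in one stage.
  let g (ξ : Ordinal.{u}) : Ordinal.{u} := max (ξ + 1) (⨆ p : I ξ, o ξ p)
  have hsmall : ∀ ξ, Small.{u} (I ξ) := fun ξ => inferInstance
  have hog : ∀ ξ p, o ξ p ≤ g ξ := fun ξ p =>
    (le_ciSup (Ordinal.bddAbove_of_small) p).trans (le_max_right _ _)
  let a (n : ℕ) : Ordinal.{u} := g^[n] (β + 1)
  have ha : ∀ n, a (n + 1) = g (a n) := fun n => Function.iterate_succ_apply' _ _ _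
  have hlt : ∀ n, a n < a (n + 1) := fun n => by
    rw [ha]
    exact (lt_add_one _).trans_le (le_max_left _ _)
  have hmono : Monotone a := monotone_nat_of_le_succ fun n => (hlt n).le
  have hbdd : BddAbove (Set.range a) := Ordinal.bddAbove_of_small
  refine ⟨⨆ n, a n, ?_, ?_⟩
  · exact (lt_add_one β).trans_le (le_ciSup hbdd 0)
  let f : (V_ (⨆ n, a n) : ZFSet.{u}) ↪[setLang] ZFSet.{u} :=
    { toFun := Subtype.val
      inj' := Subtype.val_injective
      map_fun' := fun f => f.elim
      map_rel' := fun r x => by cases r; exact Iff.rfl }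
  refine fun _ k φ _ v => (f.isElementary_of_exists ?_ φ v).symm
  intro n φ x b hb
  have hx : ∀ i, ∃ m, (x i : ZFSet.{u}).rank < a m := by
    intro i
    have := ZFSet.mem_vonNeumann.1 (x i).2
    exact (lt_ciSup_iff hbdd).1 this
  choose m hm using hx
  obtain ⟨N, hN⟩ : ∃ N, ∀ i, m i ≤ N :=
    ⟨Finset.univ.sup m, fun i => Finset.le_sup (Finset.mem_univ i)⟩
  let p : I (a N) := ⟨n, φ, fun i => ⟨x i, ZFSet.mem_vonNeumann.2
    ((hm i).trans_le (hmono (hN i)))⟩⟩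
  obtain ⟨c, hc, hc'⟩ := ho (a N) p b hb
  refine ⟨⟨c, ZFSet.mem_vonNeumann.2 ?_⟩, hc'⟩
  refine (hc.trans_le (hog _ _)).trans_le ?_
  rw [← ha]
  exact le_ciSup hbdd (N + 1)

/-- A `Σ_{n+1}`-correct `V_α` contains witnesses of `Π_n` properties of its elements. -/
theorem exists_mem_of_sigmaCorrect {n : ℕ} {α : Ordinal.{u}} (h : α ∈ sigmaCorrect (n + 1))
    {ι : Type} [Finite ι] {R : (ι → ZFSet.{u}) → ZFSet.{u} → Prop}
    (hR : PiPred n fun w : Option ι → ZFSet.{u} => R (fun i => w (some i)) (w none))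
    (v : ι → ZFSet.{u}) (hv : ∀ i, v i ∈ V_ α) (hx : ∃ x, R v x) : ∃ x ∈ V_ α, R v x := by
  obtain ⟨φ, hφ, H⟩ := hR.exists_formula.2
  let σ : Option ι ⊕ Fin 0 → ι ⊕ Fin 1 :=
    Sum.elim (fun o => o.elim (.inr 0) .inl) Fin.elim0
  let ψ : setLang.Formula ι := (renameFormula φ σ).ex
  have hψ : IsLevy .sigma (n + 1) ψ := .ex (.sigma_of_pi (hφ.rename σ))
  have hval : ∀ (v : ι → ZFSet.{u}) (x : ZFSet.{u}),
      (renameFormula φ σ).Realize v (Fin.snoc default x : Fin 1 → ZFSet.{u}) ↔ R v x := by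
    intro v x
    rw [realize_renameFormula_formula, H, not_not]
    exact Iff.rfl
  let v' : ι → (V_ α : ZFSet.{u}) := fun i => ⟨v i, hv i⟩
  have h1 : (BoundedFormula.Realize ψ (fun i => (v' i : ZFSet.{u})) fun i => i.elim0) := by
    obtain ⟨x, hx⟩ := hx
    rw [Subsingleton.elim (fun i : Fin 0 => _) (default : Fin 0 → ZFSet.{u})]
    exact BoundedFormula.realize_ex.2 ⟨x, (hval v x).2 hx⟩
  have h2 := ((sigmaCorrect_iff.1 h).realize_bounded hψ v' default).2
    (by convert h1)
  obtain ⟨x, hx⟩ := BoundedFormula.realize_ex.1 h2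
  refine ⟨x, x.2, ?_⟩
  rw [← hval]
  -- The witness satisfies the Π_n matrix in `V_ α`; Σ_n-correctness transfers the matrix to the
  -- universe.
  have := ((sigmaCorrect_iff.1 (sigmaCorrect_anti n.le_succ h)).realize_bounded
    (hφ.rename σ) v' (Fin.snoc default x)).1 hx
  rwa [coe_snoc, Subsingleton.elim (fun i : Fin 0 => _) (default : Fin 0 → ZFSet.{u})] at this

end Correct

/-! ### Limit levels, ω, and closure of levels under set operations. -/

section Limit

/-- Some set has `ξ` as an element, so one in `V_ α` does, and its rank exceeds `ξ`. -/
theorem add_one_lt_of_sigmaCorrect {n : ℕ} {α : Ordinal.{u}} (h : α ∈ sigmaCorrect (n + 1)) :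
    ∀ ξ < α, ξ + 1 < α := by
  intro ξ hξ
  obtain ⟨x, hx, hx'⟩ := exists_mem_of_sigmaCorrect (ι := Unit) h (R := fun v x => v () ∈ x)
    (.of_deltaZero inferInstance) (fun _ => ξ.toZFSet)
      (fun _ => by simpa using ZFSet.mem_vonNeumann.2 (by simpa using hξ))
    ⟨_, ZFSet.mem_singleton.2 rfl⟩
  have h1 := ZFSet.rank_lt_of_mem hx'
  rw [rank_toZFSet] at h1
  exact (Order.add_one_le_of_lt h1).trans_lt (ZFSet.mem_vonNeumann.1 hx)

/-- Ranks climb strictly along an ∈-chain that never stops. The hypotheses are Δ₀, so they serve as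
an axiom of infinity that does not mention ω. -/
theorem omega_le_rank {x : ZFSet.{u}} (h0 : ∃ y, y ∈ x) (h : ∀ y ∈ x, ∃ z ∈ x, y ∈ z) :
    ω ≤ x.rank := by
  rw [Ordinal.omega0_le]
  have : ∀ n : ℕ, ∃ y ∈ x, (n : Ordinal.{u}) ≤ y.rank := by
    intro n
    induction n with
    | zero =>
      obtain ⟨y, hy⟩ := h0
      exact ⟨y, hy, by simp⟩
    | succ n ih =>
      obtain ⟨y, hy, hn⟩ := ih
      obtain ⟨z, hz, hyz⟩ := h y hy
      refine ⟨z, hz, ?_⟩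
      rw [Nat.cast_succ]
      exact Order.add_one_le_of_lt (hn.trans_lt (ZFSet.rank_lt_of_mem hyz))
  intro n
  obtain ⟨y, hy, hn⟩ := this n
  exact hn.trans (ZFSet.rank_lt_of_mem hy).le

theorem exists_infinite_set : ∃ x : ZFSet.{u}, x.rank = ω ∧ (∃ y, y ∈ x) ∧
    ∀ y ∈ x, ∃ z ∈ x, y ∈ z := by
  refine ⟨(ω : Ordinal.{u}).toZFSet, rank_toZFSet _, ⟨(0 : Ordinal.{u}).toZFSet, ?_⟩, ?_⟩
  · rw [toZFSet_mem_toZFSet_iff]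
    exact omega0_pos
  · intro y hy
    obtain ⟨a, ha, rfl⟩ := mem_toZFSet_iff.1 hy
    refine ⟨(a + 1).toZFSet, ?_, ?_⟩
    · rw [toZFSet_mem_toZFSet_iff]
      exact isSuccLimit_omega0.add_one_lt ha
    · rw [toZFSet_mem_toZFSet_iff]
      exact lt_add_one a

theorem omega_lt_of_sigmaCorrect {n : ℕ} {α : Ordinal.{u}} (h : α ∈ sigmaCorrect (n + 1)) :
    ω < α := by
  obtain ⟨y, -, h0, h1⟩ := exists_infinite_set.{u}
  obtain ⟨x, hx, h2, h3⟩ := exists_mem_of_sigmaCorrect (ι := Empty) h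
    (R := fun _ x => (∃ y ∈ x, y = y) ∧ ∀ y ∈ x, ∃ z ∈ x, y ∈ z)
    (.of_deltaZero inferInstance) (fun e => e.elim) (fun e => e.elim)
    ⟨y, by simpa using h0, h1⟩
  exact (omega_le_rank (by simpa using h2) h3).trans_lt (ZFSet.mem_vonNeumann.1 hx)

variable {α : Ordinal.{u}} {x y : ZFSet.{u}}

theorem powerset_mem_vonNeumann (hα : ∀ ξ < α, ξ + 1 < α) (hx : x ∈ V_ α) : x.powerset ∈ V_ α := by
  rw [ZFSet.mem_vonNeumann, ZFSet.rank_powerset] at *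
  exact hα _ hx

theorem union_mem_vonNeumann (hx : x ∈ V_ α) (hy : y ∈ V_ α) : x ∪ y ∈ V_ α := by
  rw [ZFSet.mem_vonNeumann, ZFSet.rank_union] at *
  exact max_lt hx hy

theorem prod_mem_vonNeumann (hα : ∀ ξ < α, ξ + 1 < α) (hx : x ∈ V_ α) (hy : y ∈ V_ α) :
    x.prod y ∈ V_ α := by
  refine ZFSet.mem_vonNeumann_of_subset ?_ (powerset_mem_vonNeumann hα (powerset_mem_vonNeumann hα
    (union_mem_vonNeumann hx hy)))
  rw [ZFSet.prod]
  exact ZFSet.sep_subset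

theorem pair_mem_vonNeumann (hα : ∀ ξ < α, ξ + 1 < α) (hx : x ∈ V_ α) (hy : y ∈ V_ α) :
    ZFSet.pair x y ∈ V_ α := by
  simp only [ZFSet.mem_vonNeumann, ZFSet.pair, ZFSet.rank_pair, ZFSet.rank_singleton] at *
  have h : ∀ ξ < α, Order.succ ξ < α := hα
  exact max_lt (h _ (h _ hx)) (h _ (max_lt (h _ hx) (h _ hy)))

end Limit

theorem toZFSet_mem_vonNeumann {ξ α : Ordinal.{u}} : ξ.toZFSet ∈ V_ α ↔ ξ < α := by
  rw [ZFSet.mem_vonNeumann, rank_toZFSet]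

/-! ### The rank function and the definition of the levels V_a. -/

section RankFunction

/-- `f` restricted to the transitive set `t` is the rank function. -/
def IsRankFn (f t : ZFSet.{u}) : Prop :=
  t.IsTransitive ∧ (∀ x ∈ t, ∃ β, ZFSet.pair x β ∈ f ∧ β = β) ∧
    ∀ x ∈ t, ∀ β, ZFSet.pair x β ∈ f → β.IsTransitive ∧
      (∀ γ ∈ β, ∃ y ∈ x, ∃ γ', ZFSet.pair y γ' ∈ f ∧ (γ = γ' ∨ γ ∈ γ')) ∧
      ∀ y ∈ x, ∃ γ', ZFSet.pair y γ' ∈ f ∧ γ' ∈ β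

instance DeltaZero.isRankFn {ι : Type} (a b : ι) :
    DeltaZero fun v : ι → ZFSet.{u} => IsRankFn (v a) (v b) := by
  unfold IsRankFn
  infer_instance

/-- By ∈-induction on `x`: the clauses make each value transitive, above the values at members of
`x`, and exhausted by those values and their elements. This is the recursion for the rank. -/
theorem IsRankFn.pair_mem_iff {f t : ZFSet.{u}} (h : IsRankFn f t) {x β : ZFSet.{u}} (hx : x ∈ t) :
    ZFSet.pair x β ∈ f ↔ β = x.rank.toZFSet := by
  induction x using ZFSet.inductionOn generalizing β with
  | _ x ih =>
  have key : ∀ β, ZFSet.pair x β ∈ f → β = x.rank.toZFSet := by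
    intro β hβ
    obtain ⟨h1, h2, h3⟩ := h.2.2 x hx β hβ
    ext γ
    rw [mem_toZFSet_iff]
    constructor
    · intro hγ
      obtain ⟨y, hy, γ', hγ', h4⟩ := h2 γ hγ
      have hyx := ZFSet.rank_lt_of_mem hy
      rw [ih y hy (h.1.subset_of_mem hx hy)] at hγ'
      subst hγ'
      rcases h4 with rfl | h4
      · exact ⟨_, hyx, rfl⟩
      · obtain ⟨a, ha, rfl⟩ := mem_toZFSet_iff.1 h4
        exact ⟨a, ha.trans hyx, rfl⟩
    · rintro ⟨a, ha, rfl⟩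
      obtain ⟨y, hy, hay⟩ := ZFSet.lt_rank_iff.1 ha
      obtain ⟨γ', h4, h5⟩ := h3 y hy
      rw [ih y hy (h.1.subset_of_mem hx hy)] at h4
      subst h4
      rcases hay.eq_or_lt with rfl | hay
      · exact h5
      · exact h1.subset_of_mem h5 (toZFSet_mem_toZFSet_iff.2 hay)
  refine ⟨key β, ?_⟩
  rintro rfl
  obtain ⟨β, hβ, -⟩ := h.2.1 x hx
  rwa [key β hβ] at hβ

/-- The rank function on a set. -/
noncomputable def rankFn (t : ZFSet.{u}) : ZFSet.{u} :=
  ZFSet.range fun x : t => ZFSet.pair x (x : ZFSet.{u}).rank.toZFSet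

theorem pair_mem_rankFn {t x β : ZFSet.{u}} :
    ZFSet.pair x β ∈ rankFn t ↔ x ∈ t ∧ β = x.rank.toZFSet := by
  simp only [rankFn, ZFSet.mem_range, ZFSet.pair_inj, Subtype.exists]
  constructor
  · rintro ⟨y, hy, rfl, rfl⟩
    exact ⟨hy, rfl⟩
  · rintro ⟨hx, rfl⟩
    exact ⟨x, hx, rfl, rfl⟩

theorem isRankFn_rankFn {t : ZFSet.{u}} (ht : t.IsTransitive) : IsRankFn (rankFn t) t := by
  refine ⟨ht, fun x hx => ⟨_, pair_mem_rankFn.2 ⟨hx, rfl⟩, rfl⟩, ?_⟩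
  intro x hx β hβ
  obtain ⟨-, rfl⟩ := pair_mem_rankFn.1 hβ
  refine ⟨(ZFSet.isOrdinal_toZFSet _).isTransitive, fun γ hγ => ?_, fun y hy => ?_⟩
  · obtain ⟨a, ha, rfl⟩ := mem_toZFSet_iff.1 hγ
    obtain ⟨y, hy, hay⟩ := ZFSet.lt_rank_iff.1 ha
    refine ⟨y, hy, _, pair_mem_rankFn.2 ⟨ht.subset_of_mem hx hy, rfl⟩, ?_⟩
    rcases hay.eq_or_lt with rfl | hay
    exacts [.inl rfl, .inr (toZFSet_mem_toZFSet_iff.2 hay)]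
  · exact ⟨_, pair_mem_rankFn.2 ⟨ht.subset_of_mem hx hy, rfl⟩,
      toZFSet_mem_toZFSet_iff.2 (ZFSet.rank_lt_of_mem hy)⟩

theorem rankFn_mem_vonNeumann {α : Ordinal.{u}} (hα : ∀ ξ < α, ξ + 1 < α) {t : ZFSet.{u}}
    (ht : t ∈ V_ α) : rankFn t ∈ V_ α := by
  refine ZFSet.mem_vonNeumann_of_subset (y := t.prod t.rank.toZFSet) ?_
    (prod_mem_vonNeumann hα ht (toZFSet_mem_vonNeumann.2 (ZFSet.mem_vonNeumann.1 ht)))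
  rw [ZFSet.subset_def]
  intro p hp
  obtain ⟨⟨x, hx⟩, rfl⟩ := ZFSet.mem_range.1 hp
  rw [ZFSet.pair_mem_prod]
  exact ⟨hx, toZFSet_mem_toZFSet_iff.2 (ZFSet.rank_lt_of_mem hx)⟩

/-- The `Π_1` definition of the levels `V_ a` of the cumulative hierarchy. -/
def IsLevel (w a : ZFSet.{u}) : Prop :=
  ∀ t f, IsRankFn f t → ∀ y ∈ t, (y ∈ w ↔ ∃ β, ZFSet.pair y β ∈ f ∧ β ∈ a)

theorem piPred_isLevel {ι : Type} (a b : ι) :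
    PiPred 1 fun v : ι → ZFSet.{u} => IsLevel (v a) (v b) :=
  .all (R := fun v t => ∀ f, IsRankFn f t → ∀ y ∈ t, (y ∈ v a ↔ ∃ β, ZFSet.pair y β ∈ f ∧ β ∈ v b))
    (.all (.of_deltaZero inferInstance))

theorem IsRankFn.mem_iff {f t : ZFSet.{u}} (h : IsRankFn f t) {y : ZFSet.{u}} (hy : y ∈ t)
    (α : Ordinal.{u}) : (∃ β, ZFSet.pair y β ∈ f ∧ β ∈ α.toZFSet) ↔ y ∈ V_ α := by
  simp [h.pair_mem_iff hy, ZFSet.mem_vonNeumann]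

/-- Every set lies in some transitive `V_ o`, which has a rank function; hence the universal
quantifier in `IsLevel` decides membership of every `y`. -/
theorem isLevel_iff {w : ZFSet.{u}} {α : Ordinal.{u}} : IsLevel w α.toZFSet ↔ w = V_ α := by
  constructor
  · intro h
    ext y
    obtain ⟨o, ho⟩ := ZFSet.exists_mem_vonNeumann y
    have hf := isRankFn_rankFn (ZFSet.isTransitive_vonNeumann o)
    rw [h _ _ hf y ho, hf.mem_iff ho]
  · rintro rfl t f hf y hy
    rw [hf.mem_iff hy]

end RankFunction

/-! ### Elementary embeddings between levels. -/

section Elementary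

variable {α β : Ordinal.{u}} (j : (V_ α : ZFSet.{u}) ↪ₑ[setLang] (V_ β : ZFSet.{u}))

open Classical in
/-- An embedding `j : V_α → V_β` as an operation on sets. -/
noncomputable def appSet (x : ZFSet.{u}) : ZFSet.{u} :=
  if h : x ∈ V_ α then j ⟨x, h⟩ else ∅

variable {j} {x y : ZFSet.{u}}

theorem appSet_coe (x : (V_ α : ZFSet.{u})) : appSet j x = j x := by
  simp [appSet]

theorem appSet_mem (hx : x ∈ V_ α) : appSet j x ∈ V_ β := by
  rw [appSet, dif_pos hx]
  exact Subtype.prop _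

theorem sends_iff (hx : x ∈ V_ α) : Sends j x y ↔ appSet j x = y := by
  simp [Sends, appSet, hx]

theorem DeltaZero.appSet_iff {ι : Type} {P : (ι → ZFSet.{u}) → Prop} (hP : DeltaZero P)
    (v : ι → ZFSet.{u}) (hv : ∀ i, v i ∈ V_ α) : P v ↔ P fun i => appSet j (v i) := by
  obtain ⟨φ, hφ, H⟩ := hP
  have habs : ∀ {γ : Ordinal.{u}} (w : ι → (V_ γ : ZFSet.{u})),
      φ.Realize w ↔ P fun i => w i := by
    intro γ w
    rw [← H, Formula.Realize, hφ.realize_coe (ZFSet.isTransitive_vonNeumann _)]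
    exact iff_of_eq (congrArg _ (Subsingleton.elim _ _))
  have h1 := habs fun i => (⟨v i, hv i⟩ : (V_ α : ZFSet.{u}))
  have h2 := habs fun i => j ⟨v i, hv i⟩
  simp only [← appSet_coe] at h2
  rw [← h1, ← h2, ← j.map_formula]
  rfl

/-- Neither level has to be correct, since the witnesses are confined to the levels and the Δ₀
matrix is absolute for both. -/
theorem DeltaZero.appSet_exists {ι κ : Type} [Finite κ] {Q : (ι ⊕ κ → ZFSet.{u}) → Prop}
    (hQ : DeltaZero Q) (v : ι → ZFSet.{u}) (hv : ∀ i, v i ∈ V_ α) :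
    (∃ w : κ → ZFSet.{u}, (∀ k, w k ∈ V_ α) ∧ Q (Sum.elim v w)) ↔
      ∃ w : κ → ZFSet.{u}, (∀ k, w k ∈ V_ β) ∧ Q (Sum.elim (fun i => appSet j (v i)) w) := by
  obtain ⟨φ, hφ, H⟩ := hQ
  obtain ⟨m, ⟨e⟩⟩ := Finite.exists_equiv_fin κ
  let σ : (ι ⊕ κ) ⊕ Fin 0 → ι ⊕ Fin m := Sum.elim (Sum.map id e) Fin.elim0
  have key : ∀ {γ : Ordinal.{u}} (v : ι → (V_ γ : ZFSet.{u})),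
      (renameFormula φ σ).exs.Realize v ↔
        ∃ w : κ → ZFSet.{u}, (∀ k, w k ∈ V_ γ) ∧ Q (Sum.elim (fun i => (v i : ZFSet.{u})) w) := by
    intro γ v
    rw [BoundedFormula.realize_exs]
    have h1 : ∀ xs : Fin m → (V_ γ : ZFSet.{u}), (renameFormula φ σ).Realize v xs ↔
        Q (Sum.elim (fun i => (v i : ZFSet.{u})) fun k => xs (e k)) := by
      intro xs
      rw [(hφ.rename σ).realize_coe (ZFSet.isTransitive_vonNeumann _),
        realize_renameFormula_formula, H]
      refine iff_of_eq (congrArg Q ?_)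
      funext a
      rcases a with a | a <;> rfl
    simp only [h1]
    constructor
    · rintro ⟨xs, h⟩
      exact ⟨_, fun k => Subtype.prop _, h⟩
    · rintro ⟨w, hw, h⟩
      exact ⟨fun i => ⟨w (e.symm i), hw _⟩, by simpa using h⟩
  have h1 := key fun i => (⟨v i, hv i⟩ : (V_ α : ZFSet.{u}))
  have h2 := key fun i => j ⟨v i, hv i⟩
  simp only [← appSet_coe] at h2
  rw [← h1, ← h2, ← j.map_formula]
  rfl

theorem DeltaZero.appSet_forall {ι κ : Type} [Finite κ] {Q : (ι ⊕ κ → ZFSet.{u}) → Prop}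
    (hQ : DeltaZero Q) (v : ι → ZFSet.{u}) (hv : ∀ i, v i ∈ V_ α) :
    (∀ w : κ → ZFSet.{u}, (∀ k, w k ∈ V_ α) → Q (Sum.elim v w)) ↔
      ∀ w : κ → ZFSet.{u}, (∀ k, w k ∈ V_ β) → Q (Sum.elim (fun i => appSet j (v i)) w) := by
  have := DeltaZero.appSet_exists (j := j) (inferInstance : DeltaZero fun v => ¬ Q v) v hv
  rw [← not_iff_not]
  push Not
  exact this

/-- Correctness of both levels lets the truth of `P` in the universe be computed in `V_ α` before
applying `j` and in `V_ β` afterwards. -/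
theorem SigmaPred.appSet_iff {n : ℕ} (hα : α ∈ sigmaCorrect n) (hβ : β ∈ sigmaCorrect n)
    {ι : Type} [Finite ι] {P : (ι → ZFSet.{u}) → Prop} (hP : SigmaPred n P)
    (v : ι → ZFSet.{u}) (hv : ∀ i, v i ∈ V_ α) : P v ↔ P fun i => appSet j (v i) := by
  obtain ⟨φ, hφ, H⟩ := hP.exists_formula.1
  have habs : ∀ {γ : Ordinal.{u}}, γ ∈ sigmaCorrect n → ∀ (w : ι → (V_ γ : ZFSet.{u})),
      φ.Realize w ↔ P fun i => w i := by
    intro γ hγ w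
    rw [← H, Formula.Realize, (sigmaCorrect_iff.1 hγ).realize_bounded hφ]
    exact iff_of_eq (congrArg _ (Subsingleton.elim _ _))
  have h1 := habs hα fun i => (⟨v i, hv i⟩ : (V_ α : ZFSet.{u}))
  have h2 := habs hβ fun i => j ⟨v i, hv i⟩
  simp only [← appSet_coe] at h2
  rw [← h1, ← h2, ← j.map_formula]
  rfl

theorem appSet_mem_appSet (hx : x ∈ V_ α) (hy : y ∈ V_ α) : appSet j x ∈ appSet j y ↔ x ∈ y :=
  (DeltaZero.appSet_iff (DeltaZero.mem (0 : Fin 2) 1) ![x, y] (by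
    intro i; fin_cases i <;> assumption)).symm

theorem appSet_pair (hα : ∀ ξ < α, ξ + 1 < α) (hx : x ∈ V_ α) (hy : y ∈ V_ α) :
    appSet j (ZFSet.pair x y) = ZFSet.pair (appSet j x) (appSet j y) :=
  (DeltaZero.appSet_iff (DeltaZero.eqPair (0 : Fin 3) 1 2) ![ZFSet.pair x y, x, y] (by
    intro i; fin_cases i; exacts [pair_mem_vonNeumann hα hx hy, hx, hy])).1 rfl

theorem isOrdinal_appSet (hx : x ∈ V_ α) : (appSet j x).IsOrdinal ↔ x.IsOrdinal :=
  (DeltaZero.appSet_iff (DeltaZero.isOrdinal ()) (fun _ => x) (fun _ => hx)).symm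

variable (j) in
/-- The action of an embedding `j : V_α → V_β` on ordinals. -/
noncomputable def appOrd (ξ : Ordinal.{u}) : Ordinal.{u} := (appSet j ξ.toZFSet).rank

variable {ξ η : Ordinal.{u}}

theorem appSet_toZFSet (hξ : ξ < α) : appSet j ξ.toZFSet = (appOrd j ξ).toZFSet :=
  (((isOrdinal_appSet (toZFSet_mem_vonNeumann.2 hξ)).2
    (ZFSet.isOrdinal_toZFSet ξ)).toZFSet_rank_eq).symm

theorem appOrd_lt (hξ : ξ < α) : appOrd j ξ < β :=
  ZFSet.mem_vonNeumann.1 (appSet_mem (toZFSet_mem_vonNeumann.2 hξ))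

theorem appOrd_lt_appOrd (hξ : ξ < α) (hη : η < α) : appOrd j ξ < appOrd j η ↔ ξ < η := by
  rw [← toZFSet_mem_toZFSet_iff, ← appSet_toZFSet hξ, ← appSet_toZFSet hη, appSet_mem_appSet,
    toZFSet_mem_toZFSet_iff] <;> rwa [toZFSet_mem_vonNeumann]

theorem sends_toZFSet (hξ : ξ < α) : Sends j ξ.toZFSet η.toZFSet ↔ appOrd j ξ = η := by
  rw [sends_iff (toZFSet_mem_vonNeumann.2 hξ), appSet_toZFSet hξ, toZFSet_injective.eq_iff]

theorem isCriticalPoint_iff : IsCriticalPoint j ξ ↔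
    ξ < α ∧ appOrd j ξ ≠ ξ ∧ ∀ η < ξ, appOrd j η = η := by
  constructor
  · rintro ⟨⟨h1, h2⟩, h3⟩
    rw [sends_toZFSet h1] at h2
    refine ⟨h1, h2, fun η hη => ?_⟩
    by_contra h
    exact (h3 ⟨hη.trans h1, by rwa [sends_toZFSet (hη.trans h1)]⟩).not_gt hη
  · rintro ⟨h1, h2, h3⟩
    refine ⟨⟨h1, by rwa [sends_toZFSet h1]⟩, ?_⟩
    rintro η ⟨h4, h5⟩
    by_contra h
    exact h5 ((sends_toZFSet h4).2 (h3 η (not_le.1 h)))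

/-- Having limit height is a first-order property of a level: every set is an element of some set.
-/
theorem forall_add_one_lt_of_elementary (j : (V_ α : ZFSet.{u}) ↪ₑ[setLang] (V_ β : ZFSet.{u}))
    (hα : ∀ ξ < α, ξ + 1 < α) : ∀ ξ < β, ξ + 1 < β := by
  let φ : setLang.Formula Empty := .all (.ex (memFormula (.var (.inr 0)) (.var (.inr 1))))
  have key : ∀ (γ : Ordinal.{u}) (e : Empty → (V_ γ : ZFSet.{u})), φ.Realize e ↔
      ∀ x : (V_ γ : ZFSet.{u}), ∃ y : (V_ γ : ZFSet.{u}), (x : ZFSet.{u}) ∈ (y : ZFSet.{u}) := by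
    intro γ e
    simp only [φ, Formula.Realize, BoundedFormula.realize_all, BoundedFormula.realize_ex,
      realize_memFormula_set]
    rfl
  have h1 : φ.Realize (fun e : Empty => (e.elim : (V_ α : ZFSet.{u}))) := by
    rw [key]
    intro x
    refine ⟨⟨{(x : ZFSet.{u})}, ?_⟩, ZFSet.mem_singleton.2 rfl⟩
    rw [ZFSet.mem_vonNeumann, ZFSet.rank_singleton]
    exact hα _ (ZFSet.mem_vonNeumann.1 x.2)
  rw [← j.map_formula, key] at h1
  intro ξ hξ
  obtain ⟨y, hy⟩ := h1 ⟨ξ.toZFSet, toZFSet_mem_vonNeumann.2 hξ⟩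
  have h2 := ZFSet.rank_lt_of_mem hy
  rw [rank_toZFSet] at h2
  exact (Order.add_one_le_of_lt h2).trans_lt (ZFSet.mem_vonNeumann.1 y.2)

/-- The rank function on `V_ (x.rank + 1)` lies in `V_ α`, and `j` sends it to a rank function whose
domain contains `j(x)`. -/
theorem rank_appSet (hα : ∀ ξ < α, ξ + 1 < α) (hx : x ∈ V_ α) :
    (appSet j x).rank = appOrd j x.rank := by
  have hr := ZFSet.mem_vonNeumann.1 hx
  set t := V_ (x.rank + 1) with ht
  have htα : t ∈ V_ α := ZFSet.vonNeumann_mem_of_lt (hα _ hr)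
  have hxt : x ∈ t := ZFSet.mem_vonNeumann.2 (lt_add_one _)
  have hf := isRankFn_rankFn (ZFSet.isTransitive_vonNeumann (x.rank + 1))
  have hfα := rankFn_mem_vonNeumann hα htα
  have hrα : x.rank.toZFSet ∈ V_ α := toZFSet_mem_vonNeumann.2 hr
  have h1 : IsRankFn (appSet j (rankFn t)) (appSet j t) :=
    (DeltaZero.appSet_iff (DeltaZero.isRankFn (0 : Fin 2) 1) ![rankFn t, t] (by
      intro i; fin_cases i <;> assumption)).1 hf
  have h2 : ZFSet.pair (appSet j x) (appSet j x.rank.toZFSet) ∈ appSet j (rankFn t) := by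
    rw [← appSet_pair hα hx hrα, appSet_mem_appSet (pair_mem_vonNeumann hα hx hrα) hfα]
    exact (hf.pair_mem_iff hxt).2 rfl
  rw [h1.pair_mem_iff ((appSet_mem_appSet hx htα).2 hxt)] at h2
  rw [appOrd, h2, rank_toZFSet]

/-- `j` preserves the Π_1 definition of a level, read inside `V_ α` and `V_ β`. As `β` is a limit,
each `y ∈ V_ β` is in the domain of a rank function in `V_ β`, so the definition read there is still
decisive. -/
theorem appSet_vonNeumann (hα : ∀ ξ < α, ξ + 1 < α) (hξ : ξ < α) :
    appSet j (V_ ξ) = V_ (appOrd j ξ) := by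
  have hβ := forall_add_one_lt_of_elementary j hα
  have key := (DeltaZero.appSet_forall (j := j) (ι := Fin 2) (κ := Fin 2)
    (Q := fun v => IsRankFn (v (.inr 1)) (v (.inr 0)) → ∀ y ∈ v (.inr 0), (y ∈ v (.inl 0) ↔
      ∃ β, ZFSet.pair y β ∈ v (.inr 1) ∧ β ∈ v (.inl 1))) inferInstance ![V_ ξ, ξ.toZFSet] (by
      intro i; fin_cases i
      exacts [ZFSet.vonNeumann_mem_of_lt hξ, toZFSet_mem_vonNeumann.2 hξ])).1 (by
      intro w _ hf y hy
      exact (hf.mem_iff hy ξ).symm)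
  have key' : ∀ y ∈ V_ β, (y ∈ appSet j (V_ ξ) ↔ y ∈ V_ (appOrd j ξ)) := by
    intro y hy
    have h1 := hβ _ (ZFSet.mem_vonNeumann.1 hy)
    have hf := isRankFn_rankFn (ZFSet.isTransitive_vonNeumann (y.rank + 1))
    have ht := ZFSet.vonNeumann_mem_of_lt h1
    have := key ![V_ (y.rank + 1), rankFn (V_ (y.rank + 1))] (by
      intro i; fin_cases i
      exacts [ht, rankFn_mem_vonNeumann hβ ht]) hf y (ZFSet.mem_vonNeumann.2 (lt_add_one _))
    refine this.trans ?_
    simp only [Sum.elim_inl, Matrix.cons_val_one, Matrix.cons_val_fin_one]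
    rw [appSet_toZFSet hξ]
    exact hf.mem_iff (ZFSet.mem_vonNeumann.2 (lt_add_one _)) _
  ext y
  constructor
  · intro hy
    refine (key' y ?_).1 hy
    exact (ZFSet.isTransitive_vonNeumann β).subset_of_mem
      (appSet_mem (ZFSet.vonNeumann_mem_of_lt hξ)) hy
  · intro hy
    refine (key' y ?_).2 hy
    exact ZFSet.mem_vonNeumann.2 ((ZFSet.mem_vonNeumann.1 hy).trans (appOrd_lt hξ))

/-- Induction on rank: `j(x)` has the same rank as `x`, so the members of either set have smaller
rank and are fixed already. -/
theorem appSet_eq_self (hα : ∀ ξ < α, ξ + 1 < α) {δ : Ordinal.{u}} (hj : IsCriticalPoint j δ)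
    (hx : x ∈ V_ δ) : appSet j x = x := by
  obtain ⟨h1, -, h3⟩ := isCriticalPoint_iff.1 hj
  induction hρ : x.rank using WellFoundedLT.induction generalizing x with
  | _ ρ ih =>
  subst hρ
  have hxδ := ZFSet.mem_vonNeumann.1 hx
  have hxα := ZFSet.mem_vonNeumann.2 (hxδ.trans h1)
  have hr : (appSet j x).rank = x.rank := by
    rw [rank_appSet hα hxα, h3 _ hxδ]
  have aux : ∀ y, y.rank < x.rank → (y ∈ appSet j x ↔ y ∈ x) := by
    intro y hy
    have := ih _ hy (ZFSet.mem_vonNeumann.2 (hy.trans hxδ)) rfl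
    conv_lhs => rw [← this]
    exact appSet_mem_appSet (ZFSet.mem_vonNeumann.2 ((hy.trans hxδ).trans h1)) hxα
  ext y
  constructor
  · intro hy
    exact (aux y (by rw [← hr]; exact ZFSet.rank_lt_of_mem hy)).1 hy
  · intro hy
    exact (aux y (ZFSet.rank_lt_of_mem hy)).2 hy

/-- Truth in `V_ ξ` is a Δ₀ statement about the set `V_ ξ`, which `j` sends to `V_ (appOrd j ξ)`. -/
theorem realize_appSet (hα : ∀ ξ < α, ξ + 1 < α) (hξ : ξ < α) {ι : Type} (φ : setLang.Formula ι)
    (v : ι → (V_ ξ : ZFSet.{u})) (w : ι → (V_ (appOrd j ξ) : ZFSet.{u}))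
    (hw : ∀ i, (w i : ZFSet.{u}) = appSet j (v i)) : φ.Realize w ↔ φ.Realize v := by
  have hP : DeltaZero fun u : Option ι → ZFSet.{u} => Formula.Realize (relativize φ) u :=
    ⟨relativize φ, isDeltaZero_relativize φ, fun _ => Iff.rfl⟩
  have hv : ∀ i, (v i : ZFSet.{u}) ∈ V_ α := fun i =>
    ZFSet.vonNeumann_subset_of_le hξ.le (v i).2
  have key : ∀ {γ : Ordinal.{u}} (v : ι → (V_ γ : ZFSet.{u})), φ.Realize v ↔
      Formula.Realize (relativize φ) fun a : Option ι => a.elim (V_ γ) fun a => (v a : ZFSet.{u}) :=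
        by
    intro γ v
    rw [Formula.Realize, ← realize_relativize, Formula.Realize]
    exact iff_of_eq (congrArg _ (Subsingleton.elim _ _))
  rw [key w, key v, hP.appSet_iff (j := j) fun a : Option ι => a.elim (V_ ξ) fun a =>
    (v a : ZFSet.{u})]
  · refine iff_of_eq (congrArg _ ?_)
    funext a
    cases a
    · exact (appSet_vonNeumann hα hξ).symm
    · exact hw _
  · intro a
    cases a
    · exact ZFSet.vonNeumann_mem_of_lt hξ
    · exact hv _

/-- The restriction of `j : V_α → V_β` to an embedding `V_ξ → V_j(ξ)`. -/
noncomputable def restrictEmb (j : (V_ α : ZFSet.{u}) ↪ₑ[setLang] (V_ β : ZFSet.{u}))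
    (hα : ∀ ξ < α, ξ + 1 < α) (hξ : ξ < α) :
    (V_ ξ : ZFSet.{u}) ↪ₑ[setLang] (V_ (appOrd j ξ) : ZFSet.{u}) where
  toFun x := ⟨appSet j x, by
    rw [← appSet_vonNeumann hα hξ, appSet_mem_appSet (ZFSet.vonNeumann_subset_of_le hξ.le x.2)
      (ZFSet.vonNeumann_mem_of_lt hξ)]
    exact x.2⟩
  map_formula' _ φ v := realize_appSet hα hξ φ v _ fun _ => rfl

theorem appSet_restrictEmb (hα : ∀ ξ < α, ξ + 1 < α) (hξ : ξ < α) (hx : x ∈ V_ ξ) :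
    appSet (restrictEmb j hα hξ) x = appSet j x := by
  rw [appSet, dif_pos hx]
  rfl

theorem appOrd_restrictEmb (hα : ∀ ξ < α, ξ + 1 < α) (hξ : ξ < α) (hη : η < ξ) :
    appOrd (restrictEmb j hα hξ) η = appOrd j η := by
  rw [appOrd, appSet_restrictEmb hα hξ (toZFSet_mem_vonNeumann.2 hη), appOrd]

theorem isCriticalPoint_restrictEmb (hα : ∀ ξ < α, ξ + 1 < α) (hξ : ξ < α) {δ : Ordinal.{u}}
    (hδ : δ < ξ) (h : IsCriticalPoint j δ) : IsCriticalPoint (restrictEmb j hα hξ) δ := by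
  rw [isCriticalPoint_iff] at *
  refine ⟨hδ, by rw [appOrd_restrictEmb hα hξ hδ]; exact h.2.1, fun η hη => ?_⟩
  rw [appOrd_restrictEmb hα hξ (hη.trans hδ)]
  exact h.2.2 η hη

/-- If `δ` is the critical point of `j`, then `V_δ` is an elementary substructure of `V_j(δ)`. -/
theorem realize_iff_of_isCriticalPoint (hα : ∀ ξ < α, ξ + 1 < α) {δ : Ordinal.{u}}
    (hj : IsCriticalPoint j δ) {ι : Type} (φ : setLang.Formula ι)
    (v : ι → (V_ δ : ZFSet.{u})) (w : ι → (V_ (appOrd j δ) : ZFSet.{u}))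
    (hw : ∀ i, (w i : ZFSet.{u}) = v i) : φ.Realize w ↔ φ.Realize v :=
  realize_appSet hα hj.1.1 φ v w fun i => by rw [hw, appSet_eq_self hα hj (v i).2]

theorem lt_appOrd_of_isCriticalPoint {δ : Ordinal.{u}} (hj : IsCriticalPoint j δ) :
    δ < appOrd j δ := by
  obtain ⟨h1, h2, h3⟩ := isCriticalPoint_iff.1 hj
  by_contra h
  have h4 := (not_lt.1 h).lt_of_ne h2
  have h5 := (appOrd_lt_appOrd (j := j) (h4.trans h1) h1).2 h4
  rw [h3 _ h4] at h5
  exact lt_irrefl _ h5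

end Elementary

/-! ### Coding of formulas by hereditarily finite sets. -/

section Coding

/-- Formulas of set theory with variables named by natural numbers. -/
inductive NamedFormula : Type
  | falsum : NamedFormula
  | equal (i j : ℕ) : NamedFormula
  | mem (i j : ℕ) : NamedFormula
  | imp (φ ψ : NamedFormula) : NamedFormula
  | all (i : ℕ) (φ : NamedFormula) : NamedFormula

/-- Satisfaction of a formula with named variables in a set. -/
def NamedFormula.Sat {M : ZFSet.{u}} : NamedFormula → (ℕ → M) → Prop
  | .falsum, _ => False
  | .equal i j, e => e i = e j
  | .mem i j, e => (e i : ZFSet.{u}) ∈ (e j : ZFSet.{u})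
  | .imp φ ψ, e => φ.Sat e → ψ.Sat e
  | .all i φ, e => ∀ x : M, φ.Sat (Function.update e i x)

/-- The name of a term, which is always a variable. -/
def termName {m k : ℕ} : setLang.Term (Fin m ⊕ Fin k) → ℕ
  | .var x => x.elim (fun i : Fin m => (i : ℕ)) fun i : Fin k => m + i
  | .func f _ => f.elim

/-- The formula with named variables for an atomic formula. -/
def relName : ∀ {l : ℕ}, MemRel l → (Fin l → ℕ) → NamedFormula
  | _, .mem, ts => .mem (ts 0) (ts 1)

/-- Translation into formulas with named variables. -/
def toNamed {m : ℕ} : ∀ {k : ℕ}, setLang.BoundedFormula (Fin m) k → NamedFormula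
  | _, .falsum => .falsum
  | _, .equal s t => .equal (termName s) (termName t)
  | _, .rel R ts => relName R fun i => termName (ts i)
  | _, .imp φ ψ => .imp (toNamed φ) (toNamed ψ)
  | k, .all φ => .all (m + k) (toNamed φ)

theorem realize_termName {M : ZFSet.{u}} {m k : ℕ} (t : setLang.Term (Fin m ⊕ Fin k)) (e : ℕ → M) :
    t.realize (Sum.elim (fun i : Fin m => e i) fun i : Fin k => e (m + i)) = e (termName t) := by
  cases t with
  | var x => rcases x with i | i <;> rfl
  | func f => exact f.elim

/-- The free variable `i` has name `i` and the bound variable `i` has name `m + i`, so one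
assignment carries both; a quantifier at depth `k` changes the value at the fresh name `m + k`. -/
theorem sat_toNamed {M : ZFSet.{u}} {m k : ℕ} (φ : setLang.BoundedFormula (Fin m) k) (e : ℕ → M) :
    (toNamed φ).Sat e ↔ φ.Realize (fun i => e i) fun i => e (m + i) := by
  induction φ generalizing e with
  | falsum => exact Iff.rfl
  | equal s t =>
    simp only [BoundedFormula.Realize, realize_termName]
    exact Iff.rfl
  | rel R ts =>
    cases R
    change _ ↔ (((ts 0).realize _ : M) : ZFSet.{u}) ∈ (((ts 1).realize _ : M) : ZFSet.{u})
    rw [realize_termName, realize_termName]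
    exact Iff.rfl
  | imp φ ψ ih₁ ih₂ => exact imp_congr (ih₁ e) (ih₂ e)
  | @all k φ ih =>
    refine forall_congr' fun x => (ih _).trans (iff_of_eq ?_)
    congr 1
    · funext i
      exact Function.update_of_ne (by have := i.2; omega) _ _
    · funext i
      refine Fin.lastCases ?_ (fun i => ?_) i
      · simp
      · simp only [Fin.val_castSucc, Fin.snoc_castSucc]
        exact Function.update_of_ne (by have := i.2; omega) _ _

/-- The von Neumann numeral `n`. -/
noncomputable def numeral (n : ℕ) : ZFSet.{u} := (n : Ordinal.{u}).toZFSet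

theorem numeral_inj {m n : ℕ} : numeral.{u} m = numeral n ↔ m = n := by
  rw [numeral, numeral, toZFSet_injective.eq_iff, Nat.cast_inj]

/-- The set of variable names. -/
noncomputable def names : ZFSet.{u} := (ω : Ordinal.{u}).toZFSet

theorem mem_names {x : ZFSet.{u}} : x ∈ names ↔ ∃ n, x = numeral n := by
  simp only [names, mem_toZFSet_iff, lt_omega0]
  constructor
  · rintro ⟨_, ⟨n, rfl⟩, rfl⟩
    exact ⟨n, rfl⟩
  · rintro ⟨n, rfl⟩
    exact ⟨_, ⟨n, rfl⟩, rfl⟩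

theorem numeral_mem_names (n : ℕ) : numeral.{u} n ∈ names := mem_names.2 ⟨n, rfl⟩

/-- Codes of formulas. -/
noncomputable def NamedFormula.code : NamedFormula → ZFSet.{u}
  | .falsum => ∅
  | .equal i j => .pair (numeral 1) (.pair (numeral i) (numeral j))
  | .mem i j => .pair (numeral 2) (.pair (numeral i) (numeral j))
  | .imp φ ψ => .pair (numeral 3) (.pair φ.code ψ.code)
  | .all i φ => .pair (numeral 4) (.pair (numeral i) φ.code)

theorem pair_ne_empty (x y : ZFSet.{u}) : ZFSet.pair x y ≠ ∅ := by
  intro h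
  have : ({x} : ZFSet.{u}) ∈ ZFSet.pair x y := by simp [ZFSet.pair]
  rw [h] at this
  exact ZFSet.notMem_empty _ this

theorem NamedFormula.code_inj {φ ψ : NamedFormula} : φ.code.{u} = ψ.code ↔ φ = ψ := by
  refine ⟨fun h => ?_, fun h => h ▸ rfl⟩
  induction φ generalizing ψ with
  | falsum =>
    cases ψ <;> first | rfl | exact (pair_ne_empty _ _ h.symm).elim
  | equal i j =>
    cases ψ <;> simp only [code, ZFSet.pair_inj, numeral_inj, pair_ne_empty] at h <;>
      simp_all
  | mem i j =>
    cases ψ <;> simp only [code, ZFSet.pair_inj, numeral_inj, pair_ne_empty] at h <;>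
      simp_all
  | imp φ₁ φ₂ ih₁ ih₂ =>
    cases ψ <;> simp only [code, ZFSet.pair_inj, numeral_inj, pair_ne_empty] at h <;>
      first | (rw [ih₁ h.2.1, ih₂ h.2.2]) | simp_all
  | all i φ ih =>
    cases ψ <;> simp only [code, ZFSet.pair_inj, numeral_inj, pair_ne_empty] at h <;>
      first | (rw [h.2.1, ih h.2.2]) | simp_all

theorem numeral_mem_vonNeumann_omega (n : ℕ) : numeral.{u} n ∈ V_ ω :=
  toZFSet_mem_vonNeumann.2 (natCast_lt_omega0 n)

theorem add_one_lt_omega0 : ∀ ξ < (ω : Ordinal.{u}), ξ + 1 < ω :=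
  fun _ h => isSuccLimit_omega0.add_one_lt h

theorem NamedFormula.code_mem_vonNeumann (φ : NamedFormula) : φ.code.{u} ∈ V_ ω := by
  have hn := numeral_mem_vonNeumann_omega.{u}
  have hp := @pair_mem_vonNeumann.{u} ω
  induction φ with
  | falsum => exact ZFSet.mem_vonNeumann.2 (by simp [code])
  | equal i j => exact hp add_one_lt_omega0 (hn _) (hp add_one_lt_omega0 (hn _) (hn _))
  | mem i j => exact hp add_one_lt_omega0 (hn _) (hp add_one_lt_omega0 (hn _) (hn _))
  | imp φ₁ φ₂ ih₁ ih₂ => exact hp add_one_lt_omega0 (hn _) (hp add_one_lt_omega0 ih₁ ih₂)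
  | all i φ ih => exact hp add_one_lt_omega0 (hn _) (hp add_one_lt_omega0 (hn _) ih)

/-- The set of codes of all formulas. -/
noncomputable def codes : ZFSet.{u} := (V_ ω).sep fun x => ∃ φ : NamedFormula, x = φ.code

theorem mem_codes {x : ZFSet.{u}} : x ∈ codes ↔ ∃ φ : NamedFormula, x = φ.code := by
  rw [codes, ZFSet.mem_sep, and_iff_right_iff_imp]
  rintro ⟨φ, rfl⟩
  exact φ.code_mem_vonNeumann

theorem code_mem_codes (φ : NamedFormula) : φ.code.{u} ∈ codes := mem_codes.2 ⟨φ, rfl⟩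

/-- The constants used in the definition of satisfaction: the set of variable names, the set of
codes, and the tags of the four kinds of composite codes. -/
noncomputable def codingConst : Fin 6 → ZFSet.{u} :=
  ![names, codes, numeral 1, numeral 2, numeral 3, numeral 4]

/-- With `α` the critical point of an embedding, this shows that the constants are fixed. They can
therefore be parameters and need no defining formulas. -/
theorem codingConst_mem {α : Ordinal.{u}} (hα : ω < α) (i : Fin 6) : codingConst i ∈ V_ α := by
  have hn : ∀ n, numeral n ∈ V_ α := fun n =>
    ZFSet.vonNeumann_subset_of_le hα.le (numeral_mem_vonNeumann_omega n)
  have hc : codes ∈ V_ α := by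
    refine ZFSet.mem_vonNeumann_of_subset (y := V_ ω) ?_ (ZFSet.vonNeumann_mem_of_lt hα)
    rw [ZFSet.subset_def]
    intro x hx
    obtain ⟨φ, rfl⟩ := mem_codes.1 hx
    exact φ.code_mem_vonNeumann
  fin_cases i
  exacts [toZFSet_mem_vonNeumann.2 hα, hc, hn 1, hn 2, hn 3, hn 4]

/-- The set of codes of the formulas with property `Φ`. -/
noncomputable def codeSet (Φ : ∀ m : ℕ, setLang.Formula (Fin m) → Prop) : ZFSet.{u} :=
  codes.sep fun x => ∃ m, ∃ φ : setLang.Formula (Fin m), Φ m φ ∧ x = (toNamed φ).code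

theorem mem_codeSet {Φ : ∀ m : ℕ, setLang.Formula (Fin m) → Prop} {x : ZFSet.{u}} :
    x ∈ codeSet Φ ↔ ∃ m, ∃ φ : setLang.Formula (Fin m), Φ m φ ∧ x = (toNamed φ).code := by
  rw [codeSet, ZFSet.mem_sep, and_iff_right_iff_imp]
  rintro ⟨m, φ, -, rfl⟩
  exact code_mem_codes _

/-- The property `Φ` is arbitrary: any set of codes is a subset of `codes`, so no syntactic class
has to be defined inside set theory. -/
theorem codeSet_mem {α : Ordinal.{u}} (hα : ω < α) (Φ : ∀ m : ℕ, setLang.Formula (Fin m) → Prop) :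
    codeSet Φ ∈ V_ α :=
  ZFSet.mem_vonNeumann_of_subset ZFSet.sep_subset (codingConst_mem hα 1)

end Coding

/-! ### Satisfaction relations as sets. -/

section Satisfaction

instance DeltaZero.eqPairPair {ι : Type} (c t a b : ι) : DeltaZero fun v : ι → ZFSet.{u} =>
    v c = ZFSet.pair (v t) (ZFSet.pair (v a) (v b)) :=
  (inferInstance : DeltaZero fun v : ι → ZFSet.{u} => ∃ s ∈ v c, ∃ p ∈ s,
    p = ZFSet.pair (v a) (v b) ∧ v c = ZFSet.pair (v t) p).congr fun v => by
    constructor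
    · intro h
      obtain ⟨s, hs, -, hp⟩ := snd_mem_sUnion_pair (x := v t) (y := ZFSet.pair (v a) (v b))
      exact ⟨s, h ▸ hs, _, hp, rfl, h⟩
    · rintro ⟨s, -, p, -, rfl, h⟩
      exact h

/-- The assignments `s` and `s'` agree off the name `i`. -/
def AgreeOff (om i s s' : ZFSet.{u}) : Prop :=
  ∀ k ∈ om, ¬ k = i → ∀ y, ZFSet.pair k y ∈ s → ZFSet.pair k y ∈ s'

instance DeltaZero.agreeOff {ι : Type} (a b c d : ι) : DeltaZero fun v : ι → ZFSet.{u} =>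
    AgreeOff (v a) (v b) (v c) (v d) := by
  unfold AgreeOff
  infer_instance

/-- `A` is a set of assignments into `M`, closed under changes of single values. -/
def IsAssignments (om M A : ZFSet.{u}) : Prop :=
  (∃ s ∈ A, s = s) ∧
  (∀ s ∈ A, ∀ i ∈ om, ∃ x, ZFSet.pair i x ∈ s ∧ x ∈ M ∧ ∀ y, ZFSet.pair i y ∈ s → y = x) ∧
  ∀ s ∈ A, ∀ i ∈ om, ∀ x ∈ M, ∃ s' ∈ A, ZFSet.pair i x ∈ s' ∧ AgreeOff om i s s'

instance DeltaZero.isAssignments {ι : Type} (a b c : ι) : DeltaZero fun v : ι → ZFSet.{u} =>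
    IsAssignments (v a) (v b) (v c) := by
  unfold IsAssignments
  infer_instance

/-- `S` is a satisfaction relation for `M` and the assignments in `A`. -/
def IsSatRel (K : Fin 6 → ZFSet.{u}) (M A S : ZFSet.{u}) : Prop :=
  IsAssignments (K 0) M A ∧
  (∀ c ∈ K 1, c = ∅ → ∀ s ∈ A, ¬ ZFSet.pair c s ∈ S) ∧
  (∀ c ∈ K 1, ∀ i ∈ K 0, ∀ j ∈ K 0, c = ZFSet.pair (K 2) (ZFSet.pair i j) → ∀ s ∈ A,
    (ZFSet.pair c s ∈ S ↔ ∃ x, ZFSet.pair i x ∈ s ∧ ZFSet.pair j x ∈ s)) ∧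
  (∀ c ∈ K 1, ∀ i ∈ K 0, ∀ j ∈ K 0, c = ZFSet.pair (K 3) (ZFSet.pair i j) → ∀ s ∈ A,
    (ZFSet.pair c s ∈ S ↔ ∃ x, ZFSet.pair i x ∈ s ∧ ∃ y, ZFSet.pair j y ∈ s ∧ x ∈ y)) ∧
  (∀ c ∈ K 1, ∀ f ∈ K 1, ∀ g ∈ K 1, c = ZFSet.pair (K 4) (ZFSet.pair f g) → ∀ s ∈ A,
    (ZFSet.pair c s ∈ S ↔ (ZFSet.pair f s ∈ S → ZFSet.pair g s ∈ S))) ∧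
  ∀ c ∈ K 1, ∀ i ∈ K 0, ∀ f ∈ K 1, c = ZFSet.pair (K 5) (ZFSet.pair i f) → ∀ s ∈ A,
    (ZFSet.pair c s ∈ S ↔ ∀ s' ∈ A, AgreeOff (K 0) i s s' → ZFSet.pair f s' ∈ S)

instance DeltaZero.isSatRel {ι : Type} (K : Fin 6 → ι) (a b c : ι) :
    DeltaZero fun v : ι → ZFSet.{u} => IsSatRel (fun i => v (K i)) (v a) (v b) (v c) := by
  unfold IsSatRel
  infer_instance

/-- The set `s` is an assignment with values `e`. -/
def Codes {M : ZFSet.{u}} (s : ZFSet.{u}) (e : ℕ → M) : Prop :=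
  ∀ (i : ℕ) (x : ZFSet.{u}), ZFSet.pair (numeral i) x ∈ s ↔ x = e i

variable {M A S : ZFSet.{u}}

theorem IsAssignments.exists_codes (h : IsAssignments names M A) {s : ZFSet.{u}} (hs : s ∈ A) :
    ∃ e : ℕ → M, Codes s e := by
  have : ∀ i, ∃ x : M, ∀ y, ZFSet.pair (numeral i) y ∈ s ↔ y = x := by
    intro i
    obtain ⟨x, h1, h2, h3⟩ := h.2.1 s hs _ (numeral_mem_names i)
    refine ⟨⟨x, h2⟩, fun y => ⟨fun hy => h3 y hy, ?_⟩⟩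
    rintro rfl
    exact h1
  choose e he using this
  exact ⟨e, he⟩

/-- The one-sided condition in `AgreeOff` suffices because both assignments code total functions. -/
theorem agreeOff_iff {s s' : ZFSet.{u}} {e e' : ℕ → M} (hs : Codes s e) (hs' : Codes s' e')
    (i : ℕ) : AgreeOff names (numeral i) s s' ↔ e' = Function.update e i (e' i) := by
  constructor
  · intro h
    funext k
    by_cases hk : k = i
    · subst hk; simp
    · rw [Function.update_of_ne hk]
      have := h _ (numeral_mem_names k) (by rwa [numeral_inj]) _ ((hs k _).2 rfl)
      exact (Subtype.ext ((hs' k _).1 this)).symm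
  · intro h k hk hki y hy
    obtain ⟨n, rfl⟩ := mem_names.1 hk
    rw [numeral_inj] at hki
    rw [hs] at hy
    rw [hs', h, Function.update_of_ne hki]
    exact hy

theorem IsAssignments.exists_update (h : IsAssignments names M A) {s : ZFSet.{u}} (hs : s ∈ A)
    {e : ℕ → M} (he : Codes s e) (i : ℕ) (x : M) :
    ∃ s' ∈ A, Codes s' (Function.update e i x) := by
  obtain ⟨s', hs', h1, h2⟩ := h.2.2 s hs _ (numeral_mem_names i) x x.2
  obtain ⟨e', he'⟩ := h.exists_codes hs'
  rw [agreeOff_iff he he'] at h2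
  rw [he'] at h1
  rw [← Subtype.ext h1] at h2
  exact ⟨s', hs', h2 ▸ he'⟩

theorem IsAssignments.exists_extends (h : IsAssignments names M A) {m : ℕ} (v : Fin m → M) :
    ∃ s ∈ A, ∃ e : ℕ → M, Codes s e ∧ ∀ i : Fin m, e i = v i := by
  induction m with
  | zero =>
    obtain ⟨s, hs, -⟩ := h.1
    obtain ⟨e, he⟩ := h.exists_codes hs
    exact ⟨s, hs, e, he, fun i => i.elim0⟩
  | succ m ih =>
    obtain ⟨s, hs, e, he, h1⟩ := ih fun i => v i.castSucc
    obtain ⟨s', hs', he'⟩ := h.exists_update hs he m (v (Fin.last m))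
    refine ⟨s', hs', _, he', fun i => ?_⟩
    refine Fin.lastCases ?_ (fun i => ?_) i
    · simp
    · rw [Fin.val_castSucc, Function.update_of_ne (by have := i.2; omega), h1]

/-- Tarski's clauses determine `S` on codes by induction. `A` need not contain all assignments;
closure under single changes is enough for the quantifier clause. -/
theorem IsSatRel.pair_mem_iff (h : IsSatRel codingConst M A S) (φ : NamedFormula) {s : ZFSet.{u}}
    (hs : s ∈ A) {e : ℕ → M} (he : Codes s e) : ZFSet.pair φ.code s ∈ S ↔ φ.Sat e := by
  obtain ⟨hA, hfalsum, hequal, hmem, himp, hall⟩ := h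
  induction φ generalizing s e with
  | falsum => exact iff_of_false (hfalsum _ (code_mem_codes .falsum) rfl s hs) id
  | equal i j =>
    refine (hequal _ (code_mem_codes (.equal i j)) _ (numeral_mem_names i) _ (numeral_mem_names j)
      rfl s hs).trans ?_
    simp only [he i _, he j _, NamedFormula.Sat, exists_eq_left, Subtype.coe_inj]
  | mem i j =>
    refine (hmem _ (code_mem_codes (.mem i j)) _ (numeral_mem_names i) _ (numeral_mem_names j)
      rfl s hs).trans ?_
    simp only [he i _, he j _, NamedFormula.Sat, exists_eq_left]
  | imp φ ψ ih₁ ih₂ =>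
    refine (himp _ (code_mem_codes (.imp φ ψ)) _ (code_mem_codes φ) _ (code_mem_codes ψ)
      rfl s hs).trans ?_
    rw [ih₁ hs he, ih₂ hs he]
    exact Iff.rfl
  | all i φ ih =>
    refine (hall _ (code_mem_codes (.all i φ)) _ (numeral_mem_names i) _ (code_mem_codes φ)
      rfl s hs).trans ?_
    constructor
    · intro H x
      obtain ⟨s', hs', he'⟩ := hA.exists_update hs he i x
      rw [← ih hs' he']
      exact H s' hs' ((agreeOff_iff he he' i).2 (by simp))
    · intro H s' hs' hag
      obtain ⟨e', he'⟩ := hA.exists_codes hs'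
      rw [ih hs' he', (agreeOff_iff he he' i).1 hag]
      exact H _

/-- The graph of a function `ℕ → M`. -/
noncomputable def assignment (e : ℕ → M) : ZFSet.{u} :=
  ZFSet.range fun i : ℕ => ZFSet.pair (numeral i) (e i)

theorem codes_assignment (e : ℕ → M) : Codes (assignment e) e := by
  intro i x
  simp only [assignment, ZFSet.mem_range, ZFSet.pair_inj, numeral_inj]
  constructor
  · rintro ⟨_, rfl, rfl⟩
    rfl
  · rintro rfl
    exact ⟨i, rfl, rfl⟩

variable (M) in
/-- The set of all assignments into `M`. -/
noncomputable def allAssignments : ZFSet.{u} :=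
  (names.prod M).powerset.sep fun s => ∃ e : ℕ → M, s = assignment e

theorem mem_allAssignments {s : ZFSet.{u}} :
    s ∈ allAssignments M ↔ ∃ e : ℕ → M, s = assignment e := by
  rw [allAssignments, ZFSet.mem_sep, and_iff_right_iff_imp]
  rintro ⟨e, rfl⟩
  rw [ZFSet.mem_powerset, ZFSet.subset_def]
  intro p hp
  obtain ⟨i, rfl⟩ := ZFSet.mem_range.1 hp
  exact ZFSet.pair_mem_prod.2 ⟨numeral_mem_names i, (e i).2⟩

theorem isAssignments_allAssignments (hM : M.Nonempty) :
    IsAssignments names M (allAssignments M) := by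
  obtain ⟨x, hx⟩ := (ZFSet.nonempty_def M).1 hM
  refine ⟨⟨_, mem_allAssignments.2 ⟨fun _ => ⟨x, hx⟩, rfl⟩, rfl⟩, ?_, ?_⟩
  · intro s hs i hi
    obtain ⟨e, rfl⟩ := mem_allAssignments.1 hs
    obtain ⟨n, rfl⟩ := mem_names.1 hi
    exact ⟨_, (codes_assignment e n _).2 rfl, (e n).2, fun y hy => (codes_assignment e n y).1 hy⟩
  · intro s hs i hi x hx
    obtain ⟨e, rfl⟩ := mem_allAssignments.1 hs
    obtain ⟨n, rfl⟩ := mem_names.1 hi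
    refine ⟨_, mem_allAssignments.2 ⟨Function.update e n ⟨x, hx⟩, rfl⟩,
      (codes_assignment _ n _).2 (by simp), ?_⟩
    rw [agreeOff_iff (codes_assignment _) (codes_assignment _)]
    simp

variable (M) in
/-- The satisfaction relation of `M` for all assignments. -/
noncomputable def satRel : ZFSet.{u} :=
  (codes.prod (allAssignments M)).sep fun p =>
    ∃ (φ : NamedFormula) (e : ℕ → M), p = ZFSet.pair φ.code (assignment e) ∧ φ.Sat e

theorem assignment_injective : Function.Injective (assignment : (ℕ → M) → ZFSet.{u}) := by
  intro e e' h
  funext i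
  refine Subtype.ext ?_
  rw [← codes_assignment e' i, ← h, codes_assignment e i]

theorem pair_mem_satRel {φ : NamedFormula} {e : ℕ → M} :
    ZFSet.pair φ.code (assignment e) ∈ satRel M ↔ φ.Sat e := by
  rw [satRel, ZFSet.mem_sep, ZFSet.pair_mem_prod]
  constructor
  · rintro ⟨-, φ', e', h, hsat⟩
    rw [ZFSet.pair_inj, NamedFormula.code_inj] at h
    obtain ⟨rfl, h⟩ := h
    rwa [assignment_injective h]
  · exact fun h => ⟨⟨code_mem_codes φ, mem_allAssignments.2 ⟨e, rfl⟩⟩, φ, e, rfl, h⟩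

theorem isSatRel_satRel (hM : M.Nonempty) :
    IsSatRel codingConst M (allAssignments M) (satRel M) := by
  have hc : ∀ e : ℕ → M, Codes (assignment e) e := codes_assignment
  refine ⟨isAssignments_allAssignments hM, ?_, ?_, ?_, ?_, ?_⟩
  · rintro c - rfl s hs
    obtain ⟨e, rfl⟩ := mem_allAssignments.1 hs
    exact (pair_mem_satRel (φ := .falsum)).not.2 id
  · rintro c - i hi j hj rfl s hs
    obtain ⟨e, rfl⟩ := mem_allAssignments.1 hs
    obtain ⟨i, rfl⟩ := mem_names.1 hi
    obtain ⟨j, rfl⟩ := mem_names.1 hj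
    refine (pair_mem_satRel (φ := .equal i j)).trans ?_
    simp only [hc e i _, hc e j _, NamedFormula.Sat, exists_eq_left, Subtype.coe_inj]
  · rintro c - i hi j hj rfl s hs
    obtain ⟨e, rfl⟩ := mem_allAssignments.1 hs
    obtain ⟨i, rfl⟩ := mem_names.1 hi
    obtain ⟨j, rfl⟩ := mem_names.1 hj
    refine (pair_mem_satRel (φ := .mem i j)).trans ?_
    simp only [hc e i _, hc e j _, NamedFormula.Sat, exists_eq_left]
  · rintro c - f hf g hg rfl s hs
    obtain ⟨e, rfl⟩ := mem_allAssignments.1 hs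
    obtain ⟨φ, rfl⟩ := mem_codes.1 hf
    obtain ⟨ψ, rfl⟩ := mem_codes.1 hg
    rw [pair_mem_satRel, pair_mem_satRel]
    exact pair_mem_satRel (φ := .imp φ ψ)
  · rintro c - i hi f hf rfl s hs
    obtain ⟨e, rfl⟩ := mem_allAssignments.1 hs
    obtain ⟨i, rfl⟩ := mem_names.1 hi
    obtain ⟨φ, rfl⟩ := mem_codes.1 hf
    refine (pair_mem_satRel (φ := .all i φ)).trans ?_
    constructor
    · intro H s' hs' hag
      obtain ⟨e', rfl⟩ := mem_allAssignments.1 hs'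
      rw [pair_mem_satRel, (agreeOff_iff (hc e) (hc e') i).1 hag]
      exact H _
    · intro H x
      rw [← pair_mem_satRel]
      exact H _ (mem_allAssignments.2 ⟨_, rfl⟩) ((agreeOff_iff (hc e) (hc _) i).2 (by simp))

theorem allAssignments_mem {α : Ordinal.{u}} (hα : ∀ ξ < α, ξ + 1 < α) (hω : ω < α)
    (hM : M ∈ V_ α) : allAssignments M ∈ V_ α :=
  ZFSet.mem_vonNeumann_of_subset ZFSet.sep_subset (powerset_mem_vonNeumann hα
    (prod_mem_vonNeumann hα (codingConst_mem hω 0) hM))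

theorem satRel_mem {α : Ordinal.{u}} (hα : ∀ ξ < α, ξ + 1 < α) (hω : ω < α)
    (hM : M ∈ V_ α) : satRel M ∈ V_ α :=
  ZFSet.mem_vonNeumann_of_subset ZFSet.sep_subset
    (prod_mem_vonNeumann hα (codingConst_mem hω 1) (allAssignments_mem hα hω hM))

end Satisfaction

/-! ### Preservation of formulas by maps between sets. -/

section Maps

variable {M N A S B R e : ZFSet.{u}}

/-- The assignment `s'` is the composition of `s` with the map `e`. -/
def IsComp (om e s s' : ZFSet.{u}) : Prop :=
  ∀ k ∈ om, ∀ x, ZFSet.pair k x ∈ s → ∀ y, ZFSet.pair x y ∈ e → ZFSet.pair k y ∈ s'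

instance DeltaZero.isComp {ι : Type} (a b c d : ι) : DeltaZero fun v : ι → ZFSet.{u} =>
    IsComp (v a) (v b) (v c) (v d) := by
  unfold IsComp
  infer_instance

/-- `e` is a map from `M` to `N`, `S` and `R` are satisfaction relations for `M` with assignments
in `A` and for `N` with assignments in `B`, and composition with `e` maps `A` to `B`. -/
def IsSatMap (K : Fin 6 → ZFSet.{u}) (M A S N B R e : ZFSet.{u}) : Prop :=
  IsSatRel K M A S ∧ IsSatRel K N B R ∧
  (∀ x ∈ M, ∃ y, ZFSet.pair x y ∈ e ∧ y ∈ N ∧ ∀ z, ZFSet.pair x z ∈ e → z = y) ∧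
  ∀ s ∈ A, ∃ s' ∈ B, IsComp (K 0) e s s'

instance DeltaZero.isSatMap {ι : Type} (K : Fin 6 → ι) (a b c a' b' c' d : ι) :
    DeltaZero fun v : ι → ZFSet.{u} => IsSatMap (fun i => v (K i)) (v a) (v b) (v c)
      (v a') (v b') (v c') (v d) := by
  unfold IsSatMap
  infer_instance

/-- The map `e` preserves the formulas with code in `F`. -/
def Preserves (om F A S B R e : ZFSet.{u}) : Prop :=
  ∀ c ∈ F, ∀ s ∈ A, ∀ s' ∈ B, IsComp om e s s' → (ZFSet.pair c s ∈ S ↔ ZFSet.pair c s' ∈ R)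

instance DeltaZero.preserves {ι : Type} (a b c d a' b' c' : ι) :
    DeltaZero fun v : ι → ZFSet.{u} => Preserves (v a) (v b) (v c) (v d) (v a') (v b') (v c') := by
  unfold Preserves
  infer_instance

theorem IsSatMap.exists_fun {K : Fin 6 → ZFSet.{u}} (h : IsSatMap K M A S N B R e) :
    ∃ g : M → N, ∀ (x : M) y, ZFSet.pair (x : ZFSet.{u}) y ∈ e ↔ y = g x := by
  have : ∀ x : M, ∃ z : N, ∀ y, ZFSet.pair (x : ZFSet.{u}) y ∈ e ↔ y = z := by
    intro x
    obtain ⟨y, h1, h2, h3⟩ := h.2.2.1 x x.2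
    refine ⟨⟨y, h2⟩, fun z => ⟨h3 z, ?_⟩⟩
    rintro rfl
    exact h1
  choose g hg using this
  exact ⟨g, hg⟩

theorem isComp_iff {g : M → N} (hg : ∀ (x : M) y, ZFSet.pair (x : ZFSet.{u}) y ∈ e ↔ y = g x)
    {s s' : ZFSet.{u}} {a : ℕ → M} {b : ℕ → N} (hs : Codes s a) (hs' : Codes s' b) :
    IsComp names e s s' ↔ b = fun i => g (a i) := by
  constructor
  · intro h
    funext i
    have := h _ (numeral_mem_names i) _ ((hs i _).2 rfl) _ ((hg _ _).2 rfl)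
    exact (Subtype.ext ((hs' i _).1 this)).symm
  · rintro rfl k hk x hx y hy
    obtain ⟨n, rfl⟩ := mem_names.1 hk
    rw [hs] at hx
    subst hx
    rw [hg] at hy
    rwa [hs']

/-- Every finite tuple extends to an assignment in `A`, and its composition with the map is in `B`;
the choice of satisfaction data is thus irrelevant. -/
theorem IsSatMap.preserves_iff (h : IsSatMap codingConst M A S N B R e) {g : M → N}
    (hg : ∀ (x : M) y, ZFSet.pair (x : ZFSet.{u}) y ∈ e ↔ y = g x)
    (Φ : ∀ m : ℕ, setLang.Formula (Fin m) → Prop) :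
    Preserves names (codeSet Φ) A S B R e ↔ ∀ (m : ℕ) (φ : setLang.Formula (Fin m)), Φ m φ →
      ∀ v : Fin m → M, φ.Realize v ↔ φ.Realize fun i => g (v i) := by
  obtain ⟨hS, hR, -, hcomp⟩ := h
  have hsat : ∀ {P : ZFSet.{u}} {m : ℕ} (φ : setLang.Formula (Fin m)) (a : ℕ → P),
      (toNamed φ).Sat a ↔ φ.Realize fun i => a i := by
    intro P m φ a
    rw [sat_toNamed]
    exact iff_of_eq (congrArg _ (Subsingleton.elim _ _))
  constructor
  · intro H m φ hφ v
    obtain ⟨s, hs, a, ha, hav⟩ := hS.1.exists_extends v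
    obtain ⟨s', hs', hss'⟩ := hcomp s hs
    obtain ⟨b, hb⟩ := hR.1.exists_codes hs'
    have := H _ (mem_codeSet.2 ⟨m, φ, hφ, rfl⟩) s hs s' hs' hss'
    rw [hS.pair_mem_iff _ hs ha, hR.pair_mem_iff _ hs' hb, hsat, hsat,
      (isComp_iff hg ha hb).1 hss'] at this
    simpa only [hav] using this
  · intro H c hc s hs s' hs' hss'
    obtain ⟨m, φ, hφ, rfl⟩ := mem_codeSet.1 hc
    obtain ⟨a, ha⟩ := hS.1.exists_codes hs
    obtain ⟨b, hb⟩ := hR.1.exists_codes hs'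
    rw [hS.pair_mem_iff _ hs ha, hR.pair_mem_iff _ hs' hb, hsat, hsat,
      (isComp_iff hg ha hb).1 hss']
    exact H m φ hφ _

/-- The graph of a map between sets. -/
noncomputable def graph (g : M → N) : ZFSet.{u} :=
  ZFSet.range fun x : M => ZFSet.pair x (g x)

theorem pair_mem_graph (g : M → N) (x : M) (y : ZFSet.{u}) :
    ZFSet.pair (x : ZFSet.{u}) y ∈ graph g ↔ y = g x := by
  simp only [graph, ZFSet.mem_range, ZFSet.pair_inj, Subtype.coe_inj]
  constructor
  · rintro ⟨_, rfl, rfl⟩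
    rfl
  · rintro rfl
    exact ⟨x, rfl, rfl⟩

theorem graph_mem {α : Ordinal.{u}} (hα : ∀ ξ < α, ξ + 1 < α) (g : M → N) (hM : M ∈ V_ α)
    (hN : N ∈ V_ α) : graph g ∈ V_ α := by
  refine ZFSet.mem_vonNeumann_of_subset ?_ (prod_mem_vonNeumann hα hM hN)
  rw [ZFSet.subset_def]
  intro p hp
  obtain ⟨x, rfl⟩ := ZFSet.mem_range.1 hp
  exact ZFSet.pair_mem_prod.2 ⟨x.2, (g x).2⟩

theorem isSatMap_graph (hM : M.Nonempty) (hN : N.Nonempty) (g : M → N) :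
    IsSatMap codingConst M (allAssignments M) (satRel M) N (allAssignments N) (satRel N)
      (graph g) := by
  refine ⟨isSatRel_satRel hM, isSatRel_satRel hN, fun x hx => ?_, fun s hs => ?_⟩
  · exact ⟨_, (pair_mem_graph g ⟨x, hx⟩ _).2 rfl, Subtype.prop _,
      fun z hz => (pair_mem_graph g ⟨x, hx⟩ z).1 hz⟩
  · obtain ⟨a, rfl⟩ := mem_allAssignments.1 hs
    exact ⟨_, mem_allAssignments.2 ⟨fun i => g (a i), rfl⟩,
      (isComp_iff (pair_mem_graph g) (codes_assignment _) (codes_assignment _)).2 rfl⟩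

end Maps

/-! ### C^(n) is Π_n. -/

section Definability

theorem SigmaPred.exs {ι κ : Type} [Finite κ] {n : ℕ} {Q : (ι ⊕ κ → ZFSet.{u}) → Prop}
    (h : SigmaPred (n + 1) Q) :
    SigmaPred (n + 1) fun v : ι → ZFSet.{u} => ∃ w : κ → ZFSet.{u}, Q (Sum.elim v w) := by
  obtain ⟨ρ, hρ, Q', hQ', hQ⟩ := h
  refine ⟨κ ⊕ ρ, inferInstance, _, hQ'.reindex (Equiv.sumAssoc ι κ ρ), fun v => ?_⟩
  have e : ∀ (w : κ → ZFSet.{u}) (w' : ρ → ZFSet.{u}),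
      (fun i => Sum.elim v (Sum.elim w w') (Equiv.sumAssoc ι κ ρ i)) =
        Sum.elim (Sum.elim v w) w' := by
    intro w w'
    funext i
    rcases i with (i | i) | i <;> rfl
  simp only [hQ]
  constructor
  · rintro ⟨w, w', h⟩
    exact ⟨Sum.elim w w', by rwa [e]⟩
  · rintro ⟨w, h⟩
    refine ⟨fun i => w (.inl i), fun i => w (.inr i), ?_⟩
    rw [← e]
    convert h using 4
    funext i
    rcases i with i | i <;> rfl

theorem PiPred.alls {ι κ : Type} [Finite κ] {n : ℕ} {Q : (ι ⊕ κ → ZFSet.{u}) → Prop}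
    (h : PiPred (n + 1) Q) :
    PiPred (n + 1) fun v : ι → ZFSet.{u} => ∀ w : κ → ZFSet.{u}, Q (Sum.elim v w) :=
  (SigmaPred.exs h.not).congr fun _ => not_forall

/-- The inclusion of `w` in `w'` preserves the formulas with code in `F`. -/
def PreservesIncl (K : Fin 6 → ZFSet.{u}) (F w w' : ZFSet.{u}) : Prop :=
  ∀ p : Fin 5 → ZFSet.{u}, IsSatMap K w (p 1) (p 2) w' (p 3) (p 4) (p 0) →
    (∀ x ∈ w, ZFSet.pair x x ∈ p 0) → Preserves (K 0) F (p 1) (p 2) (p 3) (p 4) (p 0)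

theorem piPred_preservesIncl {ι : Type} (K : Fin 6 → ι) (a b c : ι) :
    PiPred 1 fun v : ι → ZFSet.{u} => PreservesIncl (fun i => v (K i)) (v a) (v b) (v c) :=
  PiPred.alls (κ := Fin 5) (Q := fun u : ι ⊕ Fin 5 → ZFSet.{u} =>
    IsSatMap (fun i => u (.inl (K i))) (u (.inl b)) (u (.inr 1)) (u (.inr 2)) (u (.inl c))
      (u (.inr 3)) (u (.inr 4)) (u (.inr 0)) →
    (∀ x ∈ u (.inl b), ZFSet.pair x x ∈ u (.inr 0)) →
    Preserves (u (.inl (K 0))) (u (.inl a)) (u (.inr 1)) (u (.inr 2)) (u (.inr 3)) (u (.inr 4))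
      (u (.inr 0))) (.of_deltaZero inferInstance)

/-- The set of codes of `Σ_n` formulas. -/
noncomputable def sigmaCodes (n : ℕ) : ZFSet.{u} := codeSet fun _ φ => IsLevy .sigma n φ

/-- The set of codes of all formulas without free bound variables. -/
noncomputable def formulaCodes : ZFSet.{u} := codeSet fun _ _ => True

/-- The inclusion map between sets. -/
def inclusionMap {w w' : ZFSet.{u}} (h : w ⊆ w') (x : w) : w' := ⟨x, h x.2⟩

/-- Satisfaction data exist for nonempty sets, so the universal block in `PreservesIncl` is not
vacuous, and all choices of data give the same answer. -/
theorem preservesIncl_iff {n : ℕ} {w w' : ZFSet.{u}} (hw : w.Nonempty) (h : w ⊆ w') :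
    PreservesIncl codingConst (sigmaCodes n) w w' ↔ SigmaElementary n (inclusionMap h) := by
  have hw' : w'.Nonempty := by
    obtain ⟨x, hx⟩ := (ZFSet.nonempty_def w).1 hw
    exact ZFSet.nonempty_of_mem (h hx)
  constructor
  · intro H
    have h1 := isSatMap_graph hw hw' (inclusionMap h)
    exact (h1.preserves_iff (pair_mem_graph _) _).1 (H ![graph (inclusionMap h), allAssignments w,
      satRel w, allAssignments w', satRel w'] h1
      fun x hx => (pair_mem_graph (inclusionMap h) ⟨x, hx⟩ x).2 rfl)
  · intro H p hp hid
    obtain ⟨g, hg⟩ := hp.exists_fun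
    have : g = inclusionMap h := by
      funext x
      exact (Subtype.ext ((hg x x).1 (hid x x.2))).symm
    subst this
    exact (hp.preserves_iff hg _).2 H

/-- The defining property of the `Σ_n`-correct levels; `w` is the level with index `a`. -/
def IsCorrectLevel (K : Fin 6 → ZFSet.{u}) (F : ℕ → ZFSet.{u}) : ℕ → ZFSet.{u} → ZFSet.{u} → Prop
  | 0, w, _ => (∃ x ∈ w, x = x) ∧ w.IsTransitive
  | n + 1, w, a => a.IsOrdinal ∧ IsLevel w a ∧ IsCorrectLevel K F n w a ∧
      ∀ w' a', IsCorrectLevel K F n w' a' → w ⊆ w' → PreservesIncl K (F (n + 1)) w w'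

/-- In the recursive clause the premise on `w'` is Π_n, hence Σ_{n+1}, and the conclusion is Π_1;
the implication under universal quantifiers is Π_{n+1}. -/
theorem piPred_isCorrectLevel (n : ℕ) {ι : Type} (K : Fin 6 → ι) (F : ℕ → ι) (a b : ι) :
    PiPred n fun v : ι → ZFSet.{u} =>
      IsCorrectLevel (fun i => v (K i)) (fun i => v (F i)) n (v a) (v b) := by
  induction n generalizing ι with
  | zero => exact .of_deltaZero (inferInstance :
      DeltaZero fun v : ι → ZFSet.{u} => (∃ x ∈ v a, x = x) ∧ (v a).IsTransitive)
  | succ n ih =>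
    refine .and (.of_deltaZero inferInstance) (.and ((piPred_isLevel a b).mono (by omega))
      (.and ((ih K F a b).mono n.le_succ) ?_))
    refine .all (R := fun v w' => ∀ a', IsCorrectLevel (fun i => v (K i)) (fun i => v (F i)) n w' a'
      →
      v a ⊆ w' → PreservesIncl (fun i => v (K i)) (v (F (n + 1))) (v a) w') ?_
    refine .all (R := fun v a' => IsCorrectLevel (fun i => v (some (K i))) (fun i => v (some (F i)))
      n (v none) a' → v (some a) ⊆ v none →
        PreservesIncl (fun i => v (some (K i))) (v (some (F (n + 1)))) (v (some a)) (v none)) ?_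
    refine .imp (.of_piPred (ih (fun i => some (some (K i))) (fun i => some (some (F i)))
      (some none) none) n.lt_succ_self) (.imp (.of_deltaZero inferInstance) ?_)
    exact (piPred_preservesIncl (fun i => some (some (K i))) (some (some (F (n + 1))))
      (some (some a)) (some none)).mono (by omega)

variable {n : ℕ}

/-- A Σ_{n+1} formula true in `w'` goes up to the universe by Σ_n-elementarity of `w'`, and then
down to `w`. -/
theorem SigmaElementary.inclusionMap {w w' : ZFSet.{u}} (h : w ⊆ w')
    (hw : SigmaElementary (n + 1) (Subtype.val : w → ZFSet.{u}))
    (hw' : SigmaElementary n (Subtype.val : w' → ZFSet.{u})) :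
    SigmaElementary (n + 1) (inclusionMap h) := by
  have h0 : SigmaElementary n (_root_.inclusionMap h) := by
    intro k φ hφ v
    rw [hw k φ hφ.succ v, hw' k φ hφ]
    rfl
  refine h0.succ fun k φ hφ v hv => ?_
  rw [hw k φ hφ v]
  rw [Formula.Realize]
  exact (iff_of_eq (congrArg _ (Subsingleton.elim _ _))).1 (hw'.realize_of_realize hφ _ _ hv)

theorem nonempty_vonNeumann {α : Ordinal.{u}} (h : 0 < α) : (V_ α : ZFSet.{u}).Nonempty :=
  ZFSet.nonempty_of_mem (toZFSet_mem_vonNeumann.2 h)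

theorem isCorrectLevel_iff {F : ℕ → ZFSet.{u}} {w a : ZFSet.{u}}
    (hF : ∀ i ≤ n + 1, F i = sigmaCodes i) :
    IsCorrectLevel codingConst F (n + 1) w a ↔
      ∃ θ ∈ sigmaCorrect (n + 1), a = θ.toZFSet ∧ w = V_ θ := by
  have main : ∀ n : ℕ, (∀ i ≤ n + 1, F i = sigmaCodes i) →
      (∀ w a, IsCorrectLevel codingConst F n w a →
        w.Nonempty ∧ w.IsTransitive ∧ SigmaElementary n (Subtype.val : w → ZFSet.{u})) →
      (∀ θ, 0 < θ → θ ∈ sigmaCorrect n → IsCorrectLevel codingConst F n (V_ θ) θ.toZFSet) →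
      ∀ w a, IsCorrectLevel codingConst F (n + 1) w a ↔
        ∃ θ ∈ sigmaCorrect (n + 1), a = θ.toZFSet ∧ w = V_ θ := by
    intro n hF h1 h2 w a
    constructor
    · rintro ⟨ha, hw, h3, h4⟩
      obtain ⟨θ, rfl⟩ := ZFSet.isOrdinal_iff_mem_range_toZFSet.1 ha
      obtain rfl := isLevel_iff.1 hw
      obtain ⟨h5, -, h6⟩ := h1 _ _ h3
      refine ⟨θ, SigmaElementary.succ h6 fun k φ hφ v hv => ?_, rfl, rfl⟩
      -- A correct `V_ α` stands for the universe among the sets `w'`, so preservation into it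
      -- already yields correctness of `θ`.
      obtain ⟨α, hα, hcorr⟩ := exists_forall_mem_sigmaCorrect θ
      have hsub := ZFSet.vonNeumann_subset_of_le hα.le
      have h7 := h4 _ _ (h2 α ((zero_le (a := θ)).trans_lt hα) (hcorr n)) hsub
      rw [hF _ le_rfl, preservesIncl_iff h5 hsub] at h7
      rw [h7 k φ hφ v, hcorr (n + 1) k φ hφ]
      exact hv
    · rintro ⟨θ, hθ, rfl, rfl⟩
      have h0 : 0 < θ := omega0_pos.trans (omega_lt_of_sigmaCorrect hθ)
      refine ⟨ZFSet.isOrdinal_toZFSet θ, isLevel_iff.2 rfl,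
        h2 θ h0 (sigmaCorrect_anti n.le_succ hθ), fun w' a' hw' hsub => ?_⟩
      rw [hF _ le_rfl, preservesIncl_iff (nonempty_vonNeumann h0) hsub]
      exact (sigmaCorrect_iff.1 hθ).inclusionMap hsub (h1 _ _ hw').2.2
  induction n generalizing w a with
  | zero =>
    refine main 0 hF ?_ ?_ w a
    · rintro w - ⟨⟨x, hx, -⟩, h⟩
      exact ⟨ZFSet.nonempty_of_mem hx, h, sigmaElementary_zero_val h⟩
    · intro θ hθ _
      exact ⟨⟨_, toZFSet_mem_vonNeumann.2 hθ, rfl⟩, ZFSet.isTransitive_vonNeumann θ⟩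
  | succ n ih =>
    have ih := fun w a => @ih w a fun i hi => hF i (by omega)
    refine main (n + 1) hF ?_ ?_ w a
    · intro w a h
      obtain ⟨θ, hθ, rfl, rfl⟩ := (ih _ _).1 h
      exact ⟨nonempty_vonNeumann (omega0_pos.trans (omega_lt_of_sigmaCorrect hθ)),
        ZFSet.isTransitive_vonNeumann θ, hθ⟩
    · intro θ _ hθ
      exact (ih _ _).2 ⟨θ, hθ, rfl, rfl⟩

end Definability

/-! ### Existence of an extendibility embedding is Σ_{n+1}. -/

section ExtendiblePredicate

/-- Maps which preserve all formulas are elementary embeddings. -/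
theorem IsSatMap.exists_elementaryEmbedding {M A S N B R e : ZFSet.{u}}
    (h : IsSatMap codingConst M A S N B R e) (h' : Preserves names formulaCodes A S B R e) :
    ∃ j : M ↪ₑ[setLang] N, ∀ (x : M) y, ZFSet.pair (x : ZFSet.{u}) y ∈ e ↔ y = j x := by
  obtain ⟨g, hg⟩ := h.exists_fun
  exact ⟨⟨g, fun m φ v => ((h.preserves_iff hg _).1 h' m φ trivial v).symm⟩, hg⟩

theorem preserves_graph {M N : ZFSet.{u}} (hM : M.Nonempty) (hN : N.Nonempty)
    (j : M ↪ₑ[setLang] N) : Preserves names formulaCodes (allAssignments M) (satRel M)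
      (allAssignments N) (satRel N) (graph j) :=
  ((isSatMap_graph hM hN j).preserves_iff (pair_mem_graph _) _).2 fun _ φ _ v =>
    (j.map_formula φ v).symm

/-- The existence of an elementary embedding `V_η → V_ζ` with critical point `δ` which maps `δ` to
a `Σ_n`-correct ordinal above `η`. -/
def HasExtension (K : Fin 6 → ZFSet.{u}) (G : ZFSet.{u}) (F : ℕ → ZFSet.{u}) (n : ℕ)
    (η δ : ZFSet.{u}) : Prop :=
  ∃ p : Fin 10 → ZFSet.{u}, (IsLevel (p 0) η ∧ IsLevel (p 1) (p 2) ∧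
    IsCorrectLevel K F n (p 4) (p 3)) ∧ (p 2).IsOrdinal ∧
    IsSatMap K (p 0) (p 5) (p 6) (p 1) (p 7) (p 8) (p 9) ∧
    Preserves (K 0) G (p 5) (p 6) (p 7) (p 8) (p 9) ∧
    (∀ γ ∈ δ, ZFSet.pair γ γ ∈ p 9) ∧ ZFSet.pair δ (p 3) ∈ p 9 ∧ η ∈ p 3

/-- The matrix is a conjunction of Π_n and Δ₀ clauses. Recognising levels is Π_1, whence `1 ≤ n`. -/
theorem sigmaPred_hasExtension {n : ℕ} (hn : 1 ≤ n) {ι : Type} (K : Fin 6 → ι) (G : ι) (F : ℕ → ι)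
    (a b : ι) : SigmaPred (n + 1) fun v : ι → ZFSet.{u} =>
      HasExtension (fun i => v (K i)) (v G) (fun i => v (F i)) n (v a) (v b) := by
  refine SigmaPred.exs (κ := Fin 10) (Q := fun u : ι ⊕ Fin 10 → ZFSet.{u} =>
    (IsLevel (u (.inr 0)) (u (.inl a)) ∧ IsLevel (u (.inr 1)) (u (.inr 2)) ∧
    IsCorrectLevel (fun i => u (.inl (K i))) (fun i => u (.inl (F i))) n (u (.inr 4)) (u (.inr 3)))
      ∧
    (u (.inr 2)).IsOrdinal ∧
    IsSatMap (fun i => u (.inl (K i))) (u (.inr 0)) (u (.inr 5)) (u (.inr 6)) (u (.inr 1))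
      (u (.inr 7)) (u (.inr 8)) (u (.inr 9)) ∧
    Preserves (u (.inl (K 0))) (u (.inl G)) (u (.inr 5)) (u (.inr 6)) (u (.inr 7)) (u (.inr 8))
      (u (.inr 9)) ∧
    (∀ γ ∈ u (.inl b), ZFSet.pair γ γ ∈ u (.inr 9)) ∧
    ZFSet.pair (u (.inl b)) (u (.inr 3)) ∈ u (.inr 9) ∧ u (.inl a) ∈ u (.inr 3)) ?_
  refine .and (.of_piPred (n := n) (.and ((piPred_isLevel _ _).mono hn)
    (.and ((piPred_isLevel _ _).mono hn)
      (piPred_isCorrectLevel n (fun i => Sum.inl (K i)) (fun i => Sum.inl (F i)) _ _)))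
        n.lt_succ_self) (.of_deltaZero inferInstance)

/-- The critical point is encoded by fixing all `γ < δ` and moving `δ` to `θ > η > δ`. -/
theorem hasExtension_iff {n : ℕ} {F : ℕ → ZFSet.{u}} (hF : ∀ i ≤ n + 1, F i = sigmaCodes i)
    {η δ : Ordinal.{u}} (hδ : δ < η) :
    HasExtension codingConst formulaCodes F (n + 1) η.toZFSet δ.toZFSet ↔
      ∃ (ζ : Ordinal.{u}) (j : (V_ η : ZFSet.{u}) ↪ₑ[setLang] (V_ ζ : ZFSet.{u})),
        IsCriticalPoint j δ ∧ ∃ θ : Ordinal.{u}, Sends j δ.toZFSet θ.toZFSet ∧ η < θ ∧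
          θ ∈ sigmaCorrect (n + 1) := by
  have hmem : ∀ {γ}, γ < η → γ.toZFSet ∈ V_ η := toZFSet_mem_vonNeumann.2
  constructor
  · rintro ⟨p, ⟨h0, h1, h2⟩, h3, h4, h5, h6, h7, h8⟩
    obtain ⟨ζ, hζ⟩ := ZFSet.isOrdinal_iff_mem_range_toZFSet.1 h3
    obtain ⟨θ, hθ, hpθ, hpw⟩ := (isCorrectLevel_iff hF).1 h2
    rw [isLevel_iff] at h0
    rw [← hζ, isLevel_iff] at h1
    rw [h0, h1] at h4
    obtain ⟨j, hj⟩ := h4.exists_elementaryEmbedding h5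
    rw [hpθ] at h7 h8
    rw [toZFSet_mem_toZFSet_iff] at h8
    have hjδ : Sends j δ.toZFSet θ.toZFSet := ⟨hmem hδ, ((hj ⟨_, hmem hδ⟩ _).1 h7).symm⟩
    refine ⟨ζ, j, isCriticalPoint_iff.2 ⟨hδ, ?_, fun γ hγ => ?_⟩, θ, hjδ, h8, hθ⟩
    · rw [(sends_toZFSet hδ).1 hjδ]
      exact (hδ.trans h8).ne'
    · rw [← sends_toZFSet (hγ.trans hδ)]
      exact ⟨hmem (hγ.trans hδ), ((hj ⟨_, hmem (hγ.trans hδ)⟩ _).1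
        (h6 _ (toZFSet_mem_toZFSet_iff.2 hγ))).symm⟩
  · rintro ⟨ζ, j, hj, θ, hjδ, hηθ, hθ⟩
    have hη : (V_ η : ZFSet.{u}).Nonempty := ZFSet.nonempty_of_mem (hmem hδ)
    have hζ : (V_ ζ : ZFSet.{u}).Nonempty := ZFSet.nonempty_of_mem (appSet_mem (hmem hδ) (j := j))
    refine ⟨![V_ η, V_ ζ, ζ.toZFSet, θ.toZFSet, V_ θ, allAssignments (V_ η), satRel (V_ η),
      allAssignments (V_ ζ), satRel (V_ ζ), graph j], ⟨isLevel_iff.2 rfl, isLevel_iff.2 rfl,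
        (isCorrectLevel_iff hF).2 ⟨θ, hθ, rfl, rfl⟩⟩, ZFSet.isOrdinal_toZFSet ζ,
        isSatMap_graph hη hζ j, preserves_graph hη hζ j, fun γ hγ => ?_, ?_,
        toZFSet_mem_toZFSet_iff.2 hηθ⟩
    · obtain ⟨ξ, hξ, rfl⟩ := mem_toZFSet_iff.1 hγ
      obtain ⟨h1, h2⟩ := (sends_toZFSet (hξ.trans hδ)).2 ((isCriticalPoint_iff.1 hj).2.2 ξ hξ)
      exact (pair_mem_graph j ⟨_, h1⟩ _).2 h2.symm
    · obtain ⟨h1, h2⟩ := hjδ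
      exact (pair_mem_graph j ⟨_, h1⟩ _).2 h2.symm

end ExtendiblePredicate

/-! ### Supercompact ordinals are correct. -/

section Supercompact

variable {n : ℕ} {δ : Ordinal.{u}}

/-- The class `C^{(n)}` is closed under limits. -/
theorem mem_sigmaCorrect_of_forall_lt (hδ : 0 < δ)
    (h : ∀ γ < δ, ∃ α < δ, γ < α ∧ α ∈ sigmaCorrect n) : δ ∈ sigmaCorrect n := by
  induction n with
  | zero => exact mem_sigmaCorrect_zero δ
  | succ n ih =>
    have ih := ih fun γ hγ => by
      obtain ⟨α, h1, h2, h3⟩ := h γ hγ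
      exact ⟨α, h1, h2, sigmaCorrect_anti n.le_succ h3⟩
    refine (sigmaCorrect_iff.1 ih).succ fun k φ hφ v hv => ?_
    obtain ⟨γ, hγ, hγv⟩ : ∃ γ < δ, ∀ i, (v i : ZFSet.{u}).rank ≤ γ := by
      have hi : ∀ i, (v i : ZFSet.{u}).rank < δ := fun i => ZFSet.mem_vonNeumann.1 (v i).2
      clear hv hφ φ
      induction k with
      | zero => exact ⟨0, hδ, fun i => i.elim0⟩
      | succ k ihk =>
        obtain ⟨γ, hγ, h1⟩ := ihk (fun i => v i.castSucc) fun i => hi _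
        refine ⟨max γ (v (Fin.last k) : ZFSet.{u}).rank, max_lt hγ (hi _), fun i => ?_⟩
        refine Fin.lastCases (le_max_right _ _) (fun i => (h1 i).trans (le_max_left _ _)) i
    obtain ⟨α, hα, hγα, hαn⟩ := h γ hγ
    have hsub := ZFSet.vonNeumann_subset_of_le hα.le
    let v' : Fin k → (V_ α : ZFSet.{u}) := fun i =>
      ⟨v i, ZFSet.mem_vonNeumann.2 ((hγv i).trans_lt hγα)⟩
    -- `α` was chosen above the ranks of the parameters: the formula descends from the universe to
    -- `V_ α` and rises from there to `V_ δ`.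
    exact (((sigmaCorrect_iff.1 hαn).inclusionMap hsub ih) k φ hφ v').1 ((hαn k φ hφ v').2 hv)

theorem IsSigmaSupercompact.mem_sigmaCorrect (h : IsSigmaSupercompact (n + 1) δ) :
    δ ∈ sigmaCorrect (n + 1) := by
  obtain ⟨lam, hlam, hcorr⟩ := exists_forall_mem_sigmaCorrect δ
  have h0 : 0 < δ := by
    obtain ⟨δ', lam', -, h1, -⟩ := h lam hlam (hcorr _) ∅ (by
      rw [← toZFSet_zero, toZFSet_mem_vonNeumann]; exact (zero_le (a := δ)).trans_lt hlam)
    exact (zero_le (a := lam')).trans_lt h1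
  refine mem_sigmaCorrect_of_forall_lt h0 fun γ hγ => ?_
  -- With `a = γ < δ`, the preimage of `γ` is an ordinal below the critical point `δ'`. It is
  -- therefore fixed and equals `γ`, so `γ < δ' < lam'`.
  obtain ⟨δ', lam', h1, h2, h3, a', ha', j, hj, hjδ, hja⟩ :=
    h lam hlam (hcorr _) γ.toZFSet (toZFSet_mem_vonNeumann.2 (hγ.trans hlam))
  refine ⟨lam', h2, ?_, h3⟩
  rw [sends_toZFSet h1] at hjδ
  rw [sends_iff ha'] at hja
  have hord : a'.IsOrdinal := (isOrdinal_appSet ha').1 (hja ▸ ZFSet.isOrdinal_toZFSet γ)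
  obtain ⟨ξ, rfl⟩ := ZFSet.isOrdinal_iff_mem_range_toZFSet.1 hord
  rw [toZFSet_mem_vonNeumann] at ha'
  rw [appSet_toZFSet ha', toZFSet_injective.eq_iff] at hja
  have hξ : ξ < δ' := by
    rwa [← appOrd_lt_appOrd (j := j) ha' h1, hja, hjδ]
  rw [(isCriticalPoint_iff.1 hj).2.2 ξ hξ] at hja
  exact hja ▸ ha'

end Supercompact

/-! ### Surjections from ordinals inside V_κ. -/

section Surjections

/-- `f` maps a subset of `a` onto a superset of `x`. -/
def IsSurjection (f a x : ZFSet.{u}) : Prop :=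
  (∀ y ∈ x, ∃ ξ ∈ a, ZFSet.pair ξ y ∈ f) ∧
    ∀ ξ ∈ a, ∀ y, ZFSet.pair ξ y ∈ f → ∀ z, ZFSet.pair ξ z ∈ f → z = y

instance DeltaZero.isSurjection {ι : Type} (a b c : ι) :
    DeltaZero fun v : ι → ZFSet.{u} => IsSurjection (v a) (v b) (v c) := by
  unfold IsSurjection
  infer_instance

theorem IsSurjection.card_le {f a x : ZFSet.{u}} (h : IsSurjection f a x) : x.card ≤ a.card := by
  have : ∀ y : x, ∃ ξ : a, ZFSet.pair (ξ : ZFSet.{u}) y ∈ f := fun y => by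
    obtain ⟨ξ, hξ, h'⟩ := h.1 y y.2
    exact ⟨⟨ξ, hξ⟩, h'⟩
  choose g hg using this
  rw [← Cardinal.lift_le.{u + 1}, ← ZFSet.cardinalMk_coe_sort, ← ZFSet.cardinalMk_coe_sort]
  refine Cardinal.mk_le_of_injective (f := g) fun y z hyz => Subtype.ext ?_
  exact h.2 _ (g z).2 _ (hg z) _ (hyz ▸ hg y)

theorem exists_isSurjection (x : ZFSet.{u}) :
    ∃ (γ : Ordinal.{u}) (f : ZFSet.{u}), IsSurjection f γ.toZFSet x := by
  let γ := x.card.ord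
  have hcard : Cardinal.mk x = Cardinal.mk (γ.toZFSet : ZFSet.{u}) := by
    rw [ZFSet.cardinalMk_coe_sort, ZFSet.cardinalMk_coe_sort, card_toZFSet, Cardinal.card_ord]
  obtain ⟨e⟩ := Cardinal.eq.1 hcard
  refine ⟨γ, graph e.symm, fun y hy => ⟨e ⟨y, hy⟩, Subtype.prop _, ?_⟩, fun ξ hξ y hy z hz => ?_⟩
  · rw [pair_mem_graph, Equiv.symm_apply_apply]
  · rw [(pair_mem_graph e.symm ⟨ξ, hξ⟩ y).1 hy, (pair_mem_graph e.symm ⟨ξ, hξ⟩ z).1 hz]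

/-- Every element of `V_κ` is the image of an ordinal below `κ` under a map in `V_κ`. -/
def HasSurjections (κ : Ordinal.{u}) : Prop :=
  ∀ x ∈ V_ κ, ∃ γ < κ, ∃ f ∈ V_ κ, IsSurjection f γ.toZFSet x

theorem hasSurjections_of_mem_sigmaCorrect {κ : Ordinal.{u}} (h : κ ∈ sigmaCorrect 1) :
    HasSurjections κ := by
  intro x hx
  obtain ⟨γ, f, hf⟩ := exists_isSurjection x
  obtain ⟨z, hz, s, hs, a, ha, t, ht, g, hg, hord, hsurj⟩ := exists_mem_of_sigmaCorrect
    (ι := Unit) h (R := fun v z => ∃ s ∈ z, ∃ a ∈ s, ∃ t ∈ z, ∃ g ∈ t, a.IsOrdinal ∧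
      IsSurjection g a (v ())) (.of_deltaZero inferInstance) (fun _ => x) (fun _ => hx)
    -- Reflection supplies a single witness, so `γ` and `f` are packed into one set from which
    -- bounded quantifiers recover them.
    ⟨{{γ.toZFSet}, {f}}, _, ZFSet.mem_pair.2 (.inl rfl), _, ZFSet.mem_singleton.2 rfl,
      _, ZFSet.mem_pair.2 (.inr rfl), _, ZFSet.mem_singleton.2 rfl, ZFSet.isOrdinal_toZFSet γ, hf⟩
  have htr := ZFSet.isTransitive_vonNeumann κ
  have ha := htr.subset_of_mem (htr.subset_of_mem hz hs) ha
  have hg := htr.subset_of_mem (htr.subset_of_mem hz ht) hg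
  obtain ⟨γ, rfl⟩ := ZFSet.isOrdinal_iff_mem_range_toZFSet.1 hord
  exact ⟨γ, toZFSet_mem_vonNeumann.1 ha, g, hg, hsurj⟩

/-- If `κ` were not initial, the power set of its cardinality would lie in `V_ κ` and be covered by
an ordinal below `κ`, against Cantor. -/
theorem HasSurjections.isInitial {κ : Ordinal.{u}} (h : HasSurjections κ)
    (hκ : ∀ ξ < κ, ξ + 1 < κ) : κ.IsInitial := by
  by_contra hne
  have hlt : κ.card.ord < κ := (Cardinal.ord_card_le κ).lt_of_ne hne
  obtain ⟨ξ, hξ, f, -, hf⟩ := h _ (powerset_mem_vonNeumann hκ (toZFSet_mem_vonNeumann.2 hlt))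
  have h1 := hf.card_le
  rw [ZFSet.card_powerset, card_toZFSet, card_toZFSet, Cardinal.card_ord] at h1
  exact ((Cardinal.cantor _).trans_le h1).not_ge (Ordinal.card_le_card hξ.le)

end Surjections

/-! ### Supercompact implies extendible. -/

section Backward

variable {n : ℕ} {δ : Ordinal.{u}}

/-- `V_ (appOrd j δ)` has a nonempty element without ∈-maximal members, so by elementarity `V_ δ`
has one too. -/
theorem omega_lt_of_isCriticalPoint {α β : Ordinal.{u}}
    {j : (V_ α : ZFSet.{u}) ↪ₑ[setLang] (V_ β : ZFSet.{u})} (hα : ∀ ξ < α, ξ + 1 < α)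
    (h : IsCriticalPoint j δ) (hω : ω < appOrd j δ) : ω < δ := by
  have hδ := h.1.1
  obtain ⟨y, hy, h0, h1⟩ := exists_infinite_set.{u}
  have key := (DeltaZero.appSet_iff (j := j) (inferInstance : DeltaZero fun v : Unit → ZFSet.{u} =>
    ∃ x ∈ v (), (∃ y ∈ x, y = y) ∧ ∀ y ∈ x, ∃ z ∈ x, y ∈ z) (fun _ => V_ δ)
      (fun _ => ZFSet.vonNeumann_mem_of_lt hδ)).2 (by
      rw [appSet_vonNeumann hα hδ]
      exact ⟨y, ZFSet.mem_vonNeumann.2 (hy ▸ hω), by simpa using h0, h1⟩)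
  obtain ⟨x, hx, h2, h3⟩ := key
  exact (omega_le_rank (by simpa using h2) h3).trans_lt (ZFSet.mem_vonNeumann.1 hx)

theorem IsSigmaSupercompact.isCExtendible (hn : 1 ≤ n) (h : IsSigmaSupercompact (n + 1) δ) :
    IsCExtendible n δ := by
  have hδ := h.mem_sigmaCorrect
  have hlimδ := add_one_lt_of_sigmaCorrect hδ
  refine ⟨(hasSurjections_of_mem_sigmaCorrect
    (sigmaCorrect_anti (by omega) hδ)).isInitial hlimδ, fun η hη => ?_⟩
  obtain ⟨m, rfl⟩ : ∃ m, n = m + 1 := ⟨n - 1, by omega⟩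
  obtain ⟨lam, hlam, hcorr⟩ := exists_forall_mem_sigmaCorrect η
  obtain ⟨δ', lam', h1, h2, h3, a', ha', j, hj, hjδ, hja⟩ :=
    h lam (hη.trans hlam) (hcorr _) η.toZFSet (toZFSet_mem_vonNeumann.2 hlam)
  have hlim := add_one_lt_of_sigmaCorrect h3
  rw [sends_toZFSet h1] at hjδ
  rw [sends_iff ha'] at hja
  have hord : a'.IsOrdinal := (isOrdinal_appSet ha').1 (hja ▸ ZFSet.isOrdinal_toZFSet η)
  obtain ⟨η', rfl⟩ := ZFSet.isOrdinal_iff_mem_range_toZFSet.1 hord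
  rw [toZFSet_mem_vonNeumann] at ha'
  rw [appSet_toZFSet ha', toZFSet_injective.eq_iff] at hja
  have hδη : δ' < η' := by rwa [← appOrd_lt_appOrd (j := j) h1 ha', hja, hjδ]
  have hω : ω < δ' := omega_lt_of_isCriticalPoint hlim hj
    (hjδ ▸ omega_lt_of_sigmaCorrect hδ)
  -- Only finitely many parameters are allowed, so indices are reduced modulo `m + 2`; just those up
  -- to `m + 1` matter.
  let F : ℕ → ZFSet.{u} := fun i => sigmaCodes (Fin.ofNat (m + 2) i : Fin (m + 2))
  have hF : ∀ i ≤ m + 1, F i = sigmaCodes i := fun i hi => by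
    simp [F, Nat.mod_eq_of_lt (show i < m + 2 by omega)]
  -- The restriction of `j` to `V_ η'` is the witness, with target `V_ η` and `δ` as the image of
  -- `δ'`: `δ` is correct and exceeds `lam' > η'`.
  have hext : HasExtension codingConst formulaCodes F (m + 1) η'.toZFSet δ'.toZFSet :=
    (hasExtension_iff hF hδη).2 ⟨_, restrictEmb j hlim ha',
      isCriticalPoint_restrictEmb hlim ha' hδη hj, δ,
      (sends_toZFSet hδη).2 (by rw [appOrd_restrictEmb hlim ha' hδη, hjδ]), ha'.trans h2,
      sigmaCorrect_anti (Nat.le_succ _) hδ⟩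
  let ι := Fin 6 ⊕ Fin (m + 2) ⊕ Fin 3
  have hP : SigmaPred (m + 2) fun v : ι → ZFSet.{u} =>
      HasExtension (fun i => v (.inl i)) (v (.inr (.inr 0)))
        (fun i => v (.inr (.inl (Fin.ofNat (m + 2) i)))) (m + 1) (v (.inr (.inr 1)))
        (v (.inr (.inr 2))) :=
    sigmaPred_hasExtension (ι := ι) hn Sum.inl (Sum.inr (Sum.inr 0))
      (fun i => Sum.inr (Sum.inl (Fin.ofNat (m + 2) i))) (Sum.inr (Sum.inr 1)) (Sum.inr (Sum.inr 2))
  let v : ι → ZFSet.{u} := Sum.elim codingConst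
    (Sum.elim (fun i => sigmaCodes i) ![formulaCodes, η'.toZFSet, δ'.toZFSet])
  have hωl := hω.trans h1
  have hv : ∀ i, v i ∈ V_ lam' := by
    rintro (i | i | i)
    · exact codingConst_mem hωl i
    · exact codeSet_mem hωl _
    · fin_cases i
      exacts [codeSet_mem hωl _, toZFSet_mem_vonNeumann.2 ha', toZFSet_mem_vonNeumann.2 h1]
  have key := (hP.appSet_iff (j := j) h3 (hcorr _) v hv).1 hext
  refine (hasExtension_iff hF hη).1 ?_
  convert key using 1
  · funext i
    exact (appSet_eq_self hlim hj (codingConst_mem hω i)).symm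
  · exact (appSet_eq_self hlim hj (codeSet_mem hω _)).symm
  · funext i
    exact (appSet_eq_self hlim hj (codeSet_mem hω _)).symm
  · exact (hja ▸ appSet_toZFSet ha').symm
  · exact (hjδ ▸ appSet_toZFSet h1).symm

end Backward

/-! ### Extendible implies supercompact. -/

section Forward

variable {n : ℕ} {δ : Ordinal.{u}}

theorem IsCExtendible.exists_embedding (h : IsCExtendible n δ) {lam : Ordinal.{u}} (hlam : δ < lam)
    :
    ∃ (μ : Ordinal.{u}) (j : (V_ lam : ZFSet.{u}) ↪ₑ[setLang] (V_ μ : ZFSet.{u})),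
      IsCriticalPoint j δ ∧ lam < appOrd j δ ∧ appOrd j δ ∈ sigmaCorrect n := by
  obtain ⟨μ, j, hj, θ, hθ, h1, h2⟩ := h.2 lam hlam
  rw [sends_toZFSet hlam] at hθ
  subst hθ
  exact ⟨μ, j, hj, h1, h2⟩

/-- `V_ δ` is elementary in `V_ (appOrd j δ)`. Σ_{n+1} truths of the latter rise to the universe,
and those of the universe reach it through `V_ μ`. -/
theorem IsCExtendible.mem_sigmaCorrect (h : IsCExtendible n δ) : δ ∈ sigmaCorrect (n + 1) := by
  obtain ⟨μ, hμ, hcorr⟩ := exists_forall_mem_sigmaCorrect δ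
  have hlim := add_one_lt_of_sigmaCorrect (hcorr (n + 1))
  obtain ⟨β, j, hj, h1, h2⟩ := h.exists_embedding hμ
  have hsub := ZFSet.vonNeumann_subset_of_le h1.le
  intro k φ hφ v
  have hδκ := ZFSet.vonNeumann_subset_of_le (lt_appOrd_of_isCriticalPoint hj).le
  have h3 := realize_iff_of_isCriticalPoint hlim hj φ v (fun i => inclusionMap hδκ (v i))
    fun _ => rfl
  rw [← h3]
  constructor
  · intro h4
    rw [Formula.Realize]
    exact (iff_of_eq (congrArg _ (Subsingleton.elim _ _))).1
      ((sigmaCorrect_iff.1 h2).realize_of_realize hφ _ _ h4)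
  · intro h4
    let v' : Fin k → (V_ μ : ZFSet.{u}) :=
      fun i => inclusionMap (ZFSet.vonNeumann_subset_of_le hμ.le) (v i)
    exact (((sigmaCorrect_iff.1 (hcorr (n + 1))).inclusionMap hsub h2) k φ hφ v').1
      ((hcorr (n + 1) k φ hφ v').2 h4)

/-- `p` describes a level `w = V_{λ'}` with `λ' < δ`, an elementary embedding `w → L` with critical
point `δ'` which maps `δ'` to `δ` and `a'` to `a`, and witnesses that the inclusion of `w` in `D`
preserves the formulas with code in `F`. Here `r` is the rank function on `D`. -/
def IsReflection (K : Fin 6 → ZFSet.{u}) (G F D L r a δ : ZFSet.{u}) (p : Fin 14 → ZFSet.{u}) :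
    Prop :=
  p 1 ∈ δ ∧ p 2 ∈ p 1 ∧ p 0 ⊆ D ∧
  (∀ x ∈ D, (x ∈ p 0 ↔ ∃ β, ZFSet.pair x β ∈ r ∧ β ∈ p 1)) ∧ p 3 ∈ p 0 ∧
  (IsSatMap K (p 0) (p 5) (p 6) L (p 7) (p 8) (p 4) ∧
    Preserves (K 0) G (p 5) (p 6) (p 7) (p 8) (p 4)) ∧
  (∀ γ ∈ p 2, ZFSet.pair γ γ ∈ p 4) ∧ ZFSet.pair (p 2) δ ∈ p 4 ∧ ZFSet.pair (p 3) a ∈ p 4 ∧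
  (IsSatMap K (p 0) (p 10) (p 11) D (p 12) (p 13) (p 9) ∧ (∀ x ∈ p 0, ZFSet.pair x x ∈ p 9) ∧
    Preserves (K 0) F (p 10) (p 11) (p 12) (p 13) (p 9))

theorem deltaZero_isReflection : DeltaZero fun u : (Fin 6 ⊕ Fin 7) ⊕ Fin 14 → ZFSet.{u} =>
    IsReflection (fun i => u (.inl (.inl i))) (u (.inl (.inr 0))) (u (.inl (.inr 1)))
      (u (.inl (.inr 2))) (u (.inl (.inr 3))) (u (.inl (.inr 4))) (u (.inl (.inr 5)))
      (u (.inl (.inr 6))) fun i => u (.inr i) := by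
  unfold IsReflection
  infer_instance

theorem IsReflection.of_appSet {α β : Ordinal.{u}}
    {j : (V_ α : ZFSet.{u}) ↪ₑ[setLang] (V_ β : ZFSet.{u})} {K : Fin 6 → ZFSet.{u}}
    {G F D L r a d : ZFSet.{u}} {p : Fin 14 → ZFSet.{u}} (hK : ∀ i, K i ∈ V_ α) (hG : G ∈ V_ α)
    (hF : F ∈ V_ α) (hD : D ∈ V_ α) (hL : L ∈ V_ α) (hr : r ∈ V_ α) (ha : a ∈ V_ α) (hd : d ∈ V_ α)
    (hp : ∀ k, p k ∈ V_ β)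
    (h : IsReflection (fun i => appSet j (K i)) (appSet j G) (appSet j F) (appSet j D)
      (appSet j L) (appSet j r) (appSet j a) (appSet j d) p) :
    ∃ p, IsReflection K G F D L r a d p := by
  have hv : ∀ i, (Sum.elim K ![G, F, D, L, r, a, d] : Fin 6 ⊕ Fin 7 → ZFSet.{u}) i ∈ V_ α := by
    rintro (i | i)
    · exact hK i
    · fin_cases i <;> assumption
  obtain ⟨p, -, hp⟩ := (deltaZero_isReflection.appSet_exists (j := j) _ hv).2 ⟨p, hp, h⟩
  exact ⟨p, hp⟩

/-- The rank function on `V_ δ` identifies `p 0` as a level, and its Σ_n-elementarity in `V_ δ`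
composes with the correctness of `δ`. -/
theorem IsReflection.exists_embedding {L a : ZFSet.{u}} {p : Fin 14 → ZFSet.{u}}
    (h : IsReflection codingConst formulaCodes (sigmaCodes n) (V_ δ) L (rankFn (V_ δ)) a
      δ.toZFSet p) (hδ : δ ∈ sigmaCorrect n) {lam : Ordinal.{u}} (hL : L = V_ lam) :
    ∃ δ' lam' : Ordinal.{u}, δ' < lam' ∧ lam' < δ ∧ lam' ∈ sigmaCorrect n ∧
      ∃ a' : ZFSet.{u}, a' ∈ V_ lam' ∧
        ∃ j : (V_ lam' : ZFSet.{u}) ↪ₑ[setLang] (V_ lam : ZFSet.{u}),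
          IsCriticalPoint j δ' ∧ Sends j δ'.toZFSet δ.toZFSet ∧ Sends j a' a := by
  subst hL
  obtain ⟨h1, h2, h3, h4, h5, ⟨h6, h7⟩, h8, h9, h10, h11, h12, h13⟩ := h
  obtain ⟨lam', hlam', he⟩ := mem_toZFSet_iff.1 h1
  rw [← he] at h2 h4
  obtain ⟨δ', hδ', he'⟩ := mem_toZFSet_iff.1 h2
  rw [← he'] at h8 h9
  have hsub := ZFSet.vonNeumann_subset_of_le hlam'.le
  have hw : p 0 = V_ lam' := by
    have hr := isRankFn_rankFn (ZFSet.isTransitive_vonNeumann δ)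
    ext x
    constructor
    · intro hx
      exact (hr.mem_iff (h3 hx) lam').1 ((h4 x (h3 hx)).1 hx)
    · intro hx
      exact (h4 x (hsub hx)).2 ((hr.mem_iff (hsub hx) lam').2 hx)
  rw [hw] at h5 h6 h11
  have hmem : ∀ {γ}, γ < lam' → γ.toZFSet ∈ V_ lam' := toZFSet_mem_vonNeumann.2
  obtain ⟨j, hj⟩ := h6.exists_elementaryEmbedding h7
  have hjδ : Sends j δ'.toZFSet δ.toZFSet := ⟨hmem hδ', ((hj ⟨_, hmem hδ'⟩ _).1 h9).symm⟩
  obtain ⟨g, hg⟩ := h11.exists_fun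
  have hinc : SigmaElementary n (inclusionMap hsub) := by
    have : g = inclusionMap hsub := by
      funext x
      exact (Subtype.ext ((hg x x).1 (h12 x (by rw [hw]; exact x.2)))).symm
    rw [← this]
    exact (h11.preserves_iff hg _).1 h13
  refine ⟨δ', lam', hδ', hlam', fun k φ hφ v => (hinc k φ hφ v).trans (hδ k φ hφ _), p 3, h5, j,
    isCriticalPoint_iff.2 ⟨hδ', ?_, fun γ hγ => ?_⟩, hjδ, ⟨h5, ((hj ⟨_, h5⟩ _).1 h10).symm⟩⟩
  · rw [(sends_toZFSet hδ').1 hjδ]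
    exact (hδ'.trans hlam').ne'
  · rw [← sends_toZFSet (hγ.trans hδ')]
    exact ⟨hmem (hγ.trans hδ'), ((hj ⟨_, hmem (hγ.trans hδ')⟩ _).1
      (h8 _ (toZFSet_mem_toZFSet_iff.2 hγ))).symm⟩

theorem IsCExtendible.isSigmaSupercompact (h : IsCExtendible n δ) :
    IsSigmaSupercompact (n + 1) δ := by
  intro lam hlam hlamC a ha
  have hδ := h.mem_sigmaCorrect
  have hω := omega_lt_of_sigmaCorrect hδ
  -- Here `μ` only has to be a limit above `lam`, so that `j` restricts to `V_ lam` and the required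
  -- sets lie in the levels.
  obtain ⟨μ, hμ, hcorr⟩ := exists_forall_mem_sigmaCorrect lam
  have hlim := add_one_lt_of_sigmaCorrect (hcorr (n + 1))
  have hδμ := hlam.trans hμ
  obtain ⟨β, j, hj, hκμ, hκ⟩ := h.exists_embedding hδμ
  have hβ := forall_add_one_lt_of_elementary j hlim
  have hδκ := lt_appOrd_of_isCriticalPoint hj
  have hκβ := appOrd_lt (j := j) hδμ
  have hlβ := appOrd_lt (j := j) hμ
  have hωβ := (hω.trans hδκ).trans hκβ
  have hlκ := hμ.trans hκμ
  have haμ : a ∈ V_ μ := ZFSet.vonNeumann_subset_of_le hμ.le ha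
  have hfix : ∀ {x}, x ∈ V_ δ → appSet j x = x := appSet_eq_self hlim hj
  have hδV := ZFSet.vonNeumann_mem_of_lt hδμ
  have hrμ : rankFn (V_ δ) ∈ V_ μ := rankFn_mem_vonNeumann hlim hδV
  have hr : IsRankFn (appSet j (rankFn (V_ δ))) (V_ (appOrd j δ)) := by
    rw [← appSet_vonNeumann hlim hδμ]
    exact (DeltaZero.appSet_iff (DeltaZero.isRankFn (0 : Fin 2) 1) ![rankFn (V_ δ), V_ δ] (by
      intro i; fin_cases i <;> assumption)).1 (isRankFn_rankFn (ZFSet.isTransitive_vonNeumann δ))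
  let i := restrictEmb j hlim hμ
  have hsub := ZFSet.vonNeumann_subset_of_le hlκ.le
  have hlβ' := hlκ.trans hκβ
  have hne : (V_ lam : ZFSet.{u}).Nonempty := nonempty_vonNeumann ((zero_le (a := δ)).trans_lt hlam)
  have hne' : (V_ (appOrd j lam) : ZFSet.{u}).Nonempty :=
    ZFSet.nonempty_of_mem (i ⟨a, ha⟩).2
  have hneκ : (V_ (appOrd j δ) : ZFSet.{u}).Nonempty :=
    nonempty_vonNeumann ((zero_le (a := δ)).trans_lt hδκ)
  have hV := @ZFSet.vonNeumann_mem_of_lt.{u}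
  have hgraph : ∀ {x y : ZFSet.{u}} (hx : x ∈ V_ lam), appSet j x = y →
      ZFSet.pair x y ∈ graph i := by
    intro x y hx hxy
    refine (pair_mem_graph i ⟨x, hx⟩ y).2 ?_
    rw [← hxy, ← appSet_restrictEmb hlim hμ hx, ← appSet_coe]
  let p : Fin 14 → ZFSet.{u} := ![V_ lam, lam.toZFSet, δ.toZFSet, a, graph i, allAssignments
    (V_ lam), satRel (V_ lam),
      allAssignments (V_ (appOrd j lam)), satRel (V_ (appOrd j lam)),
      graph (inclusionMap hsub), allAssignments (V_ lam), satRel (V_ lam),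
      allAssignments (V_ (appOrd j δ)), satRel (V_ (appOrd j δ))]
  have hp : ∀ k, p k ∈ V_ β := by
    intro i
    fin_cases i
    exacts [hV hlβ', toZFSet_mem_vonNeumann.2 hlβ', toZFSet_mem_vonNeumann.2 (hδκ.trans hκβ),
      ZFSet.vonNeumann_subset_of_le hlβ'.le ha, graph_mem hβ _ (hV hlβ') (hV hlβ),
      allAssignments_mem hβ hωβ (hV hlβ'), satRel_mem hβ hωβ (hV hlβ'),
      allAssignments_mem hβ hωβ (hV hlβ), satRel_mem hβ hωβ (hV hlβ),
      graph_mem hβ _ (hV hlβ') (hV hκβ), allAssignments_mem hβ hωβ (hV hlβ'),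
      satRel_mem hβ hωβ (hV hlβ'), allAssignments_mem hβ hωβ (hV hκβ),
      satRel_mem hβ hωβ (hV hκβ)]
  -- From the point of view of `j(δ)`, the ordinals `lam` and `δ` themselves play the roles of
  -- `lam'` and `δ'`. The last clause uses `lam ∈ C^(n+1)` and `j(δ) ∈ C^(n)`.
  have hrefl : IsReflection codingConst formulaCodes (sigmaCodes (n + 1)) (V_ (appOrd j δ))
      (V_ (appOrd j lam)) (appSet j (rankFn (V_ δ))) (appSet j a) (appOrd j δ).toZFSet p := by
    refine ⟨toZFSet_mem_toZFSet_iff.2 hlκ, toZFSet_mem_toZFSet_iff.2 hlam, hsub,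
      fun x hx => (hr.mem_iff hx lam).symm, ha, ⟨isSatMap_graph hne hne' i,
      preserves_graph hne hne' i⟩, fun γ hγ => ?_,
      hgraph (toZFSet_mem_vonNeumann.2 hlam) (appSet_toZFSet hδμ), hgraph ha rfl,
      isSatMap_graph hne hneκ _,
      fun x hx => (pair_mem_graph (inclusionMap hsub) ⟨x, hx⟩ x).2 rfl, ?_⟩
    · obtain ⟨ξ, hξ, rfl⟩ := mem_toZFSet_iff.1 hγ
      exact hgraph (toZFSet_mem_vonNeumann.2 (hξ.trans hlam))
        (hfix (toZFSet_mem_vonNeumann.2 hξ))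
    · exact ((isSatMap_graph hne hneκ _).preserves_iff (pair_mem_graph _) _).2
        ((sigmaCorrect_iff.1 hlamC).inclusionMap hsub hκ)
  have hK : (fun i => appSet j (codingConst i)) = codingConst :=
    funext fun i => hfix (codingConst_mem hω i)
  have hcode : ∀ N, appSet j (codeSet N) = codeSet N := fun N => hfix (codeSet_mem hω N)
  obtain ⟨q, hq⟩ := IsReflection.of_appSet (j := j) (G := formulaCodes) (F := sigmaCodes (n + 1))
    (codingConst_mem (hω.trans hδμ)) (codeSet_mem (hω.trans hδμ) _)
    (codeSet_mem (hω.trans hδμ) _) hδV (hV hμ) hrμ haμ (toZFSet_mem_vonNeumann.2 hδμ) hp (by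
      rw [hK, formulaCodes, sigmaCodes, hcode, hcode, appSet_vonNeumann hlim hδμ,
        appSet_vonNeumann hlim hμ, appSet_toZFSet hδμ]
      exact hrefl)
  exact hq.exists_embedding hδ rfl

end Forward

/-! ### Mostowski collapse. -/

section Collapse

/-- The Mostowski collapse of the membership relation restricted to `X`. -/
noncomputable def collapse (X : Set ZFSet.{u}) (x : ZFSet.{u}) : ZFSet.{u} :=
  ZFSet.range fun y : (x.sep (· ∈ X) : ZFSet.{u}) => collapse X y
termination_by x
decreasing_by exact (ZFSet.mem_sep.1 y.2).1

variable {X : Set ZFSet.{u}} {x y : ZFSet.{u}}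

theorem mem_collapse {z : ZFSet.{u}} : z ∈ collapse X x ↔ ∃ y ∈ x, y ∈ X ∧ collapse X y = z := by
  rw [collapse]
  simp [ZFSet.mem_range, and_assoc]

theorem collapse_eq_self {t : ZFSet.{u}} (ht : t.IsTransitive) (htX : ∀ x ∈ t, x ∈ X)
    (hx : x ∈ t) : collapse X x = x := by
  induction x using ZFSet.inductionOn with
  | _ x ih =>
  ext z
  rw [mem_collapse]
  constructor
  · rintro ⟨y, hy, -, rfl⟩
    rwa [ih y hy (ht.subset_of_mem hx hy)]
  · intro hz
    have hzt := ht.subset_of_mem hx hz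
    exact ⟨z, hz, htX z hzt, ih z hz hzt⟩

theorem collapse_injOn (hX : ∀ x ∈ X, ∀ y ∈ X, (∀ z ∈ X, z ∈ x ↔ z ∈ y) → x = y) (hx : x ∈ X)
    (hy : y ∈ X) (h : collapse X x = collapse X y) : x = y := by
  induction x using ZFSet.inductionOn generalizing y with
  | _ x ih =>
  refine hX x hx y hy fun z hz => ⟨fun hzx => ?_, fun hzy => ?_⟩
  · have h1 : collapse X z ∈ collapse X y := h ▸ mem_collapse.2 ⟨z, hzx, hz, rfl⟩
    obtain ⟨w, hw, hwX, h2⟩ := mem_collapse.1 h1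
    rwa [ih z hzx hz hwX h2.symm]
  · have h1 : collapse X z ∈ collapse X x := h ▸ mem_collapse.2 ⟨z, hzy, hz, rfl⟩
    obtain ⟨w, hw, hwX, h2⟩ := mem_collapse.1 h1
    rwa [← ih w hw hwX hz h2]

theorem collapse_mem_collapse (hX : ∀ x ∈ X, ∀ y ∈ X, (∀ z ∈ X, z ∈ x ↔ z ∈ y) → x = y)
    (hx : x ∈ X) : collapse X x ∈ collapse X y ↔ x ∈ y := by
  rw [mem_collapse]
  constructor
  · rintro ⟨z, hz, hzX, h⟩
    rwa [← collapse_injOn hX hzX hx h]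
  · exact fun h => ⟨x, h, hx, rfl⟩

end Collapse

/-! ### A criterion for C^(1), and the case of extendible cardinals. -/

section CorrectLevel

instance (n : ℕ) : Subsingleton (MemRel n) :=
  ⟨fun a b => by cases a; cases b; rfl⟩

theorem card_setLang_le : setLang.card ≤ Cardinal.aleph0 := by
  have h1 : ∀ n, Countable (setLang.Functions n) := fun n => inferInstanceAs (Countable Empty)
  have h2 : ∀ n, Countable (setLang.Relations n) := fun n => inferInstanceAs (Countable (MemRel n))
  have : Countable setLang.Symbols := inferInstanceAs (Countable (_ ⊕ _))
  exact Cardinal.mk_le_aleph0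

theorem exists_rank_eq {N : ZFSet.{u}} (hN : N.IsTransitive) {ξ : Ordinal.{u}} (hξ : ξ < N.rank) :
    ∃ x ∈ N, x.rank = ξ := by
  have : ∀ x, x ⊆ N → ξ < x.rank → ∃ y ∈ N, y.rank = ξ := by
    intro x
    induction x using ZFSet.inductionOn with
    | _ x ih =>
    intro hx h
    obtain ⟨y, hy, h1⟩ := ZFSet.lt_rank_iff.1 h
    rcases h1.eq_or_lt with h1 | h1
    · exact ⟨y, hx hy, h1.symm⟩
    · exact ih y hy (hN.subset_of_mem (hx hy)) h1
  exact this N (fun _ h => h) hξ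

theorem card_rank_le {N : ZFSet.{u}} (hN : N.IsTransitive) : N.rank.card ≤ N.card := by
  rw [← card_toZFSet]
  refine IsSurjection.card_le (f := rankFn N) ⟨fun y hy => ?_, fun ξ _ y hy z hz => ?_⟩
  · obtain ⟨ξ, hξ, rfl⟩ := mem_toZFSet_iff.1 hy
    obtain ⟨x, hx, rfl⟩ := exists_rank_eq hN hξ
    exact ⟨x, hx, pair_mem_rankFn.2 ⟨hx, rfl⟩⟩
  · rw [(pair_mem_rankFn.1 hy).2, (pair_mem_rankFn.1 hz).2]

/-- The downward Löwenheim–Skolem theorem with transitive models. -/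
theorem exists_transitive_card_eq {ν : Ordinal.{u}} {t : ZFSet.{u}}
    (ht : t.IsTransitive) (hω : (ω : Ordinal.{u}).toZFSet ⊆ t) (htν : t ⊆ V_ ν) :
    ∃ N : ZFSet.{u}, N.IsTransitive ∧ N.card = t.card ∧ ∃ h : t ⊆ N,
      ∀ {ι : Type} (φ : setLang.Formula ι) (v : ι → t),
        φ.Realize (fun i => inclusionMap htν (v i)) ↔ φ.Realize fun i => inclusionMap h (v i) := by
  let s : Set (V_ ν : ZFSet.{u}) := Set.range (inclusionMap htν)
  have hinj : Function.Injective (inclusionMap htν) := fun x y hxy =>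
    Subtype.ext (congrArg (fun z : (V_ ν : ZFSet.{u}) => (z : ZFSet.{u})) hxy)
  have hℵ : Cardinal.aleph0 ≤ Cardinal.mk t := by
    rw [ZFSet.cardinalMk_coe_sort, Cardinal.aleph0_le_lift]
    have := ZFSet.card_mono hω
    rwa [card_toZFSet, card_omega0] at this
  obtain ⟨S, hS, hcard⟩ := exists_elementarySubstructure_card_eq setLang s (Cardinal.mk t) hℵ
    (by simpa [s] using Cardinal.mk_range_le)
    (by simpa using (Cardinal.lift_le_aleph0.2 card_setLang_le).trans hℵ)
    (by simpa using Cardinal.mk_le_of_injective hinj)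
  have hts : ∀ x (hx : x ∈ t), (⟨x, htν hx⟩ : (V_ ν : ZFSet.{u})) ∈ S := fun x hx =>
    hS ⟨⟨x, hx⟩, rfl⟩
  let X : Set ZFSet.{u} := Set.range fun x : S => ((x : (V_ ν : ZFSet.{u})) : ZFSet.{u})
  -- `X` inherits extensionality from the transitive set `V_ ν` by elementarity, so the collapse is
  -- an isomorphism; it fixes the transitive set `t ⊆ X`.
  have hX : ∀ x ∈ X, ∀ y ∈ X, (∀ z ∈ X, z ∈ x ↔ z ∈ y) → x = y := by
    rintro _ ⟨x, rfl⟩ _ ⟨y, rfl⟩ h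
    let φ : setLang.Formula (Fin 2) := .all ((memFormula (.var (.inr 0)) (.var (.inl 0))).iff
      (memFormula (.var (.inr 0)) (.var (.inl 1))))
    have h1 : φ.Realize ![x, y] := by
      simp only [φ, Formula.Realize, BoundedFormula.realize_all, BoundedFormula.realize_iff]
      exact fun z => h _ ⟨z, rfl⟩
    rw [← S.subtype.map_formula] at h1
    simp only [φ, Formula.Realize, BoundedFormula.realize_all, BoundedFormula.realize_iff,
      realize_memFormula_set] at h1
    have htr := ZFSet.isTransitive_vonNeumann ν
    ext z
    exact ⟨fun hz => (h1 ⟨z, htr.subset_of_mem x.1.2 hz⟩).1 hz,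
      fun hz => (h1 ⟨z, htr.subset_of_mem y.1.2 hz⟩).2 hz⟩
  let N : ZFSet.{u} := ZFSet.range fun x : S => collapse X x
  have hNmem : ∀ {z}, z ∈ N ↔ ∃ x ∈ X, collapse X x = z := by
    intro z
    simp [N, X, ZFSet.mem_range]
  have hNt : ∀ x ∈ t, collapse X x = x := fun x hx =>
    collapse_eq_self ht (fun y hy => ⟨⟨_, hts y hy⟩, rfl⟩) hx
  let g : S → N := fun x => ⟨collapse X x, hNmem.2 ⟨_, ⟨x, rfl⟩, rfl⟩⟩
  have hg : Function.Bijective g := by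
    constructor
    · intro x y hxy
      exact Subtype.ext (Subtype.ext (collapse_injOn hX ⟨x, rfl⟩ ⟨y, rfl⟩
        (congrArg (fun z : N => (z : ZFSet.{u})) hxy)))
    · rintro ⟨z, hz⟩
      obtain ⟨_, ⟨x, rfl⟩, rfl⟩ := hNmem.1 hz
      exact ⟨x, rfl⟩
  let e : S ≃[setLang] N :=
    { Equiv.ofBijective g hg with
      map_fun' := fun f => f.elim
      map_rel' := fun r v => by
        cases r
        exact collapse_mem_collapse hX ⟨v 0, rfl⟩ }
  have htN : t ⊆ N := fun x hx => hNmem.2 ⟨x, ⟨⟨_, hts x hx⟩, rfl⟩, hNt x hx⟩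
  refine ⟨N, fun z hz => fun w hw => ?_, ?_, htN, fun φ v => ?_⟩
  · obtain ⟨x, -, rfl⟩ := hNmem.1 hz
    obtain ⟨y, -, hy, rfl⟩ := mem_collapse.1 hw
    exact hNmem.2 ⟨y, hy, rfl⟩
  · rw [← Cardinal.lift_inj.{u, u + 1}, ← ZFSet.cardinalMk_coe_sort, ← ZFSet.cardinalMk_coe_sort,
      ← Cardinal.mk_congr e.toEquiv]
    simpa using hcard
  · let w : _ → S := fun i => ⟨_, hts (v i) (v i).2⟩
    have h1 := S.subtype.map_formula φ w
    have h2 := StrongHomClass.realize_formula e φ (v := w)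
    have h3 : e ∘ w = fun i => inclusionMap htN (v i) :=
      funext fun i => Subtype.ext (hNt _ (v i).2)
    rw [← h3, h2, ← h1]
    rfl

/-- A true Σ_1 formula holds in a transitive `N` of the size of some `V_ γ`, `γ < κ`, containing the
parameters. By the surjections this size is less than that of `κ`, so `N` has rank below `κ`, lies
in `V_ κ`, and the formula rises from `N` to `V_ κ`. -/
theorem HasSurjections.mem_sigmaCorrect {κ : Ordinal.{u}} (h : HasSurjections κ)
    (hκ : ∀ ξ < κ, ξ + 1 < κ) (hω : ω < κ) : κ ∈ sigmaCorrect 1 := by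
  have hinit := h.isInitial hκ
  refine (sigmaElementary_zero_val (ZFSet.isTransitive_vonNeumann κ)).succ fun k φ hφ v hv => ?_
  obtain ⟨ν, hν, hcorr⟩ := exists_forall_mem_sigmaCorrect κ
  let ρ : Ordinal.{u} := Finset.univ.sup fun i => (v i : ZFSet.{u}).rank + 1
  have hρ : ρ < κ := (Finset.sup_lt_iff ((zero_le (a := ω)).trans_lt hω)).2
    fun i _ => hκ _ (ZFSet.mem_vonNeumann.1 (v i).2)
  have hγ : max ω ρ < κ := max_lt hω hρ
  have htν := ZFSet.vonNeumann_subset_of_le (hγ.trans hν).le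
  obtain ⟨N, hN, hcard, htN, hreal⟩ := exists_transitive_card_eq
    (ZFSet.isTransitive_vonNeumann (max ω ρ))
    (fun x hx => ZFSet.vonNeumann_subset_of_le (le_max_left _ _)
      (Ordinal.toZFSet_subset_vonNeumann _ hx)) htν
  have hvt : ∀ i, (v i : ZFSet.{u}) ∈ V_ (max ω ρ) := fun i => ZFSet.mem_vonNeumann.2 <|
    (lt_add_one _).trans_le ((Finset.le_sup (f := fun i => (v i : ZFSet.{u}).rank + 1)
      (Finset.mem_univ i)).trans (le_max_right _ _))
  have hNκ : N ⊆ V_ κ := by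
    obtain ⟨γ, hγ', f, -, hf⟩ := h _ (ZFSet.vonNeumann_mem_of_lt hγ)
    have h1 := ((card_rank_le hN).trans hcard.le).trans hf.card_le
    rw [card_toZFSet] at h1
    refine ZFSet.subset_vonNeumann.2 (le_of_lt ?_)
    rw [← hinit.ord_card, Cardinal.lt_ord] at hγ' ⊢
    exact h1.trans_lt hγ'
  have h1 : φ.Realize fun i => inclusionMap htν ⟨v i, hvt i⟩ :=
    (hcorr 1 k φ hφ _).2 hv
  rw [hreal φ fun i => ⟨v i, hvt i⟩] at h1
  have h2 : SigmaElementary 0 (inclusionMap hNκ) := fun k φ hφ w => by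
    rw [sigmaElementary_zero_val hN k φ hφ,
      sigmaElementary_zero_val (ZFSet.isTransitive_vonNeumann κ) k φ hφ]
    rfl
  have h3 := h2.realize_of_realize hφ _ _ h1
  rw [Formula.Realize]
  exact (iff_of_eq (congrArg _ (Subsingleton.elim _ _))).1 h3

/-- C^(0) contains every ordinal, so the case `n = 0` of the forward argument gives `δ ∈ C^(1)`. The
surjection property of `δ` is Δ₀ in `V_ δ` and `δ`, so it passes to `j(δ)`. -/
theorem IsExtendible.isCExtendible {δ : Ordinal.{u}} (h : IsExtendible δ) : IsCExtendible 1 δ := by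
  have h0 : IsCExtendible 0 δ := by
    refine ⟨h.1, fun lam hlam => ?_⟩
    obtain ⟨μ, j, hj, θ, hθ, h1⟩ := h.2 lam hlam
    exact ⟨μ, j, hj, θ, hθ, h1, mem_sigmaCorrect_zero θ⟩
  have hδ := h0.mem_sigmaCorrect
  have hω := omega_lt_of_sigmaCorrect hδ
  have hsurj := hasSurjections_of_mem_sigmaCorrect hδ
  have hlimδ := add_one_lt_of_sigmaCorrect hδ
  refine ⟨h.1, fun lam hlam => ?_⟩
  obtain ⟨μ, hμ, hcorr⟩ := exists_forall_mem_sigmaCorrect lam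
  have hlim := add_one_lt_of_sigmaCorrect (hcorr 1)
  have hδμ := hlam.trans hμ
  obtain ⟨β, j, hj, hκμ, -⟩ := h0.exists_embedding hδμ
  have hδκ := lt_appOrd_of_isCriticalPoint hj
  have hlimκ := forall_add_one_lt_of_elementary (restrictEmb j hlim hδμ) hlimδ
  have hsurjκ : HasSurjections (appOrd j δ) := by
    have h1 := (DeltaZero.appSet_iff (j := j) (inferInstance :
      DeltaZero fun v : Fin 2 → ZFSet.{u} =>
      ∀ x ∈ v 0, ∃ γ ∈ v 1, ∃ f ∈ v 0, IsSurjection f γ x) ![V_ δ, δ.toZFSet] (by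
        intro i; fin_cases i
        exacts [ZFSet.vonNeumann_mem_of_lt hδμ, toZFSet_mem_vonNeumann.2 hδμ])).1 (by
        intro x hx
        obtain ⟨γ, hγ, f, hf, h1⟩ := hsurj x hx
        exact ⟨_, toZFSet_mem_toZFSet_iff.2 hγ, f, hf, h1⟩)
    simp only [Matrix.cons_val_zero, Matrix.cons_val_one, Matrix.cons_val_fin_one,
      appSet_vonNeumann hlim hδμ, appSet_toZFSet hδμ] at h1
    intro x hx
    obtain ⟨γ, hγ, f, hf, h2⟩ := h1 x hx
    obtain ⟨γ, hγ', rfl⟩ := mem_toZFSet_iff.1 hγ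
    exact ⟨γ, hγ', f, hf, h2⟩
  refine ⟨_, restrictEmb j hlim hμ, isCriticalPoint_restrictEmb hlim hμ hlam hj, appOrd j δ, ?_,
    hμ.trans hκμ, hsurjκ.mem_sigmaCorrect hlimκ (hω.trans hδκ)⟩
  rw [sends_toZFSet hlam, appOrd_restrictEmb hlim hμ hlam]

end CorrectLevel

theorem theorem2p2 (δ : Ordinal.{u}) :
    (∀ n : ℕ, 1 ≤ n → (IsCExtendible n δ ↔ IsSigmaSupercompact (n + 1) δ)) ∧
      (IsExtendible δ ↔ IsSigmaSupercompact 2 δ) := by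
  have main : ∀ n : ℕ, 1 ≤ n → (IsCExtendible n δ ↔ IsSigmaSupercompact (n + 1) δ) :=
    fun n hn => ⟨fun h => h.isSigmaSupercompact, fun h => h.isCExtendible hn⟩
  refine ⟨main, ?_⟩
  rw [← main 1 le_rfl]
  refine ⟨fun h => h.isCExtendible, fun h => ⟨h.1, fun lam hlam => ?_⟩⟩
  obtain ⟨μ, j, hj, θ, hθ, h1, -⟩ := h.2 lam hlam
  exact ⟨μ, j, hj, θ, hθ, h1⟩
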